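/- Let $\mathsf k$ be a field, $M$ a lattice (a finitely generated free abelian group), $M_{\mathbb R}=\mathbb R\otimes M$, and let $C\subset M_{\mathbb R}$ be a rational polyhedral cone that is full dimensional and pointed (contains no line). Let $R=\mathsf k[C\cap M]$ be the toric algebra, spanned by the monomials $x^m$ with $m\in C\cap M$ in the Laurent ring $\mathsf k[M]$. For $v\in M_{\mathbb R}$ the conic module $A_v$ is the $M$-graded $R$-submodule of $\mathsf k[M]$ spanned by the $x^m$ with $m\in M\cap(C+v)$, and the chamber of constancy of $v$ is $\Delta=\{w\in M_{\mathbb R}: A_w=A_v\}$; one writes $A_\Delta=A_v$. Let $\Sigma_1\subset \mathrm{Hom}_{\mathbb Z}(M,\mathbb Z)$ be the set of primitive inward-pointing normals to the facets of $C$ (the primitive generators of the extremal rays of the dual cone of $C$). For a chamber $\Delta\ni v$ put $d_n=\lceil\langle v,n\rangle\rceil$ for $n\in\Sigma_1$. The cells of $\Delta$ are the non-empty sets among $$\tau_\Omega=\{x\in M_{\mathbb R}: d_n-1<\langle x,n\rangle<d_n\ \text{for } n\in\Omega,\quad \langle x,n\rangle=d_n\ \text{for } n\in\Sigma_1\setminus\Omega\},\qquad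 \Omega\subseteq\Sigma_1,$$ and the codimension of a cell is the codimension of its affine span in $M_{\mathbb R}$. Let $\mathbb A=\bigoplus_{i=1}^s A_{\Delta_i}^{d_i}$ be a complete sum of conic modules: the $d_i$ are positive integers and every conic module is isomorphic as an $R$-module to exactly one of the $A_{\Delta_i}$. For a chamber $\Delta$ let $P_\Delta=\mathrm{Hom}_R(\mathbb A,A_\Delta)$, an $M$-graded right $\mathrm{End}_R(\mathbb A)$-module by precomposition, and let $S_\Delta$ be its unique graded simple quotient, that is, the quotient of $P_\Delta$ by its unique maximal proper graded submodule. Then, for every chamber of constancy $\Delta$, the projective dimension of the right $\mathrm{End}_R(\mathbb A)$-module $S_\Delta$ equals the maximum of the codimensions of the cells of $\Delta$. In particular $\mathrm{pdim}(S_\Delta)\le \mathrm{rank}(M)$, with equality when $A_\Delta$ is a free $R$-module. -/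

import Mathlib

open scoped TensorProduct

noncomputable section

namespace ConicModules

universe u v

/-- The real vector space `M_ℝ = ℝ ⊗ M` of a lattice `M`. -/
abbrev RealSpace (M : Type v) [AddCommGroup M] : Type v := ℝ ⊗[ℤ] M

section Cones

variable {M : Type v} [AddCommGroup M]

/-- The inclusion `M → M_ℝ`, `m ↦ 1 ⊗ m`. -/
def latticePoint (m : M) : RealSpace M := (1 : ℝ) ⊗ₜ[ℤ] m

/-- A rational polyhedral cone: all non-negative real combinations of a finite set of lattice
vectors. -/
def IsRationalPolyhedral (C : PointedCone ℝ (RealSpace M)) : Prop :=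
  ∃ T : Finset M, C = PointedCone.hull ℝ (latticePoint '' (T : Set M))

/-- `C` is full dimensional: it spans `M_ℝ`. -/
def IsFullDimensional (C : PointedCone ℝ (RealSpace M)) : Prop :=
  Submodule.span ℝ (C : Set (RealSpace M)) = ⊤

/-- `C` is pointed (strongly convex): it contains no line. -/
def IsStronglyConvex (C : PointedCone ℝ (RealSpace M)) : Prop :=
  ∀ x ∈ C, -x ∈ C → x = 0

/-- The real linear functional `⟨·, n⟩` on `M_ℝ` given by `n` in the dual lattice
`N = Hom(M, ℤ)`. -/
def realFunctional (n : Module.Dual ℤ M) : Module.Dual ℝ (RealSpace M) :=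
  n.baseChange ℝ

/-- The dual cone `σ` of `C` in `N_ℝ`, as a set of linear functionals on `M_ℝ`. -/
def dualCone (C : PointedCone ℝ (RealSpace M)) : Set (Module.Dual ℝ (RealSpace M)) :=
  {w | ∀ x ∈ C, 0 ≤ w x}

/-- The set `Σ₁` of primitive inward-pointing normals to the facets of a full-dimensional
cone `C`: the primitive vectors `n` of the dual lattice that span the extremal rays of the
dual cone of `C`. -/
def primitiveNormals (C : PointedCone ℝ (RealSpace M)) : Set (Module.Dual ℤ M) :=
  {n | realFunctional n ∈ dualCone C ∧
    (∀ a ∈ dualCone C, ∀ b ∈ dualCone C, a + b = realFunctional n →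
      ∃ t : ℝ, 0 ≤ t ∧ a = t • realFunctional n) ∧
    ∀ ε : ℝ, 0 < ε → ε < 1 →
      ¬ ∃ n' : Module.Dual ℤ M, realFunctional n' = ε • realFunctional n}

/-- The lattice points `M ∩ (C + x)` of the translated cone `C + x`. -/
def translatePoints (C : PointedCone ℝ (RealSpace M)) (x : RealSpace M) : Set M :=
  {m | latticePoint m - x ∈ C}

end Cones

section Modules

variable (k : Type u) [Field k] {M : Type v} [AddCommGroup M]

/-- The toric algebra `k[C ∩ M]`: the subalgebra of the Laurent ring `k[M]` spanned by the
monomials with exponents in `C`. -/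
def toricAlgebra (C : PointedCone ℝ (RealSpace M)) : Subalgebra k (AddMonoidAlgebra k M) :=
  (AddMonoidAlgebra.supported k k (translatePoints C 0)).toSubalgebra
    (by
      rw [AddMonoidAlgebra.mem_supported']
      intro m hm
      have h0 : m ≠ 0 := by
        rintro rfl
        exact hm (by simp [translatePoints, latticePoint])
      rw [AddMonoidAlgebra.one_def, AddMonoidAlgebra.coeff_single]
      exact Finsupp.single_eq_of_ne h0)
    (by
      classical
      intro f g hf hg
      rw [AddMonoidAlgebra.mem_supported'] at *
      intro m hm
      rw [AddMonoidAlgebra.coeff_mul, Finsupp.sum]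
      refine Finset.sum_eq_zero fun a _ => ?_
      rw [Finsupp.sum]
      refine Finset.sum_eq_zero fun b _ => ?_
      split_ifs with h
      · by_cases ha : a ∈ translatePoints C 0
        · by_cases hb : b ∈ translatePoints C 0
          · refine absurd ?_ hm
            subst h
            simp only [translatePoints, latticePoint, sub_zero, Set.mem_ofPred_eq,
              TensorProduct.tmul_add] at *
            exact C.add_mem ha hb
          · simp [hg b hb]
        · simp [hf a ha]
      · rfl)

/-- The conic module `A_x`: the submodule over the toric algebra of the Laurent ring `k[M]`
spanned by the monomials with exponents in `C + x`. -/
def conicModule (C : PointedCone ℝ (RealSpace M)) (x : RealSpace M) :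
    Submodule (toricAlgebra k C) (AddMonoidAlgebra k M) where
  carrier := AddMonoidAlgebra.supported k k (translatePoints C x)
  add_mem' := fun hf hg => Submodule.add_mem _ hf hg
  zero_mem' := Submodule.zero_mem _
  smul_mem' := by
    classical
    rintro ⟨f, hf⟩ g hg
    change f * g ∈ AddMonoidAlgebra.supported k k (translatePoints C x)
    replace hf : f ∈ AddMonoidAlgebra.supported k k (translatePoints C 0) := hf
    replace hg : g ∈ AddMonoidAlgebra.supported k k (translatePoints C x) := hg
    rw [AddMonoidAlgebra.mem_supported'] at *
    intro m hm
    rw [AddMonoidAlgebra.coeff_mul, Finsupp.sum]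
    refine Finset.sum_eq_zero fun a _ => ?_
    rw [Finsupp.sum]
    refine Finset.sum_eq_zero fun b _ => ?_
    split_ifs with h
    · by_cases ha : a ∈ translatePoints C 0
      · by_cases hb : b ∈ translatePoints C x
        · refine absurd ?_ hm
          subst h
          simp only [translatePoints, latticePoint, sub_zero, Set.mem_ofPred_eq,
            TensorProduct.tmul_add, add_sub_assoc] at *
          exact C.add_mem ha hb
        · simp [hg b hb]
      · simp [hf a ha]
    · rfl

/-- The conic module `A_x` as a type of its own. -/
def ConicModule (C : PointedCone ℝ (RealSpace M)) (x : RealSpace M) : Type (max u v) :=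
  conicModule k C x

instance (C : PointedCone ℝ (RealSpace M)) (x : RealSpace M) :
    AddCommGroup (ConicModule k C x) :=
  (conicModule k C x).addCommGroup

instance (C : PointedCone ℝ (RealSpace M)) (x : RealSpace M) :
    Module (toricAlgebra k C) (ConicModule k C x) :=
  (conicModule k C x).module

/-- The inclusion of `A_x` in the Laurent ring `k[M]`. -/
def toLaurent {C : PointedCone ℝ (RealSpace M)} {x : RealSpace M} (f : ConicModule k C x) :
    AddMonoidAlgebra k M :=
  Subtype.val (p := (· ∈ conicModule k C x)) f

/-- The chamber of constancy containing `x`: all `y` with `A_y = A_x`. -/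
def chamber (C : PointedCone ℝ (RealSpace M)) (x : RealSpace M) : Set (RealSpace M) :=
  {y | conicModule k C y = conicModule k C x}

end Modules

section Cells

variable {M : Type v} [AddCommGroup M]

/-- For the numbers `d_n = ⌈⟨x, n⟩⌉`, `n ∈ Σ₁`, and a subset `Ω` of `Σ₁`, the set of all `y`
with `d_n - 1 < ⟨y, n⟩ < d_n` for `n ∈ Ω` and `⟨y, n⟩ = d_n` for `n ∈ Σ₁ \ Ω`. -/
def openCell (C : PointedCone ℝ (RealSpace M)) (x : RealSpace M)
    (Ω : Set (Module.Dual ℤ M)) : Set (RealSpace M) :=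
  {y | (∀ n ∈ Ω, (⌈realFunctional n x⌉ : ℝ) - 1 < realFunctional n y ∧
        realFunctional n y < ⌈realFunctional n x⌉) ∧
    ∀ n ∈ primitiveNormals C \ Ω, realFunctional n y = ⌈realFunctional n x⌉}

/-- The (non-empty) open cells of a chamber of constancy `Δ`. -/
def cells (C : PointedCone ℝ (RealSpace M)) (Δ : Set (RealSpace M)) :
    Set (Set (RealSpace M)) :=
  {τ | τ.Nonempty ∧ ∃ x ∈ Δ, ∃ Ω ⊆ primitiveNormals C, τ = openCell C x Ω}

/-- The codimension in `M_ℝ` of (the affine span of) a subset of `M_ℝ`. -/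
def codim (τ : Set (RealSpace M)) : ℕ :=
  Module.finrank ℝ (RealSpace M ⧸ (affineSpan ℝ τ).direction)

end Cells

section Endomorphisms

variable (k : Type u) [Field k] {M : Type v} [AddCommGroup M]
  (C : PointedCone ℝ (RealSpace M)) {s : ℕ} (c : Fin s → RealSpace M) (d : Fin s → ℕ)

/-- The direct sum `𝔸 = ⨁ i, A_{c i} ^ {d i}`. -/
abbrev ConicSum : Type (max u v) :=
  (p : Σ i : Fin s, Fin (d i)) → ConicModule k C (c p.1)

/-- `𝔸` is a complete sum of conic modules: all multiplicities are positive and every conic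
module is isomorphic to exactly one of the `A_{c i}`. -/
def IsCompleteSum : Prop :=
  (∀ i, 0 < d i) ∧
    ∀ x : RealSpace M, ∃! i, Nonempty (ConicModule k C x ≃ₗ[toricAlgebra k C]
      ConicModule k C (c i))

/-- The ring `End_R(𝔸)` of `R`-linear endomorphisms of `𝔸` (product: composition). -/
abbrev EndRing : Type (max u v) :=
  Module.End (toricAlgebra k C) (ConicSum k C c d)

/-- `P_Δ = Hom_R(𝔸, A_Δ)` for the chamber `Δ` of `x`. -/
def ProjectiveOf (x : RealSpace M) : Type (max u v) :=
  ConicSum k C c d →ₗ[toricAlgebra k C] ConicModule k C x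

instance (x : RealSpace M) : AddCommGroup (ProjectiveOf k C c d x) :=
  LinearMap.addCommGroup

/-- An element of `P_Δ` as a linear map. -/
def toHom {x : RealSpace M} (f : ProjectiveOf k C c d x) :
    ConicSum k C c d →ₗ[toricAlgebra k C] ConicModule k C x := f

/-- `P_Δ` is a right `End_R(𝔸)`-module by precomposition, `f · a = f ∘ a`; a right module is
a left module over the opposite ring. -/
instance (x : RealSpace M) : Module (EndRing k C c d)ᵐᵒᵖ (ProjectiveOf k C c d x) where
  smul a f := LinearMap.comp (toHom k C c d f) a.unop
  one_smul f := LinearMap.comp_id (toHom k C c d f)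
  mul_smul a b f := (LinearMap.comp_assoc a.unop b.unop (toHom k C c d f)).symm
  smul_zero a := LinearMap.zero_comp a.unop
  smul_add a f g := LinearMap.add_comp a.unop (toHom k C c d g) (toHom k C c d f)
  add_smul a b f := LinearMap.comp_add a.unop b.unop (toHom k C c d f)
  zero_smul f := LinearMap.comp_zero (toHom k C c d f)

/-- `f : 𝔸 → A_x` is homogeneous of degree `m` for the `M`-gradings: it maps elements of degree
`a` to elements of degree `a + m`. -/
def IsHomogeneousHom {x : RealSpace M} (m : M) (f : ProjectiveOf k C c d x) : Prop :=
  ∀ (a : M) (y : ConicSum k C c d),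
    (∀ p, toLaurent k (y p) ∈ AddMonoidAlgebra.grade k a) →
    toLaurent k (toHom k C c d f y) ∈ AddMonoidAlgebra.grade k (a + m)

/-- A right submodule `Q` of `P_Δ` is graded if each of its elements is a finite sum of
homogeneous elements of `Q`. -/
def IsGradedSubmodule {x : RealSpace M}
    (Q : Submodule (EndRing k C c d)ᵐᵒᵖ (ProjectiveOf k C c d x)) : Prop :=
  ∀ f ∈ Q, f ∈ AddSubmonoid.closure {g | g ∈ Q ∧ ∃ m : M, IsHomogeneousHom k C c d m g}

/-- The largest proper graded submodule of `P_Δ`, as the sum of all the proper graded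
submodules. (This sum is a graded submodule; it is the unique maximal one exactly if it is
proper, that is, if the quotient below is non-zero.) -/
def gradedRadical (x : RealSpace M) :
    Submodule (EndRing k C c d)ᵐᵒᵖ (ProjectiveOf k C c d x) :=
  sSup {Q | IsGradedSubmodule k C c d Q ∧ Q ≠ ⊤}

/-- The graded simple quotient `S_Δ` of `P_Δ`. -/
abbrev GradedSimple (x : RealSpace M) : Type (max u v) :=
  ProjectiveOf k C c d x ⧸ gradedRadical k C c d x

/-- The projective dimension of the right `End_R(𝔸)`-module `S_Δ`, an element of
`{-∞} ∪ ℕ ∪ {∞}` (and `-∞` only for the zero module). -/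
def pdimSimple (x : RealSpace M) : WithBot ℕ∞ :=
  CategoryTheory.projectiveDimension
    (ModuleCat.of (EndRing k C c d)ᵐᵒᵖ (GradedSimple k C c d x))

end Endomorphisms

end ConicModules

end

/-! Write `d_n` for the levels of `x`, and label a cell by the set `E` of normals that attain `d_n`
on it, the complement of `Ω`. Pushing a point of the cell slightly towards the interior of `C` leads
to a chamber whose levels are `d_n + 1` on `E` and `d_n` elsewhere; `cellPoint` represents it. The
projectives of these chambers, placed in homological degree `rk E` (the codimension of the cell) and
joined by inclusions with cellular incidence signs, form a projective resolution of the simple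
module. It does not split at its last step, so its length, the largest codimension, is the
projective dimension.

Exactness is a question about cells. A homomorphism of conic modules is multiplication by a Laurent
polynomial (`IsFullRational.toLaurent_apply`), and its exponents are constrained by one inequality
per facet (`IsFullRational.forall_add_mem_iff`). The resolution therefore decomposes over pairs
consisting of a summand `p` of the complete sum and an exponent `m`. With `w = c p + m`, the strand
of `(p, m)` is zero unless all levels of `w` are at least `d_n`; otherwise it is the cellular
complex of the cells whose labels lie in `F = {n | d_n < level w n}`. If `F` is empty, only the open
cell remains, and these strands make up the simple module, because the graded radical consists
exactly of the elements with no coefficient there (`gradedRadical_eq`). If `F` is non-empty, a small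
shift of `w` gives a point beyond the walls in `F` and within the other strips, and the cells
visible from it form an exact complex (`IsBeyond.isAcyclicOn`).

That exactness is proved by a sweep along a segment from a cell to the point beyond. For generic
starting point, the walls crossed last are parallel inside the cell; they cut the family of visible
cells into two families with fewer crossed walls, or into a pair of a cell and its facet. The signs
come from orienting a cell by the exterior product of a basis of its normals. The differential
squares to zero because cells two codimensions apart have exactly two cells between them
(`IsCell.exists_diamond`) and vectors anticommute in the exterior algebra.

For the lower bound, projective dimension below the length would provide a retraction of the last
differential (`exists_retraction_of_hasProjectiveDimensionLT`). This would require a non-zero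
constant coefficient in a map from a conic module to a strictly smaller one, which the facet
inequalities forbid (`resolutionMap_comp_ne_id`). Codimensions are at most the rank; when the conic
module is free it is a monomial translate of the toric algebra, so some lattice point lies on all
walls at once and, by pointedness, is a cell of full codimension. -/

noncomputable section

namespace ConicModules

/-! ### Farkas' lemma -/

/-- Farkas' lemma: a functional that is non-negative wherever finitely many functionals are
is a non-negative combination of them. -/
theorem exists_nonneg_sum_eq {V ι : Type*} [AddCommGroup V] [Module ℝ V] (s : Finset ι)
    (a : ι → Module.Dual ℝ V) (b : Module.Dual ℝ V)
    (h : ∀ x, (∀ i ∈ s, 0 ≤ a i x) → 0 ≤ b x) :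
    ∃ c : ι → ℝ, (∀ i, 0 ≤ c i) ∧ b = ∑ i ∈ s, c i • a i := by
  classical
  induction s using Finset.induction_on generalizing a b with
  | empty =>
    refine ⟨0, fun _ => le_rfl, ?_⟩
    ext x
    have h1 := h x (by simp)
    have h2 := h (-x) (by simp)
    simp only [map_neg] at h2
    simp only [Finset.sum_empty, LinearMap.zero_apply]
    linarith
  | insert j s hj ih =>
    by_cases hs : ∀ x, (∀ i ∈ s, 0 ≤ a i x) → 0 ≤ b x
    · obtain ⟨c, hc, hb⟩ := ih a b hs
      refine ⟨Function.update c j 0, fun i => ?_, ?_⟩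
      · by_cases hi : i = j
        · subst hi; simp
        · simp [hi, hc i]
      · rw [Finset.sum_insert hj, hb]
        simp only [Function.update_self, zero_smul, zero_add]
        refine Finset.sum_congr rfl fun i hi => ?_
        rw [Function.update_of_ne]
        rintro rfl
        exact hj hi
    · push Not at hs
      obtain ⟨x₀, hx₀, hb₀⟩ := hs
      have hj₀ : a j x₀ < 0 := by
        by_contra hcon
        push Not at hcon
        have := h x₀ (by
          intro i hi
          rcases Finset.mem_insert.1 hi with rfl | hi
          · exact hcon
          · exact hx₀ i hi)
        linarith
      set α : ℝ := -a j x₀ with hα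
      have hαpos : 0 < α := by rw [hα]; linarith
      -- These functionals are the old ones composed with the projection `x ↦ x + (a j x / α) • x₀`
      -- onto the kernel of `a j`, where the constraint for `j` holds trivially.
      obtain ⟨c, hc, hb⟩ := ih (fun i => a i + (a i x₀ / α) • a j) (b + (b x₀ / α) • a j) (by
        intro x hx
        have := h (x + (a j x / α) • x₀) (by
          intro i hi
          rcases Finset.mem_insert.1 hi with rfl | hi
          · have : (a i) (x + (a i x / α) • x₀) = 0 := by
              simp only [map_add, map_smul, smul_eq_mul]
              have : a i x₀ = -α := by simp [hα]
              rw [this]; field_simp; ring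
            rw [this]
          · have := hx i hi
            simp only [LinearMap.add_apply, LinearMap.smul_apply, smul_eq_mul, map_add,
              map_smul] at this ⊢
            convert this using 2
            ring)
        simp only [LinearMap.add_apply, LinearMap.smul_apply, smul_eq_mul, map_add,
          map_smul] at this ⊢
        convert this using 2
        ring)
      have hsum : 0 ≤ ∑ i ∈ s, c i * (a i x₀ / α) :=
        Finset.sum_nonneg fun i hi => mul_nonneg (hc i) (div_nonneg (hx₀ i hi) hαpos.le)
      -- The coefficient of `a j` is found by undoing the projection; it is non-negative because `b
      -- x₀ < 0` and every `a i x₀` with `i ∈ s` is non-negative.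
      refine ⟨Function.update c j ((∑ i ∈ s, c i * (a i x₀ / α)) - b x₀ / α), fun i => ?_, ?_⟩
      · by_cases hi : i = j
        · subst hi
          have : b x₀ / α ≤ 0 := div_nonpos_of_nonpos_of_nonneg hb₀.le hαpos.le
          simp only [Function.update_self]
          linarith
        · simp [hi, hc i]
      · rw [Finset.sum_insert hj]
        have h1 : ∑ i ∈ s, Function.update c j ((∑ i ∈ s, c i * (a i x₀ / α)) - b x₀ / α) i • a i
            = ∑ i ∈ s, c i • a i := by
          refine Finset.sum_congr rfl fun i hi => ?_
          rw [Function.update_of_ne]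
          rintro rfl
          exact hj hi
        rw [h1, Function.update_self]
        have h2 : b = ∑ i ∈ s, c i • (a i + (a i x₀ / α) • a j) - (b x₀ / α) • a j := by
          rw [← hb]; abel
        refine LinearMap.ext fun x => ?_
        have h3 := LinearMap.congr_fun h2 x
        have h4 : ∑ i ∈ s, c i * (a i x₀ / α * a j x)
            = (∑ i ∈ s, c i * (a i x₀ / α)) * a j x := by
          rw [Finset.sum_mul]
          exact Finset.sum_congr rfl fun i _ => by ring
        simp only [LinearMap.sub_apply, LinearMap.add_apply, LinearMap.smul_apply,
          LinearMap.sum_apply, smul_eq_mul, mul_add, Finset.sum_add_distrib, h4] at h3 ⊢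
        linarith

/-! ### Facets and primitive normals of a rational cone -/

section Polyhedral

variable {M : Type*} [AddCommGroup M]

@[simp] theorem realFunctional_latticePoint (n : Module.Dual ℤ M) (m : M) :
    realFunctional n (latticePoint m) = (n m : ℝ) := by
  simp [realFunctional, latticePoint]

theorem span_range_latticePoint :
    Submodule.span ℝ (Set.range (latticePoint : M → RealSpace M)) = ⊤ := by
  rw [eq_top_iff]
  rintro x -
  induction x using TensorProduct.induction_on with
  | zero => exact Submodule.zero_mem _
  | tmul r m =>
    have : r ⊗ₜ[ℤ] m = r • latticePoint m := by simp [latticePoint, TensorProduct.smul_tmul']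
    rw [this]
    exact Submodule.smul_mem _ _ (Submodule.subset_span ⟨m, rfl⟩)
  | add x y hx hy => exact Submodule.add_mem _ hx hy

theorem realFunctional_injective :
    Function.Injective (realFunctional : Module.Dual ℤ M → Module.Dual ℝ (RealSpace M)) := by
  intro n n' h
  ext m
  have := congrArg (fun w => w (latticePoint m)) h
  simpa using this

theorem realFunctional_smul (z : ℤ) (n : Module.Dual ℤ M) :
    realFunctional (z • n) = (z : ℝ) • realFunctional n := by
  apply LinearMap.ext_on_range span_range_latticePoint
  intro m
  simp

theorem mem_dualCone_hull {T : Set M} {w : Module.Dual ℝ (RealSpace M)} :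
    w ∈ dualCone (PointedCone.hull ℝ (latticePoint '' T)) ↔ ∀ t ∈ T, 0 ≤ w (latticePoint t) := by
  constructor
  · intro h t ht
    exact h _ (Submodule.subset_span ⟨t, ht, rfl⟩)
  · intro h x hx
    induction hx using Submodule.span_induction with
    | mem x hx => obtain ⟨t, ht, rfl⟩ := hx; exact h t ht
    | zero => simp
    | add x y _ _ hx hy => rw [map_add]; exact add_nonneg hx hy
    | smul r x _ hx =>
      have : w (r • x) = (r : ℝ) * w x := by
        rw [← smul_eq_mul, ← map_smul]; rfl
      rw [this]
      exact mul_nonneg r.2 hx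

/-- Biduality: Farkas' lemma in the dual space writes evaluation at `x` as a non-negative
combination of evaluations at the generators, and a vector is determined by its evaluation. -/
theorem mem_hull_iff_forall_dualCone [Module.Free ℤ M] (T : Finset M) (x : RealSpace M) :
    x ∈ PointedCone.hull ℝ (latticePoint '' (T : Set M)) ↔
      ∀ w ∈ dualCone (PointedCone.hull ℝ (latticePoint '' (T : Set M))), 0 ≤ w x := by
  refine ⟨fun hx w hw => hw x hx, fun h => ?_⟩
  obtain ⟨c, hc, hx⟩ := exists_nonneg_sum_eq T
    (fun t => Module.Dual.eval ℝ (RealSpace M) (latticePoint t))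
    (Module.Dual.eval ℝ (RealSpace M) x) (by
      intro w hw
      exact h w (mem_dualCone_hull.2 hw))
  have : x = ∑ t ∈ T, c t • latticePoint t := by
    apply Module.eval_apply_injective (K := ℝ)
    rw [hx]; simp
  rw [this]
  refine Submodule.sum_mem _ fun t ht => ?_
  have hs := Submodule.smul_mem (PointedCone.hull ℝ (latticePoint '' (T : Set M)))
    (⟨c t, hc t⟩ : {r : ℝ // 0 ≤ r}) (Submodule.subset_span ⟨t, ht, rfl⟩)
  exact hs

theorem eq_zero_of_forall_latticePoint {T : Set M}
    (hfull : IsFullDimensional (PointedCone.hull ℝ (latticePoint '' T)))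
    {w : Module.Dual ℝ (RealSpace M)} (h : ∀ t ∈ T, w (latticePoint t) = 0) : w = 0 := by
  have : (⊤ : Submodule ℝ (RealSpace M)) ≤ LinearMap.ker w := by
    rw [← hfull, Submodule.span_le]
    intro x hx
    induction hx using Submodule.span_induction with
    | mem x hx => obtain ⟨t, ht, rfl⟩ := hx; exact h t ht
    | zero => simp
    | add x y _ _ hx hy => exact Submodule.add_mem _ hx hy
    | smul r x _ hx => exact Submodule.smul_mem _ (r : ℝ) hx
  exact LinearMap.ext fun x => this (Submodule.mem_top (x := x))

/-- A functional that is non-negative on a finite set and not determined up to scale by its zeros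
is, up to scale, a sum of two non-negative functionals with more zeros. -/
theorem exists_add_eq_smul_of_not_extremal {T : Finset M} {w w' : Module.Dual ℝ (RealSpace M)}
    (hfull : IsFullDimensional (PointedCone.hull ℝ (latticePoint '' (T : Set M))))
    (hw : ∀ t ∈ T, 0 ≤ w (latticePoint t))
    (hw' : ∀ t ∈ T, w (latticePoint t) = 0 → w' (latticePoint t) = 0)
    (hne : ∀ r : ℝ, w' ≠ r • w) (hw0 : w ≠ 0) :
    ∃ (u₁ u₂ : Module.Dual ℝ (RealSpace M)) (r : ℝ), 0 < r ∧ u₁ + u₂ = r • w ∧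
      ∀ u, u = u₁ ∨ u = u₂ → ((∀ t ∈ T, 0 ≤ u (latticePoint t)) ∧
        (∀ t ∈ T, w (latticePoint t) = 0 → u (latticePoint t) = 0) ∧
        ∃ t ∈ T, w (latticePoint t) ≠ 0 ∧ u (latticePoint t) = 0) := by
  classical
  set S := T.filter fun t => w (latticePoint t) ≠ 0 with hS
  have hSne : S.Nonempty := by
    rw [Finset.nonempty_iff_ne_empty]
    intro hemp
    refine hw0 (eq_zero_of_forall_latticePoint hfull fun t ht => ?_)
    by_contra hcon
    have : t ∈ S := Finset.mem_filter.2 ⟨ht, hcon⟩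
    simp [hemp] at this
  set ρ : M → ℝ := fun t => w' (latticePoint t) / w (latticePoint t) with hρ
  obtain ⟨t₁, ht₁, hmax⟩ := S.exists_max_image ρ hSne
  obtain ⟨t₂, ht₂, hmin⟩ := S.exists_min_image ρ hSne
  have hpos : ∀ t ∈ S, 0 < w (latticePoint t) := fun t ht =>
    lt_of_le_of_ne (hw t (Finset.mem_filter.1 ht).1) (Ne.symm (Finset.mem_filter.1 ht).2)
  have hval : ∀ t ∈ S, w' (latticePoint t) = ρ t * w (latticePoint t) := fun t ht => by
    rw [hρ]; field_simp [(hpos t ht).ne']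
  have hzero : ∀ t ∈ T, t ∉ S → w (latticePoint t) = 0 := fun t ht hts => by
    by_contra hcon
    exact hts (Finset.mem_filter.2 ⟨ht, hcon⟩)
  have hlt : ρ t₂ < ρ t₁ := by
    refine lt_of_le_of_ne (hmin t₁ ht₁) fun heq => hne (ρ t₁) ?_
    rw [← sub_eq_zero]
    refine eq_zero_of_forall_latticePoint hfull fun t ht => ?_
    simp only [LinearMap.sub_apply, LinearMap.smul_apply, smul_eq_mul]
    by_cases hts : t ∈ S
    · have : ρ t = ρ t₁ := le_antisymm (hmax t hts) (heq ▸ hmin t hts)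
      rw [hval t hts, this]; ring
    · have h0 := hzero t ht hts
      rw [hw' t ht h0, h0]; ring
  -- In the pencil of `w` and `w'`, these are the extreme members that stay non-negative up to sign:
  -- each acquires a new zero at the generator where the ratio `w' / w` is largest or smallest.
  refine ⟨ρ t₁ • w - w', w' - ρ t₂ • w, ρ t₁ - ρ t₂, by linarith, ?_, ?_⟩
  · refine LinearMap.ext fun x => ?_
    simp only [LinearMap.sub_apply, LinearMap.add_apply, LinearMap.smul_apply, smul_eq_mul]
    ring
  · rintro u (rfl | rfl)
    · refine ⟨fun t ht => ?_, fun t ht h0 => ?_, t₁, (Finset.mem_filter.1 ht₁).1,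
        (hpos t₁ ht₁).ne', ?_⟩
      · simp only [LinearMap.sub_apply, LinearMap.smul_apply, smul_eq_mul]
        by_cases hts : t ∈ S
        · rw [hval t hts]
          nlinarith [hmax t hts, hpos t hts]
        · have h0 := hzero t ht hts
          rw [hw' t ht h0, h0]; simp
      · simp [hw' t ht h0, h0]
      · simp [hval t₁ ht₁]
    · refine ⟨fun t ht => ?_, fun t ht h0 => ?_, t₂, (Finset.mem_filter.1 ht₂).1,
        (hpos t₂ ht₂).ne', ?_⟩
      · simp only [LinearMap.sub_apply, LinearMap.smul_apply, smul_eq_mul]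
        by_cases hts : t ∈ S
        · rw [hval t hts]
          nlinarith [hmin t hts, hpos t hts]
        · have h0 := hzero t ht hts
          rw [hw' t ht h0, h0]; simp
      · simp [hw' t ht h0, h0]
      · simp [hval t₂ ht₂]

/-- A real functional vanishing on a set of lattice vectors that determines it up to scale is a
positive multiple of an integral surjective one. -/
theorem exists_integral_of_determined [Module.Free ℤ M] [Module.Finite ℤ M] {T : Set M}
    {w : Module.Dual ℝ (RealSpace M)} (hw0 : w ≠ 0)
    (hdet : ∀ w' : Module.Dual ℝ (RealSpace M),
      (∀ t ∈ T, w (latticePoint t) = 0 → w' (latticePoint t) = 0) → ∃ r : ℝ, w' = r • w) :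
    ∃ (n : Module.Dual ℤ M) (r : ℝ), 0 < r ∧ w = r • realFunctional n ∧
      Function.Surjective n := by
  classical
  -- the group of values of `w` on the lattice is free
  let φ : M →ₗ[ℤ] ℝ :=
    (w.restrictScalars ℤ).comp (TensorProduct.mk ℤ ℝ M 1)
  have hφ : ∀ m, φ m = w (latticePoint m) := fun m => rfl
  let P := LinearMap.range φ
  have : Module.Finite ℤ P := Module.Finite.range φ
  have : IsAddTorsionFree P := inferInstance
  have : Module.Free ℤ P := inferInstance
  obtain ⟨m₀, hm₀⟩ : ∃ m, w (latticePoint m) ≠ 0 := by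
    by_contra hcon
    push Not at hcon
    apply hw0
    apply LinearMap.ext_on_range span_range_latticePoint
    simpa using hcon
  -- The value group is finitely generated and torsion-free, hence free, so an integral functional
  -- on it detects `w m₀`. Pulled back to the lattice it still vanishes wherever `w` does, so `hdet`
  -- makes it a multiple of `w`.
  obtain ⟨g, hg⟩ : ∃ g : Module.Dual ℤ P, g (φ.rangeRestrict m₀) ≠ 0 := by
    by_contra hcon
    push Not at hcon
    have := (Module.forall_dual_apply_eq_zero_iff ℤ _).1 hcon
    exact hm₀ (congrArg Subtype.val this)
  set n₀ : Module.Dual ℤ M := g.comp φ.rangeRestrict with hn₀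
  have hn₀0 : n₀ ≠ 0 := fun h => hg (by
    have := congrArg (fun f => f m₀) h
    simpa [hn₀] using this)
  obtain ⟨r, hr⟩ := hdet (realFunctional n₀) (by
    intro t _ h0
    have h1 : φ.rangeRestrict t = 0 := Subtype.ext h0
    simp [hn₀, h1])
  have hr0 : r ≠ 0 := by
    rintro rfl
    rw [zero_smul] at hr
    apply hn₀0
    apply realFunctional_injective
    rw [hr]
    simp [realFunctional]
  -- divide by the positive generator of the image
  obtain ⟨γ, hγ⟩ := (inferInstance : (LinearMap.range n₀).IsPrincipal)
  have hγ0 : γ ≠ 0 := by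
    rintro rfl
    apply hn₀0
    rw [Submodule.span_zero_singleton, LinearMap.range_eq_bot] at hγ
    exact hγ
  have hdvd : ∀ m, γ ∣ n₀ m := fun m => by
    have : n₀ m ∈ LinearMap.range n₀ := ⟨m, rfl⟩
    rw [hγ, Submodule.mem_span_singleton] at this
    obtain ⟨z, hz⟩ := this
    exact ⟨z, by rw [← hz, smul_eq_mul, mul_comm]⟩
  let n₁ : Module.Dual ℤ M :=
    { toFun := fun m => n₀ m / γ
      map_add' := fun a b => by
        rw [map_add, Int.add_ediv_of_dvd_left (hdvd a)]
      map_smul' := fun z a => by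
        rw [map_smul, smul_eq_mul, Int.mul_ediv_assoc _ (hdvd a)]; rfl }
  have hn₁ : n₀ = γ • n₁ := by
    ext m
    change n₀ m = γ • (n₀ m / γ)
    rw [smul_eq_mul, Int.mul_ediv_cancel' (hdvd m)]
  have hsurj : Function.Surjective n₁ := by
    have hγmem : γ ∈ LinearMap.range n₀ := by rw [hγ]; exact Submodule.mem_span_singleton_self γ
    obtain ⟨m, hm⟩ := hγmem
    intro z
    refine ⟨z • m, ?_⟩
    have : n₁ m = 1 := by
      change n₀ m / γ = 1
      rw [hm, Int.ediv_self hγ0]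
    rw [map_smul, this]; simp
  have hw : w = ((γ : ℝ) / r) • realFunctional n₁ := by
    have : r • w = (γ : ℝ) • realFunctional n₁ := by
      rw [← hr, hn₁, realFunctional_smul]
    rw [div_eq_inv_mul, mul_smul, ← this, smul_smul, inv_mul_cancel₀ hr0, one_smul]
  have hc0 : (γ : ℝ) / r ≠ 0 := div_ne_zero (by exact_mod_cast hγ0) hr0
  rcases lt_or_gt_of_ne hc0 with hneg | hpos
  · refine ⟨-n₁, -((γ : ℝ) / r), by linarith, ?_, fun z => ?_⟩
    · rw [hw, ← neg_one_zsmul n₁, realFunctional_smul, smul_smul]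
      simp
    · obtain ⟨m, hm⟩ := hsurj (-z)
      exact ⟨m, by simp [hm]⟩
  · exact ⟨n₁, _, hpos, hw, hsurj⟩

/-- A surjective integral functional in the dual cone which is determined up to scale by the
generators of the cone on which it vanishes is a primitive normal. -/
theorem mem_primitiveNormals_of_determined {T : Finset M} {n : Module.Dual ℤ M}
    (hfull : IsFullDimensional (PointedCone.hull ℝ (latticePoint '' (T : Set M))))
    (hn : realFunctional n ∈ dualCone (PointedCone.hull ℝ (latticePoint '' (T : Set M))))
    (hsurj : Function.Surjective n)
    (hdet : ∀ w' : Module.Dual ℝ (RealSpace M),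
      (∀ t ∈ (T : Set M), n t = 0 → w' (latticePoint t) = 0) →
        ∃ r : ℝ, w' = r • realFunctional n) :
    n ∈ primitiveNormals (PointedCone.hull ℝ (latticePoint '' (T : Set M))) := by
  refine ⟨hn, fun a ha b hb hab => ?_, fun ε h0 h1 => ?_⟩
  · rw [mem_dualCone_hull] at ha hb
    have hval : ∀ m, a (latticePoint m) + b (latticePoint m) = n m := fun m => by
      rw [← LinearMap.add_apply, hab, realFunctional_latticePoint]
    obtain ⟨r, hr⟩ := hdet a (fun t ht h0 => by
      have := hval t
      rw [h0] at this
      have h1 := ha t ht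
      have h2 := hb t ht
      push_cast at this
      linarith)
    by_cases hr0 : 0 ≤ r
    · exact ⟨r, hr0, hr⟩
    · push Not at hr0
      have hzero : ∀ t ∈ (T : Set M), realFunctional n (latticePoint t) = 0 := fun t ht => by
        have h1 := ha t ht
        have h2 := (mem_dualCone_hull.1 hn) t ht
        rw [hr, LinearMap.smul_apply, smul_eq_mul] at h1
        nlinarith
      obtain ⟨m, hm⟩ := hsurj 1
      have h0 := LinearMap.congr_fun (eq_zero_of_forall_latticePoint hfull hzero) (latticePoint m)
      simp [hm] at h0
  · rintro ⟨n', hn'⟩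
    obtain ⟨m, hm⟩ := hsurj 1
    have := congrArg (fun w => w (latticePoint m)) hn'
    simp only [realFunctional_latticePoint, LinearMap.smul_apply, hm, smul_eq_mul] at this
    push_cast at this
    have h2 : (0 : ℝ) < (n' m : ℝ) := by rw [this]; linarith
    have h3 : (n' m : ℝ) < 1 := by rw [this]; linarith
    have h4 : 0 < n' m := by exact_mod_cast h2
    have h5 : n' m < 1 := by exact_mod_cast h3
    omega

/-- The primitivity clause excludes zero, since zero is each of its own multiples. -/
theorem primitiveNormals_ne_zero {C : PointedCone ℝ (RealSpace M)} {n : Module.Dual ℤ M}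
    (hn : n ∈ primitiveNormals C) : n ≠ 0 := by
  rintro rfl
  exact hn.2.2 (1 / 2) (by norm_num) (by norm_num) ⟨0, by simp [realFunctional]⟩

/-- A primitive normal generates its values on the lattice. -/
theorem surjective_of_mem_primitiveNormals {C : PointedCone ℝ (RealSpace M)}
    {n : Module.Dual ℤ M} (hn : n ∈ primitiveNormals C) : ∃ m, n m = 1 := by
  obtain ⟨γ, hγ⟩ := (inferInstance : (LinearMap.range n).IsPrincipal)
  have hγmem : γ ∈ LinearMap.range n := by rw [hγ]; exact Submodule.mem_span_singleton_self γ
  obtain ⟨m, hm⟩ := hγmem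
  have hdvd : ∀ m, γ ∣ n m := fun m => by
    have : n m ∈ LinearMap.range n := ⟨m, rfl⟩
    rw [hγ, Submodule.mem_span_singleton] at this
    obtain ⟨z, hz⟩ := this
    exact ⟨z, by rw [← hz, smul_eq_mul, mul_comm]⟩
  have hγ0 : γ ≠ 0 := by
    rintro rfl
    exact primitiveNormals_ne_zero hn (LinearMap.ext fun m => by simpa using hdvd m)
  -- If `|γ|` were at least 2, dividing by it would give an integral functional equal to a proper
  -- fraction of `n`, against primitivity.
  have habs : |γ| = 1 := by
    by_contra hcon
    have h2 : 2 ≤ |γ| := by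
      have := Int.one_le_abs hγ0
      omega
    let n₁ : Module.Dual ℤ M :=
      { toFun := fun m => n m / |γ|
        map_add' := fun a b => by
          rw [map_add, Int.add_ediv_of_dvd_left ((abs_dvd _ _).2 (hdvd a))]
        map_smul' := fun z a => by
          rw [map_smul, smul_eq_mul, Int.mul_ediv_assoc _ ((abs_dvd _ _).2 (hdvd a))]; rfl }
    have hn₁ : n = |γ| • n₁ := by
      ext m
      change n m = |γ| • (n m / |γ|)
      rw [smul_eq_mul, Int.mul_ediv_cancel' ((abs_dvd _ _).2 (hdvd m))]
    have hpos : (2 : ℝ) ≤ (|γ| : ℤ) := by exact_mod_cast h2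
    refine hn.2.2 ((|γ| : ℤ) : ℝ)⁻¹ (by positivity) (inv_lt_one_of_one_lt₀ (by linarith)) ⟨n₁, ?_⟩
    conv_rhs => rw [hn₁, realFunctional_smul, smul_smul, inv_mul_cancel₀ (by positivity), one_smul]
  rcases (abs_eq zero_le_one).1 habs with h | h
  · exact ⟨m, by rw [hm, h]⟩
  · exact ⟨-m, by rw [map_neg, hm, h]; rfl⟩

/-- A dual vector vanishing on the generators on which a primitive normal vanishes is a multiple of
that normal. -/
theorem primitiveNormals_determined {T : Finset M} {n : Module.Dual ℤ M}
    (hfull : IsFullDimensional (PointedCone.hull ℝ (latticePoint '' (T : Set M))))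
    (hn : n ∈ primitiveNormals (PointedCone.hull ℝ (latticePoint '' (T : Set M))))
    {w' : Module.Dual ℝ (RealSpace M)}
    (hw' : ∀ t ∈ T, n t = 0 → w' (latticePoint t) = 0) :
    ∃ r : ℝ, w' = r • realFunctional n := by
  by_contra hcon
  push Not at hcon
  have hn0 : realFunctional n ≠ 0 := fun h =>
    primitiveNormals_ne_zero hn (realFunctional_injective (by rw [h]; simp [realFunctional]))
  obtain ⟨u₁, u₂, r, hr, hsum, hu⟩ := exists_add_eq_smul_of_not_extremal hfull
    (mem_dualCone_hull.1 hn.1) (fun t ht h0 => hw' t ht (by simpa using h0)) hcon hn0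
  obtain ⟨h1, -, t, ht, hnt, h1t⟩ := hu u₁ (Or.inl rfl)
  obtain ⟨h2, -, t', ht', hnt', h2t'⟩ := hu u₂ (Or.inr rfl)
  have hdual : ∀ u : Module.Dual ℝ (RealSpace M), (∀ t ∈ T, 0 ≤ u (latticePoint t)) →
      r⁻¹ • u ∈ dualCone (PointedCone.hull ℝ (latticePoint '' (T : Set M))) := fun u hu =>
    mem_dualCone_hull.2 fun t ht => mul_nonneg (inv_nonneg.2 hr.le) (hu t ht)
  obtain ⟨s, -, hs⟩ := hn.2.1 (r⁻¹ • u₁) (hdual u₁ h1) (r⁻¹ • u₂) (hdual u₂ h2) (by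
    rw [← smul_add, hsum, smul_smul, inv_mul_cancel₀ hr.ne', one_smul])
  have hs0 : s = 0 := by
    have := LinearMap.congr_fun hs (latticePoint t)
    simp only [LinearMap.smul_apply, h1t, smul_eq_mul, mul_zero] at this
    rcases mul_eq_zero.1 this.symm with h | h
    · exact h
    · exact absurd h hnt
  have hu₁ : u₁ = 0 := by
    rw [hs0, zero_smul] at hs
    exact (smul_eq_zero.1 hs).resolve_left (inv_ne_zero hr.ne')
  rw [hu₁, zero_add] at hsum
  rw [hsum] at h2t'
  rcases mul_eq_zero.1 h2t' with h | h
  · exact hr.ne' h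
  · exact hnt' h

/-- The two normals are proportional. Both take the value 1 on the lattice, so the ratio is an
integral unit, and both are non-negative on a spanning cone, so it is positive. A normal is thus
recovered from the generators on its facet, which also gives finiteness. -/
theorem primitiveNormals_eq_of_vanish {T : Finset M} {n n' : Module.Dual ℤ M}
    (hfull : IsFullDimensional (PointedCone.hull ℝ (latticePoint '' (T : Set M))))
    (hn : n ∈ primitiveNormals (PointedCone.hull ℝ (latticePoint '' (T : Set M))))
    (hn' : n' ∈ primitiveNormals (PointedCone.hull ℝ (latticePoint '' (T : Set M))))
    (h : ∀ t ∈ T, n t = 0 → n' t = 0) : n' = n := by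
  obtain ⟨r, hr⟩ := primitiveNormals_determined hfull hn (w' := realFunctional n')
    (fun t ht h0 => by simp [h t ht h0])
  have hval : ∀ m, (n' m : ℝ) = r * n m := fun m => by
    simpa using LinearMap.congr_fun hr (latticePoint m)
  obtain ⟨m, hm⟩ := surjective_of_mem_primitiveNormals hn
  obtain ⟨m', hm'⟩ := surjective_of_mem_primitiveNormals hn'
  have hr1 : (n' m : ℝ) = r := by simp [hval m, hm]
  have hr2 : (1 : ℝ) = r * n m' := by rw [← hval m', hm']; simp
  rw [← hr1] at hr2
  have hz : n' m * n m' = 1 := by exact_mod_cast hr2.symm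
  have hr0 : 0 < r := by
    by_contra hcon
    push Not at hcon
    apply primitiveNormals_ne_zero hn
    apply realFunctional_injective
    have h0 : realFunctional n = 0 := eq_zero_of_forall_latticePoint hfull fun t ht => by
      have h1 := (mem_dualCone_hull.1 hn.1) t ht
      have h2 := (mem_dualCone_hull.1 hn'.1) t ht
      have h3 := hval t
      rw [realFunctional_latticePoint] at h1 h2 ⊢
      rcases hcon.lt_or_eq with hlt | heq
      · nlinarith
      · rw [heq] at hr1
        have : n' m = 0 := by exact_mod_cast hr1
        simp [this] at hz
    rw [h0]; simp [realFunctional]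
  have hpos : 0 < n' m := by
    rw [← hr1] at hr0; exact_mod_cast hr0
  have hone : n' m = 1 := Int.eq_one_of_mul_eq_one_right hpos.le hz
  ext m₁
  have := hval m₁
  rw [← hr1, hone] at this
  push_cast at this
  rw [one_mul] at this
  exact_mod_cast this

theorem finite_primitiveNormals {T : Finset M}
    (hfull : IsFullDimensional (PointedCone.hull ℝ (latticePoint '' (T : Set M)))) :
    (primitiveNormals (PointedCone.hull ℝ (latticePoint '' (T : Set M)))).Finite := by
  classical
  refine Set.Finite.of_finite_image (f := fun n : Module.Dual ℤ M => T.filter fun t => n t = 0)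
    (T.powerset.finite_toSet.subset ?_) ?_
  · rintro _ ⟨n, -, rfl⟩
    exact Finset.mem_coe.2 (Finset.mem_powerset.2 (Finset.filter_subset _ _))
  · intro n hn n' hn' h
    refine (primitiveNormals_eq_of_vanish hfull hn hn' fun t ht h0 => ?_).symm
    have : t ∈ T.filter fun t => n t = 0 := Finset.mem_filter.2 ⟨ht, h0⟩
    change (T.filter fun t => n t = 0) = T.filter fun t => n' t = 0 at h
    rw [h] at this
    exact (Finset.mem_filter.1 this).2

/-- The dual cone is generated by the primitive normals, in dual form. -/
theorem nonneg_of_forall_primitiveNormals [Module.Free ℤ M] [Module.Finite ℤ M] {T : Finset M}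
    (hfull : IsFullDimensional (PointedCone.hull ℝ (latticePoint '' (T : Set M))))
    {x : RealSpace M}
    (hx : ∀ n ∈ primitiveNormals (PointedCone.hull ℝ (latticePoint '' (T : Set M))),
      0 ≤ realFunctional n x)
    (w : Module.Dual ℝ (RealSpace M)) (hw : ∀ t ∈ T, 0 ≤ w (latticePoint t)) : 0 ≤ w x := by
  classical
  -- Induction on the number of generators where `w` does not vanish: a functional not determined by
  -- its zeros splits into two with strictly more zeros, and a determined one is a positive multiple
  -- of a primitive normal.
  induction hk : (T.filter fun t => w (latticePoint t) ≠ 0).card using Nat.strong_induction_on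
    generalizing w with
  | _ k ih =>
  by_cases hw0 : w = 0
  · simp [hw0]
  by_cases hdet : ∀ w' : Module.Dual ℝ (RealSpace M),
      (∀ t ∈ (T : Set M), w (latticePoint t) = 0 → w' (latticePoint t) = 0) →
        ∃ r : ℝ, w' = r • w
  · obtain ⟨n, r, hr, hwn, hsurj⟩ := exists_integral_of_determined hw0 hdet
    have hval : ∀ y, w y = r * realFunctional n y := fun y => by rw [hwn]; rfl
    have hn : n ∈ primitiveNormals (PointedCone.hull ℝ (latticePoint '' (T : Set M))) := by
      refine mem_primitiveNormals_of_determined hfull ?_ hsurj ?_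
      · rw [mem_dualCone_hull]
        intro t ht
        have := hw t ht
        rw [hval] at this
        exact nonneg_of_mul_nonneg_right this hr
      · intro w' hw'
        obtain ⟨r', hr'⟩ := hdet w' (fun t ht h0 => hw' t ht (by
          rw [hval, realFunctional_latticePoint] at h0
          rcases mul_eq_zero.1 h0 with h | h
          · exact absurd h hr.ne'
          · exact_mod_cast h))
        exact ⟨r' * r, by rw [hr', hwn, smul_smul]⟩
    rw [hval]
    exact mul_nonneg hr.le (hx n hn)
  · push Not at hdet
    obtain ⟨w', hw', hne⟩ := hdet
    obtain ⟨u₁, u₂, r, hr, hsum, hu⟩ :=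
      exists_add_eq_smul_of_not_extremal hfull hw hw' hne hw0
    have key : ∀ u, u = u₁ ∨ u = u₂ → 0 ≤ u x := by
      intro u huu
      obtain ⟨h1, h2, t, ht, h3, h4⟩ := hu u huu
      refine ih _ ?_ u h1 rfl
      rw [← hk]
      refine Finset.card_lt_card ?_
      rw [Finset.ssubset_iff_of_subset]
      · exact ⟨t, Finset.mem_filter.2 ⟨ht, h3⟩, fun h => (Finset.mem_filter.1 h).2 h4⟩
      · intro t' ht'
        rw [Finset.mem_filter] at ht' ⊢
        exact ⟨ht'.1, fun h0 => ht'.2 (h2 t' ht'.1 h0)⟩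
    have h1 := key u₁ (Or.inl rfl)
    have h2 := key u₂ (Or.inr rfl)
    have h3 := LinearMap.congr_fun hsum x
    simp only [LinearMap.add_apply, LinearMap.smul_apply, smul_eq_mul] at h3
    by_contra hneg
    push Not at hneg
    nlinarith

theorem primitiveNormals_finite {C : PointedCone ℝ (RealSpace M)}
    (hrational : IsRationalPolyhedral C) (hfull : IsFullDimensional C) :
    (primitiveNormals C).Finite := by
  obtain ⟨T, rfl⟩ := hrational
  exact finite_primitiveNormals hfull

/-- The cone is cut out by its primitive normals. -/
theorem mem_cone_iff [Module.Free ℤ M] [Module.Finite ℤ M]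
    {C : PointedCone ℝ (RealSpace M)}
    (hrational : IsRationalPolyhedral C) (hfull : IsFullDimensional C)
    {x : RealSpace M} :
    x ∈ C ↔ ∀ n ∈ primitiveNormals C, 0 ≤ realFunctional n x := by
  obtain ⟨T, rfl⟩ := hrational
  refine ⟨fun hx n hn => hn.1 x hx, fun h => ?_⟩
  rw [mem_hull_iff_forall_dualCone]
  exact fun w hw => nonneg_of_forall_primitiveNormals hfull h w (mem_dualCone_hull.1 hw)

/-- The relative interior of a facet contains a lattice point. -/
theorem exists_facet_point {C : PointedCone ℝ (RealSpace M)}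
    (hrational : IsRationalPolyhedral C) (hfull : IsFullDimensional C)
    {n : Module.Dual ℤ M} (hn : n ∈ primitiveNormals C) :
    ∃ u : M, n u = 0 ∧ ∀ n' ∈ primitiveNormals C, n' ≠ n → 0 < n' u := by
  classical
  obtain ⟨T, rfl⟩ := hrational
  -- The sum of the generators on the facet: another normal vanishing on it would vanish on each of
  -- them, hence equal `n`.
  refine ⟨∑ t ∈ T.filter (fun t => n t = 0), t, ?_, fun n' hn' hne => ?_⟩
  · rw [map_sum]
    exact Finset.sum_eq_zero fun t ht => (Finset.mem_filter.1 ht).2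
  · have hnonneg : ∀ t ∈ T, 0 ≤ n' t := fun t ht => by
      have := mem_dualCone_hull.1 hn'.1 t ht
      rw [realFunctional_latticePoint] at this
      exact_mod_cast this
    rw [map_sum]
    refine lt_of_le_of_ne (Finset.sum_nonneg fun t ht => hnonneg t (Finset.mem_filter.1 ht).1) ?_
    intro h0
    rw [eq_comm, Finset.sum_eq_zero_iff_of_nonneg
      (fun t ht => hnonneg t (Finset.mem_filter.1 ht).1)] at h0
    exact hne (primitiveNormals_eq_of_vanish hfull hn hn' fun t ht h1 =>
      h0 t (Finset.mem_filter.2 ⟨ht, h1⟩))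

/-- The interior of a full-dimensional cone contains a lattice point. -/
theorem exists_interior_point {C : PointedCone ℝ (RealSpace M)}
    (hrational : IsRationalPolyhedral C) (hfull : IsFullDimensional C) :
    ∃ u : M, ∀ n ∈ primitiveNormals C, 0 < n u := by
  classical
  obtain ⟨T, rfl⟩ := hrational
  refine ⟨∑ t ∈ T, t, fun n hn => ?_⟩
  have hnonneg : ∀ t ∈ T, 0 ≤ n t := fun t ht => by
    have := mem_dualCone_hull.1 hn.1 t ht
    rw [realFunctional_latticePoint] at this
    exact_mod_cast this
  rw [map_sum]
  refine lt_of_le_of_ne (Finset.sum_nonneg hnonneg) fun h0 => ?_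
  rw [eq_comm, Finset.sum_eq_zero_iff_of_nonneg hnonneg] at h0
  apply primitiveNormals_ne_zero hn
  apply realFunctional_injective
  rw [eq_zero_of_forall_latticePoint hfull (w := realFunctional n)
    (fun t ht => by simp [h0 t ht])]
  simp [realFunctional]

/-- This is where pointedness enters: the common kernel of the normals is the largest linear
subspace of the cone. -/
theorem eq_zero_of_primitiveNormals [Module.Free ℤ M] [Module.Finite ℤ M]
    {C : PointedCone ℝ (RealSpace M)}
    (hrational : IsRationalPolyhedral C) (hfull : IsFullDimensional C)
    (hpointed : IsStronglyConvex C) {x : RealSpace M}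
    (hx : ∀ n ∈ primitiveNormals C, realFunctional n x = 0) : x = 0 := by
  refine hpointed x ?_ ?_
  · rw [mem_cone_iff hrational hfull]
    exact fun n hn => (hx n hn).ge
  · rw [mem_cone_iff hrational hfull]
    intro n hn
    rw [map_neg, hx n hn, neg_zero]

end Polyhedral

/-! ### Exterior products of bases -/

section ExteriorProducts

variable {U : Type*} [AddCommGroup U] [Module ℝ U]

/-- The determinant for the basis `v` of its span, extended by a linear projection, is an
alternating form with value 1 on `v`. -/
theorem ιMulti_ne_zero_of_linearIndependent {n : ℕ} {v : Fin n → U}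
    (hv : LinearIndependent ℝ v) : ExteriorAlgebra.ιMulti ℝ n v ≠ 0 := by
  intro h0
  let W := Submodule.span ℝ (Set.range v)
  let e : Module.Basis (Fin n) ℝ W := Module.Basis.span hv
  obtain ⟨p, hp⟩ := W.subtype.exists_leftInverse_of_injective (Submodule.ker_subtype W)
  have h1 : exteriorPower.ιMulti ℝ n v = 0 := Subtype.ext h0
  have h2 : (e.det.compLinearMap p) v = 0 := by
    rw [← exteriorPower.alternatingMapLinearEquiv_apply_ιMulti, h1, map_zero]
  have h3 : (fun j => p (v j)) = e := by
    funext j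
    have h4 : v j = W.subtype (e j) :=
      congrArg Subtype.val (Module.Basis.span_apply hv j).symm
    rw [h4]
    exact LinearMap.congr_fun hp (e j)
  rw [AlternatingMap.compLinearMap_apply] at h2
  change e.det (fun j => p (v j)) = 0 at h2
  rw [h3, Module.Basis.det_self] at h2
  exact one_ne_zero h2

/-- The top exterior power of `W` is a line. The coefficient is the determinant, because alternating
maps that agree on a basis are equal. -/
theorem exists_ιMulti_eq_smul {W : Submodule ℝ U} [FiniteDimensional ℝ W] {m n : ℕ} (hmn : m = n)
    (hn : Module.finrank ℝ W = n) {e : Fin n → U} (he : LinearIndependent ℝ e)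
    (heW : ∀ j, e j ∈ W) {v : Fin m → U} (hvW : ∀ j, v j ∈ W) :
    ∃ c : ℝ, ExteriorAlgebra.ιMulti ℝ m v = c • ExteriorAlgebra.ιMulti ℝ n e := by
  subst hmn
  let e' : Fin m → W := fun j => ⟨e j, heW j⟩
  have he' : LinearIndependent ℝ e' := LinearIndependent.of_comp W.subtype he
  let B : Module.Basis (Fin m) ℝ W :=
    basisOfLinearIndependentOfCardEqFinrank' e' he' (by simp [hn])
  have hB : ⇑B = e' := coe_basisOfLinearIndependentOfCardEqFinrank' _ _ _
  let f := (ExteriorAlgebra.ιMulti ℝ m).compLinearMap W.subtype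
  let g := ((LinearMap.toSpanSingleton ℝ (ExteriorAlgebra ℝ U) (f e')).compAlternatingMap B.det)
  have hfg : f = g := by
    apply Module.Basis.ext_alternating B
    intro s hs
    let σ : Equiv.Perm (Fin m) := Equiv.ofBijective s (Finite.injective_iff_bijective.1 hs)
    have h1 : (fun j => B (s j)) = fun j => B (σ j) := rfl
    have h2 : (fun j => B (s j)) = B ∘ σ := rfl
    rw [h2, AlternatingMap.map_perm, AlternatingMap.map_perm]
    congr 1
    simp [g, hB]
    rw [← hB, Module.Basis.det_self, one_smul]
  refine ⟨B.det fun j => ⟨v j, hvW j⟩, ?_⟩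
  have := congrArg (fun F => F fun j => (⟨v j, hvW j⟩ : W)) hfg
  exact this

theorem ιMulti_mul_ι {n : ℕ} (v : Fin n → U) (x : U) :
    ExteriorAlgebra.ιMulti ℝ n v * ExteriorAlgebra.ι ℝ x =
      ExteriorAlgebra.ιMulti ℝ (n + 1) (Fin.snoc v x) := by
  have h : ExteriorAlgebra.ι ℝ x = ExteriorAlgebra.ιMulti ℝ 1 (fun _ => x) := by
    simp [ExteriorAlgebra.ιMulti_apply]
  rw [h, ExteriorAlgebra.ιMulti_mul_ιMulti]
  congr 1
  rw [Fin.append_right_eq_snoc]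

theorem exists_basis_fun (W : Submodule ℝ U) [FiniteDimensional ℝ W] :
    ∃ e : Fin (Module.finrank ℝ W) → U, LinearIndependent ℝ e ∧
      Submodule.span ℝ (Set.range e) = W := by
  refine ⟨fun j => Module.finBasis ℝ W j,
    (Module.finBasis ℝ W).linearIndependent.map' _ (Submodule.ker_subtype _), ?_⟩
  have h2 := congrArg (Submodule.map W.subtype) (Module.finBasis ℝ W).span_eq
  rw [Submodule.map_span, ← Set.range_comp, Submodule.map_top, Submodule.range_subtype] at h2
  exact h2

end ExteriorProducts

/-! ### Cells of a strip arrangement, their codimensions and incidence numbers -/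

section Arrangement

variable {V ι : Type*} [AddCommGroup V] [Module ℝ V]
  (a : ι → V →ₗ[ℝ] ℝ) (b : ι → ℝ)

/-- The point `x` lies in the open cell labelled by `E`: the set of `i` with `a i x = b i`. -/
def InCell (E : Finset ι) (x : V) : Prop :=
  (∀ i ∈ E, a i x = b i) ∧ ∀ i ∉ E, b i - 1 < a i x ∧ a i x < b i

/-- The cell labelled by `E` is non-empty. -/
def IsCell (E : Finset ι) : Prop := ∃ x, InCell a b E x

/-- The span of the functionals labelled by `E`. -/
def labelSpan (E : Finset ι) : Submodule ℝ (V →ₗ[ℝ] ℝ) :=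
  Submodule.span ℝ (a '' (E : Set ι))

/-- The codimension of the cell labelled by `E`. -/
def rk (E : Finset ι) : ℕ := Module.finrank ℝ (labelSpan a E)

theorem rk_empty : rk a ∅ = 0 := by
  have h : labelSpan a ∅ = ⊥ := by simp [labelSpan]
  rw [rk, h, finrank_bot]

instance (E : Finset ι) : FiniteDimensional ℝ (labelSpan a E) :=
  FiniteDimensional.span_of_finite ℝ (E.finite_toSet.image a)

variable {a b}

theorem mem_labelSpan {E : Finset ι} {i : ι} (hi : i ∈ E) : a i ∈ labelSpan a E :=
  Submodule.subset_span ⟨i, hi, rfl⟩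

theorem labelSpan_mono {E E' : Finset ι} (h : E' ⊆ E) : labelSpan a E' ≤ labelSpan a E :=
  Submodule.span_mono (Set.image_mono (by exact_mod_cast h))

theorem apply_eq_zero_of_mem_labelSpan {E : Finset ι} {u : V} (hu : ∀ i ∈ E, a i u = 0)
    {z : V →ₗ[ℝ] ℝ} (hz : z ∈ labelSpan a E) : z u = 0 := by
  have : labelSpan a E ≤ LinearMap.ker (LinearMap.applyₗ (R := ℝ) (M₂ := ℝ) u) := by
    rw [labelSpan, Submodule.span_le]
    rintro _ ⟨i, hi, rfl⟩
    exact hu i hi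
  exact this hz

/-- The difference of a point of the larger cell and a point of its face: passing from the face into
the cell lowers exactly the functionals that cease to be tight. -/
theorem IsCell.exists_direction {E E' : Finset ι} (hE : IsCell a b E) (hE' : IsCell a b E')
    (h : E' ⊆ E) : ∃ u : V, (∀ i ∈ E', a i u = 0) ∧ ∀ i ∈ E, i ∉ E' → a i u < 0 := by
  obtain ⟨x, hx⟩ := hE
  obtain ⟨x', hx'⟩ := hE'
  refine ⟨x' - x, fun i hi => ?_, fun i hi hi' => ?_⟩
  · rw [map_sub, hx.1 i (h hi), hx'.1 i hi, sub_self]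
  · rw [map_sub, hx.1 i hi]
    linarith [(hx'.2 i hi').2]

/-- Finitely many strict inequalities stay valid for small positive perturbations. -/
theorem exists_pos_forall_lt {ι : Type*} [Finite ι] {p r : ι → ℝ} (s : ι → ℝ)
    (h : ∀ i, p i < r i) : ∃ ε > 0, ∀ i, p i + ε * s i < r i := by
  have h1 : ∀ i, ∀ᶠ ε in nhdsWithin (0 : ℝ) (Set.Ioi 0), p i + ε * s i < r i := fun i => by
    have : Filter.Tendsto (fun ε : ℝ => p i + ε * s i) (nhdsWithin 0 (Set.Ioi 0))
        (nhds (p i + 0 * s i)) :=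
      ((continuous_const.add (continuous_id.mul continuous_const)).tendsto 0).mono_left
        nhdsWithin_le_nhds
    refine this.eventually (gt_mem_nhds ?_)
    simpa using h i
  have h2 : ∀ᶠ ε in nhdsWithin (0 : ℝ) (Set.Ioi 0), ε ∈ Set.Ioi (0 : ℝ) :=
    self_mem_nhdsWithin
  obtain ⟨ε, hε, hε'⟩ := (h2.and (Filter.eventually_all.2 h1)).exists
  exact ⟨ε, hε, hε'⟩

/-- Conversely, a short step along such a direction from a point of the face reaches a point of the
cell labelled by `E'`. This is how all intermediate cells are produced. -/
theorem IsCell.of_direction [Finite ι] {E E' : Finset ι} (hE : IsCell a b E) {u : V}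
    (h0 : ∀ i ∈ E', a i u = 0) (hneg : ∀ i ∈ E, i ∉ E' → a i u < 0)
    (h : E' ⊆ E) : IsCell a b E' := by
  classical
  obtain ⟨x, hx⟩ := hE
  obtain ⟨ε, hε, hlt⟩ := exists_pos_forall_lt (ι := ι ⊕ ι)
    (p := Sum.elim (fun i => a i x) (fun i => - a i x))
    -- For `i ∈ E` the bound `a i x + 1` is only a filler: there the upper inequality comes from the
    -- sign of `a i u`.
    (r := Sum.elim (fun i => if i ∈ E then a i x + 1 else b i) (fun i => 1 - b i))
    (Sum.elim (fun i => a i u) (fun i => - a i u)) (by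
      rintro (i | i)
      · by_cases hi : i ∈ E
        · simp [hi]
        · simpa [hi] using (hx.2 i hi).2
      · by_cases hi : i ∈ E
        · simp [hx.1 i hi]
        · simp only [Sum.elim_inr]
          linarith [(hx.2 i hi).1])
  refine ⟨x + ε • u, fun i hi => ?_, fun i hi => ⟨?_, ?_⟩⟩
  · rw [map_add, map_smul, h0 i hi, smul_zero, add_zero, hx.1 i (h hi)]
  · have := hlt (Sum.inr i)
    simp only [Sum.elim_inr] at this
    rw [map_add, map_smul, smul_eq_mul]
    linarith
  · rw [map_add, map_smul, smul_eq_mul]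
    by_cases hiE : i ∈ E
    · have := hneg i hiE hi
      rw [hx.1 i hiE]
      nlinarith
    · simpa [hiE] using hlt (Sum.inl i)

/-- The direction from the face into the cell kills the span of `E'` but not `a i`. So labels of
cells behave like flats: a strictly larger label has strictly larger rank. -/
theorem IsCell.notMem_labelSpan {E E' : Finset ι} (hE : IsCell a b E) (hE' : IsCell a b E')
    (h : E' ⊆ E) {i : ι} (hi : i ∈ E) (hi' : i ∉ E') : a i ∉ labelSpan a E' := by
  obtain ⟨u, h0, hneg⟩ := hE.exists_direction hE' h
  exact fun hmem => (hneg i hi hi').ne (apply_eq_zero_of_mem_labelSpan h0 hmem)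

theorem rk_lt_of_labelSpan_lt {E E' : Finset ι} (h : E' ⊆ E) {i : ι} (hi : i ∈ E)
    (hi' : a i ∉ labelSpan a E') : rk a E' < rk a E :=
  Submodule.finrank_lt_finrank_of_lt
    (lt_of_le_of_ne (labelSpan_mono h) fun heq => hi' (heq ▸ mem_labelSpan hi))

theorem IsCell.rk_lt {E E' : Finset ι} (hE : IsCell a b E) (hE' : IsCell a b E')
    (h : E' ⊆ E) {i : ι} (hi : i ∈ E) (hi' : i ∉ E') : rk a E' < rk a E :=
  rk_lt_of_labelSpan_lt h hi (hE.notMem_labelSpan hE' h hi hi')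

theorem IsCell.eq_of_rk_eq {E E' : Finset ι} (hE : IsCell a b E) (hE' : IsCell a b E')
    (h : E' ⊆ E) (hrk : rk a E = rk a E') : E' = E := by
  refine h.antisymm fun i hi => ?_
  by_contra hi'
  exact (hE.rk_lt hE' h hi hi').ne' hrk

/-- If the codimensions differ by one, any functional outside the smaller span generates the larger
span over the smaller. -/
theorem exists_eq_smul_add {E E' : Finset ι} (h : E' ⊆ E) (hrk : rk a E ≤ rk a E' + 1) {i : ι}
    (hi : i ∈ E) (hi' : a i ∉ labelSpan a E') {y : V →ₗ[ℝ] ℝ} (hy : y ∈ labelSpan a E) :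
    ∃ r : ℝ, ∃ z ∈ labelSpan a E', y = r • a i + z := by
  let W := ℝ ∙ a i ⊔ labelSpan a E'
  have hle : W ≤ labelSpan a E :=
    sup_le ((Submodule.span_singleton_le_iff_mem _ _).2 (mem_labelSpan hi)) (labelSpan_mono h)
  have hlt : labelSpan a E' < W := by
    refine lt_of_le_of_ne le_sup_right fun heq => hi' ?_
    rw [heq]
    exact Submodule.mem_sup_left (Submodule.mem_span_singleton_self _)
  have : FiniteDimensional ℝ W := Submodule.finiteDimensional_of_le hle
  have h1 : rk a E' < Module.finrank ℝ W := Submodule.finrank_lt_finrank_of_lt hlt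
  have heq : W = labelSpan a E := Submodule.eq_of_le_of_finrank_le hle (by
    change rk a E ≤ _
    omega)
  rw [← heq] at hy
  obtain ⟨y₁, hy₁, z, hz, rfl⟩ := Submodule.mem_sup.1 hy
  obtain ⟨r, rfl⟩ := Submodule.mem_span_singleton.1 hy₁
  exact ⟨r, z, hz, rfl⟩

variable (a) in
/-- A basis of the span of the functionals labelled by `E`. -/
def labelBasis (E : Finset ι) : Fin (rk a E) → (V →ₗ[ℝ] ℝ) :=
  (exists_basis_fun (labelSpan a E)).choose

variable (a) in
theorem linearIndependent_labelBasis (E : Finset ι) : LinearIndependent ℝ (labelBasis a E) :=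
  (exists_basis_fun (labelSpan a E)).choose_spec.1

variable (a) in
theorem span_labelBasis (E : Finset ι) :
    Submodule.span ℝ (Set.range (labelBasis a E)) = labelSpan a E :=
  (exists_basis_fun (labelSpan a E)).choose_spec.2

theorem labelBasis_mem (E : Finset ι) (j : Fin (rk a E)) : labelBasis a E j ∈ labelSpan a E := by
  rw [← span_labelBasis]
  exact Submodule.subset_span ⟨j, rfl⟩

variable (a) in
/-- An orientation of the cell labelled by `E`: the exterior product of a basis of the span. -/
def cellForm (E : Finset ι) : ExteriorAlgebra ℝ (V →ₗ[ℝ] ℝ) :=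
  ExteriorAlgebra.ιMulti ℝ (rk a E) (labelBasis a E)

theorem cellForm_ne_zero (E : Finset ι) : cellForm a E ≠ 0 :=
  ιMulti_ne_zero_of_linearIndependent (linearIndependent_labelBasis a E)

theorem cellForm_mul_ι_eq_zero {E : Finset ι} {z : V →ₗ[ℝ] ℝ} (hz : z ∈ labelSpan a E) :
    cellForm a E * ExteriorAlgebra.ι ℝ z = 0 := by
  rw [cellForm, ιMulti_mul_ι]
  refine AlternatingMap.map_linearDependent _ _ fun hind => ?_
  rw [linearIndependent_finSnoc] at hind
  exact hind.2 (by rwa [span_labelBasis])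

/-- Appending `a i` to a basis of the smaller span gives a basis of the larger one; the two exterior
products therefore span the same line. -/
theorem cellForm_mul_ι {E E' : Finset ι} (h : E' ⊆ E) (hrk : rk a E = rk a E' + 1) {i : ι}
    (hi : i ∈ E) (hi' : a i ∉ labelSpan a E') :
    ∃ c : ℝ, c ≠ 0 ∧ cellForm a E' * ExteriorAlgebra.ι ℝ (a i) = c • cellForm a E := by
  have hind : LinearIndependent ℝ
      (Fin.snoc (labelBasis a E') (a i) : Fin (rk a E' + 1) → (V →ₗ[ℝ] ℝ)) := by
    rw [linearIndependent_finSnoc]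
    exact ⟨linearIndependent_labelBasis a E', by rwa [span_labelBasis]⟩
  obtain ⟨c, hc⟩ := exists_ιMulti_eq_smul (W := labelSpan a E) hrk.symm rfl
    (linearIndependent_labelBasis a E) (labelBasis_mem E)
    (v := Fin.snoc (labelBasis a E') (a i)) (by
        intro j
        refine Fin.lastCases ?_ (fun j => ?_) j
        · simpa using mem_labelSpan hi
        · simpa using labelSpan_mono h (labelBasis_mem E' j))
  refine ⟨c, ?_, by rw [cellForm, ιMulti_mul_ι, hc]; rfl⟩
  rintro rfl
  rw [zero_smul] at hc
  exact ιMulti_ne_zero_of_linearIndependent hind hc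

/-- The coefficient of `cellForm a E` in the product of `cellForm a E'` and `a i`. -/
def formCoeff (a : ι → V →ₗ[ℝ] ℝ) (E E' : Finset ι) (i : ι) : ℝ :=
  open Classical in
  if h : ∃ c : ℝ, cellForm a E' * ExteriorAlgebra.ι ℝ (a i) = c • cellForm a E then h.choose else 0

theorem formCoeff_eq {E E' : Finset ι} {i : ι} {c : ℝ}
    (h : cellForm a E' * ExteriorAlgebra.ι ℝ (a i) = c • cellForm a E) :
    formCoeff a E E' i = c := by
  have hex : ∃ c : ℝ, cellForm a E' * ExteriorAlgebra.ι ℝ (a i) = c • cellForm a E := ⟨c, h⟩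
  rw [formCoeff, dif_pos hex]
  exact (smul_left_injective ℝ (cellForm_ne_zero E) (h.symm.trans hex.choose_spec)).symm

variable (a b) in
/-- The cell labelled by `E` is a facet of the cell labelled by `E'`. -/
structure IsCover (E E' : Finset ι) : Prop where
  isCell : IsCell a b E
  isCell' : IsCell a b E'
  subset : E' ⊆ E
  rk_eq : rk a E = rk a E' + 1

theorem IsCover.exists_mem {E E' : Finset ι} (h : IsCover a b E E') : ∃ i ∈ E, i ∉ E' := by
  by_contra hcon
  push Not at hcon
  have : E = E' := Finset.Subset.antisymm hcon h.subset
  have h1 := h.rk_eq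
  rw [this] at h1
  omega

variable (a b) in
/-- The incidence number of two cells. -/
def inc (E E' : Finset ι) : ℤ :=
  open Classical in
  if h : IsCover a b E E' then SignType.sign (formCoeff a E E' h.exists_mem.choose) else 0

theorem inc_of_not {E E' : Finset ι} (h : ¬ IsCover a b E E') : inc a b E E' = 0 :=
  dif_neg h

/-- The sign does not depend on the functional used. Modulo the span of `E'` any two of them are
proportional, and the factor is positive because both are negative on a direction from the face into
the cell. -/
theorem IsCover.inc_eq {E E' : Finset ι} (h : IsCover a b E E') {i : ι} (hi : i ∈ E)
    (hi' : i ∉ E') {c : ℝ}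
    (hc : cellForm a E' * ExteriorAlgebra.ι ℝ (a i) = c • cellForm a E) :
    inc a b E E' = SignType.sign c := by
  rw [inc, dif_pos h]
  obtain ⟨hj, hj'⟩ := h.exists_mem.choose_spec
  set j := h.exists_mem.choose
  have hjn := h.isCell.notMem_labelSpan h.isCell' h.subset hj hj'
  obtain ⟨c', -, hc'⟩ := cellForm_mul_ι h.subset h.rk_eq hj hjn
  obtain ⟨r, z, hz, hr⟩ := exists_eq_smul_add h.subset h.rk_eq.le hj hjn (mem_labelSpan hi)
  obtain ⟨u, hu0, hu⟩ := h.isCell.exists_direction h.isCell' h.subset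
  have hrpos : 0 < r := by
    have h1 := hu i hi hi'
    have h2 := hu j hj hj'
    rw [hr, LinearMap.add_apply, apply_eq_zero_of_mem_labelSpan hu0 hz, LinearMap.smul_apply,
      smul_eq_mul] at h1
    nlinarith
  have hcc : c = r * c' := by
    apply smul_left_injective ℝ (cellForm_ne_zero (a := a) E)
    change c • cellForm a E = (r * c') • cellForm a E
    rw [← hc, hr, map_add, mul_add, cellForm_mul_ι_eq_zero hz, add_zero, map_smul,
      mul_smul_comm, hc', smul_smul]
  rw [formCoeff_eq hc', hcc, sign_mul, sign_pos hrpos, one_mul]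

theorem IsCover.inc_isUnit {E E' : Finset ι} (h : IsCover a b E E') : IsUnit (inc a b E E') := by
  obtain ⟨i, hi, hi'⟩ := h.exists_mem
  obtain ⟨c, hc0, hc⟩ := cellForm_mul_ι h.subset h.rk_eq hi
    (h.isCell.notMem_labelSpan h.isCell' h.subset hi hi')
  rw [h.inc_eq hi hi' hc]
  rcases lt_or_gt_of_ne hc0 with hneg | hpos
  · simp [sign_neg hneg]
  · simp [sign_pos hpos]

end Arrangement

/-! ### The diamond property and vanishing of the squared differential -/

section Diamond

variable {V ι : Type*} [AddCommGroup V] [Module ℝ V]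
  {a : ι → (V →ₗ[ℝ] ℝ)} {b : ι → ℝ}

/-- If the codimensions of two cells differ by at least two, some direction is not proportional
to a given one on the functionals between them. -/
theorem exists_direction_not_smul {E E' : Finset ι} {u : V}
    (hu0 : ∀ i ∈ E', a i u = 0) (hu : ∀ i ∈ E, i ∉ E' → a i u < 0) (h : E' ⊆ E)
    (hrk : rk a E' + 2 ≤ rk a E) :
    ∃ v : V, (∀ i ∈ E', a i v = 0) ∧ ∀ r : ℝ, ∃ i ∈ E, i ∉ E' ∧ a i v ≠ r * a i u := by
  by_contra hcon
  push Not at hcon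
  obtain ⟨j, hj, hj'⟩ : ∃ j ∈ E, j ∉ E' := by
    by_contra hc
    push Not at hc
    have : E = E' := Finset.Subset.antisymm hc h
    rw [this] at hrk
    omega
  have hju := hu j hj hj'
  -- If every `v` were proportional to `u` on these functionals, each `a i` would be a multiple of
  -- `a j` modulo the span of `E'`, and the rank would increase by at most one.
  have hle : labelSpan a E ≤ ℝ ∙ a j ⊔ labelSpan a E' := by
    rw [labelSpan, Submodule.span_le]
    rintro _ ⟨i, hi, rfl⟩
    have hmem : a i - (a i u / a j u) • a j ∈ labelSpan a E' := by
      have : labelSpan a E' = Submodule.span ℝ (Set.range fun l : E' => a l) := by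
        rw [labelSpan, Set.image_eq_range]; rfl
      rw [this]
      refine mem_span_of_iInf_ker_le_ker fun v hv => ?_
      simp only [Submodule.mem_iInf, LinearMap.mem_ker, Subtype.forall] at hv
      obtain ⟨r, hr⟩ := hcon v hv
      have h1 := hr j hj hj'
      simp only [LinearMap.mem_ker, LinearMap.sub_apply, LinearMap.smul_apply, smul_eq_mul, h1]
      by_cases hi' : i ∈ E'
      · rw [hv i hi', hu0 i hi']; simp
      · rw [hr i hi hi']
        rw [mul_comm r (a j u), ← mul_assoc, div_mul_cancel₀ _ hju.ne]
        ring
    have : a i = (a i u / a j u) • a j + (a i - (a i u / a j u) • a j) := by abel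
    rw [SetLike.mem_coe, this]
    exact Submodule.add_mem_sup
      (Submodule.smul_mem _ _ (Submodule.mem_span_singleton_self _)) hmem
  have h1 : rk a E ≤ Module.finrank ℝ (ℝ ∙ a j ⊔ labelSpan a E' : Submodule ℝ (V →ₗ[ℝ] ℝ)) :=
    Submodule.finrank_mono hle
  have h2 := Submodule.finrank_add_le_finrank_add_finrank (ℝ ∙ a j) (labelSpan a E')
  have h3 := finrank_span_singleton (K := ℝ) (v := a j) (fun h0 => by simp [h0] at hju)
  change _ ≤ _ + rk a E' at h2
  omega

/-- The diamond property: between two cells whose codimensions differ by two there are exactly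
two cells. -/
theorem IsCell.exists_diamond [Fintype ι] [DecidableEq ι] {E E' : Finset ι} (hE : IsCell a b E)
    (hE' : IsCell a b E') (h : E' ⊆ E) (hrk : rk a E = rk a E' + 2) :
    ∃ (E₁ E₂ : Finset ι) (i₁ i₂ : ι), IsCover a b E E₁ ∧ IsCover a b E₁ E' ∧
      IsCover a b E E₂ ∧ IsCover a b E₂ E' ∧ i₁ ∈ E₁ ∧ i₁ ∉ E₂ ∧ i₂ ∈ E₂ ∧ i₂ ∉ E₁ ∧
      ∀ G, IsCover a b E G → IsCover a b G E' → G = E₁ ∨ G = E₂ := by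
  obtain ⟨u, hu0, hu⟩ := hE.exists_direction hE' h
  obtain ⟨v, hv0, hv⟩ := exists_direction_not_smul hu0 hu h hrk.ge
  set S := E \ E' with hS
  have hmemS : ∀ {i}, i ∈ S ↔ i ∈ E ∧ i ∉ E' := fun {i} => Finset.mem_sdiff
  -- Modulo directions that kill `E'` and `E`, the plane spanned by `u` and `v` sees each `i ∈ S` as
  -- a line of slope `ρ i`. The extreme slopes bound the planar cone where all these functionals are
  -- non-positive.
  set ρ : ι → ℝ := fun i => a i v / (-a i u) with hρ
  have hval : ∀ i ∈ S, a i v = ρ i * (-a i u) := fun i hi => by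
    have := (hu i (hmemS.1 hi).1 (hmemS.1 hi).2).ne
    have h2 : -a i u ≠ 0 := neg_ne_zero.2 this
    rw [hρ]
    exact (div_mul_cancel₀ _ h2).symm
  have hneg : ∀ i ∈ S, a i u < 0 := fun i hi => hu i (hmemS.1 hi).1 (hmemS.1 hi).2
  have hSne : S.Nonempty := by
    obtain ⟨i, hi, hi', -⟩ := hv 0
    exact ⟨i, hmemS.2 ⟨hi, hi'⟩⟩
  obtain ⟨i₁, hi₁, hmax⟩ := S.exists_max_image ρ hSne
  obtain ⟨i₂, hi₂, hmin⟩ := S.exists_min_image ρ hSne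
  have hlt : ρ i₂ < ρ i₁ := by
    obtain ⟨i, hi, hi', hne⟩ := hv (-ρ i₁)
    have hiS := hmemS.2 ⟨hi, hi'⟩
    refine (hmin i hiS).trans_lt (lt_of_le_of_ne (hmax i hiS) fun heq => hne ?_)
    rw [hval i hiS, heq]; ring
  -- the two intermediate cells
  have aux : ∀ (w : V) (c : ι → ℝ), (∀ i ∈ E', a i w = 0) → (∀ i ∈ S, c i ≤ 0) →
      (∀ i ∈ S, a i w = c i * (-a i u)) → (∃ i ∈ S, c i = 0) → (∃ i ∈ S, c i ≠ 0) →
      IsCover a b E (E' ∪ S.filter fun i => c i = 0) ∧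
        IsCover a b (E' ∪ S.filter fun i => c i = 0) E' := by
    intro w c hw0 hc hwc ⟨i, hi, hi0⟩ ⟨j, hj, hj0⟩
    set G := E' ∪ S.filter fun i => c i = 0
    have hGE : G ⊆ E := Finset.union_subset h
      ((Finset.filter_subset _ _).trans Finset.sdiff_subset)
    have hEG : E' ⊆ G := Finset.subset_union_left
    have hG : IsCell a b G := by
      refine hE.of_direction (u := w) (fun l hl => ?_) (fun l hl hl' => ?_) hGE
      · rcases Finset.mem_union.1 hl with hl | hl
        · exact hw0 l hl
        · rw [Finset.mem_filter] at hl
          rw [hwc l hl.1, hl.2, zero_mul]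
      · have hlS : l ∈ S := hmemS.2 ⟨hl, fun hl'' => hl' (hEG hl'')⟩
        have hl0 : c l ≠ 0 := fun h0 =>
          hl' (Finset.mem_union_right _ (Finset.mem_filter.2 ⟨hlS, h0⟩))
        rw [hwc l hlS]
        have h1 := lt_of_le_of_ne (hc l hlS) hl0
        have h2 := hneg l hlS
        nlinarith
    have hiG : i ∈ G := Finset.mem_union_right _ (Finset.mem_filter.2 ⟨hi, hi0⟩)
    have hjG : j ∉ G := fun hjG => by
      rcases Finset.mem_union.1 hjG with hl | hl
      · exact (hmemS.1 hj).2 hl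
      · exact hj0 (Finset.mem_filter.1 hl).2
    have h1 := hG.rk_lt hE' hEG hiG (hmemS.1 hi).2
    have h2 := hE.rk_lt hG hGE (hmemS.1 hj).1 hjG
    exact ⟨⟨hE, hG, hGE, by omega⟩, ⟨hG, hE', hEG, by omega⟩⟩
  -- On this boundary ray `a i` equals `(ρ i - ρ i₁) * (-a i u)`, which is non-positive and vanishes
  -- exactly for the slopes equal to the maximum. The other boundary ray uses the minimum.
  obtain ⟨hc1, hc1'⟩ := aux (v + ρ i₁ • u) (fun i => ρ i - ρ i₁)
    (fun i hi => by rw [map_add, map_smul, hv0 i hi, hu0 i hi]; simp)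
    (fun i hi => by linarith [hmax i hi])
    (fun i hi => by rw [map_add, map_smul, hval i hi, smul_eq_mul]; ring)
    ⟨i₁, hi₁, by simp⟩ ⟨i₂, hi₂, by simpa [sub_eq_zero] using hlt.ne⟩
  obtain ⟨hc2, hc2'⟩ := aux (-(v + ρ i₂ • u)) (fun i => ρ i₂ - ρ i)
    (fun i hi => by rw [map_neg, map_add, map_smul, hv0 i hi, hu0 i hi]; simp)
    (fun i hi => by linarith [hmin i hi])
    (fun i hi => by rw [map_neg, map_add, map_smul, hval i hi, smul_eq_mul]; ring)
    ⟨i₂, hi₂, by simp⟩ ⟨i₁, hi₁, by simpa [sub_eq_zero] using hlt.ne⟩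
  set E₁ := E' ∪ S.filter fun i => ρ i - ρ i₁ = 0 with hE₁
  set E₂ := E' ∪ S.filter fun i => ρ i₂ - ρ i = 0 with hE₂
  have h11 : i₁ ∈ E₁ := Finset.mem_union_right _ (Finset.mem_filter.2 ⟨hi₁, by simp⟩)
  have h22 : i₂ ∈ E₂ := Finset.mem_union_right _ (Finset.mem_filter.2 ⟨hi₂, by simp⟩)
  have h12 : i₁ ∉ E₂ := fun hmem => by
    rcases Finset.mem_union.1 hmem with hl | hl
    · exact (hmemS.1 hi₁).2 hl
    · have := (Finset.mem_filter.1 hl).2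
      linarith
  have h21 : i₂ ∉ E₁ := fun hmem => by
    rcases Finset.mem_union.1 hmem with hl | hl
    · exact (hmemS.1 hi₂).2 hl
    · have := (Finset.mem_filter.1 hl).2
      linarith
  refine ⟨E₁, E₂, i₁, i₂, hc1, hc1', hc2, hc2', h11, h12, h22, h21, fun G hG hG' => ?_⟩
  obtain ⟨i, hi, hi'⟩ := hG'.exists_mem
  have hiE : i ∈ E := hG.subset hi
  have hiS : i ∈ S := hmemS.2 ⟨hiE, hi'⟩
  -- the slope is constant on `G`
  have hconst : ∀ l ∈ G, l ∉ E' → ρ l = ρ i := fun l hl hl' => by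
    have hlS : l ∈ S := hmemS.2 ⟨hG.subset hl, hl'⟩
    obtain ⟨r, z, hz, hr⟩ := exists_eq_smul_add hG'.subset hG'.rk_eq.le hi
      (hG'.isCell.notMem_labelSpan hE' hG'.subset hi hi') (mem_labelSpan hl)
    have h1 := hval l hlS
    have h2 := hval i hiS
    have h3 := hneg l hlS
    have hlu : a l u = r * a i u := by
      rw [hr, LinearMap.add_apply, apply_eq_zero_of_mem_labelSpan hu0 hz]; simp
    have hlv : a l v = r * a i v := by
      rw [hr, LinearMap.add_apply, apply_eq_zero_of_mem_labelSpan hv0 hz]; simp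
    rw [hlv, h2, hlu] at h1
    rw [hlu] at h3
    have : (ρ i - ρ l) * (r * a i u) = 0 := by linarith
    rcases mul_eq_zero.1 this with h0 | h0
    · linarith
    · exact absurd h0 h3.ne
  by_cases hG1 : ρ i = ρ i₁
  · left
    refine hc1'.isCell.eq_of_rk_eq hG'.isCell (fun l hl => ?_) ?_
    · by_cases hl' : l ∈ E'
      · exact Finset.mem_union_left _ hl'
      · exact Finset.mem_union_right _ (Finset.mem_filter.2
          ⟨hmemS.2 ⟨hG.subset hl, hl'⟩, by rw [hconst l hl hl', hG1, sub_self]⟩)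
    · rw [hc1'.rk_eq, hG'.rk_eq]
  by_cases hG2 : ρ i = ρ i₂
  · right
    refine hc2'.isCell.eq_of_rk_eq hG'.isCell (fun l hl => ?_) ?_
    · by_cases hl' : l ∈ E'
      · exact Finset.mem_union_left _ hl'
      · exact Finset.mem_union_right _ (Finset.mem_filter.2
          ⟨hmemS.2 ⟨hG.subset hl, hl'⟩, by rw [hconst l hl hl', hG2, sub_self]⟩)
    · rw [hc2'.rk_eq, hG'.rk_eq]
  -- An intermediate slope makes `a i`, modulo the span of `E'`, a positive combination of `a i₁`
  -- and `a i₂`. But on the direction `w` into the cell labelled by `G`, `a i` vanishes while the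
  -- other two are negative.
  exfalso
  have hlt1 : ρ i < ρ i₁ := lt_of_le_of_ne (hmax i hiS) hG1
  have hlt2 : ρ i₂ < ρ i := lt_of_le_of_ne (hmin i hiS) (Ne.symm hG2)
  have hn1 : i₁ ∉ G := fun hmem => hG1 (hconst i₁ hmem (hmemS.1 hi₁).2).symm
  have hn2 : i₂ ∉ G := fun hmem => hG2 (hconst i₂ hmem (hmemS.1 hi₂).2).symm
  obtain ⟨r₂, z', hz', hr₂⟩ := exists_eq_smul_add hc1.subset hc1.rk_eq.le (hmemS.1 hi₂).1
    (hE.notMem_labelSpan hc1'.isCell hc1.subset (hmemS.1 hi₂).1 h21) (mem_labelSpan hiE)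
  obtain ⟨r₁, z, hz, rfl⟩ := exists_eq_smul_add hc1'.subset hc1'.rk_eq.le h11
    (hc1'.isCell.notMem_labelSpan hE' hc1'.subset h11 (hmemS.1 hi₁).2) hz'
  have hexp : ∀ w, (∀ l ∈ E', a l w = 0) → a i w = r₂ * a i₂ w + r₁ * a i₁ w := fun w hw => by
    rw [hr₂]
    simp only [LinearMap.add_apply, LinearMap.smul_apply, smul_eq_mul,
      apply_eq_zero_of_mem_labelSpan hw hz, add_zero]
  have e1 := hexp u hu0
  have e2 := hexp v hv0
  rw [hval i hiS, hval i₁ hi₁, hval i₂ hi₂] at e2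
  obtain ⟨w, hw0, hw⟩ := hE.exists_direction hG.isCell' hG.subset
  have e3 := hexp w (fun l hl => hw0 l (hG'.subset hl))
  rw [hw0 i hi] at e3
  have w1 := hw i₁ (hmemS.1 hi₁).1 hn1
  have w2 := hw i₂ (hmemS.1 hi₂).1 hn2
  have u1 := hneg i₁ hi₁
  have u2 := hneg i₂ hi₂
  have u3 := hneg i hiS
  -- `r₁` and `r₂` have the same sign, and their sum with positive weights is positive
  have e4 : r₁ * ((ρ i₁ - ρ i) * (-a i₁ u)) = r₂ * ((ρ i - ρ i₂) * (-a i₂ u)) := by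
    rw [e1] at e2
    linarith
  have p1 : 0 < (ρ i₁ - ρ i) * (-a i₁ u) := mul_pos (by linarith) (by linarith)
  have p2 : 0 < (ρ i - ρ i₂) * (-a i₂ u) := mul_pos (by linarith) (by linarith)
  rcases lt_trichotomy r₁ 0 with hr | hr | hr
  · have : r₂ < 0 := by
      by_contra hc
      push Not at hc
      nlinarith [mul_neg_of_neg_of_pos hr p1, mul_nonneg hc p2.le]
    nlinarith [mul_pos_of_neg_of_neg hr u1, mul_pos_of_neg_of_neg this u2]
  · rw [hr, zero_mul] at e4
    rcases mul_eq_zero.1 e4.symm with h0 | h0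
    · rw [hr, h0] at e1
      linarith
    · linarith
  · have : 0 < r₂ := by
      by_contra hc
      push Not at hc
      nlinarith [mul_pos hr p1, mul_nonneg (neg_nonneg.2 hc) p2.le]
    nlinarith [mul_neg_of_pos_of_neg hr w1, mul_neg_of_pos_of_neg this w2]

/-- The incidence numbers define a complex. -/
theorem sum_inc_mul_inc [Fintype ι] [DecidableEq ι] (E E' : Finset ι) :
    ∑ G : Finset ι, inc a b E G * inc a b G E' = 0 := by
  by_cases hex : ∃ G, IsCover a b E G ∧ IsCover a b G E'
  swap
  · push Not at hex
    refine Finset.sum_eq_zero fun G _ => ?_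
    by_cases hG : IsCover a b E G
    · rw [inc_of_not (hex G hG), mul_zero]
    · rw [inc_of_not hG, zero_mul]
  obtain ⟨G₀, hG₀, hG₀'⟩ := hex
  obtain ⟨E₁, E₂, i₁, i₂, h1, h1', h2, h2', h11, h12, h22, h21, huniq⟩ :=
    hG₀.isCell.exists_diamond hG₀'.isCell' (hG₀'.subset.trans hG₀.subset)
      (by rw [hG₀.rk_eq, hG₀'.rk_eq])
  have hne : E₁ ≠ E₂ := fun heq => h12 (heq ▸ h11)
  have hn1 : i₁ ∉ E' := fun hm => h12 (h2'.subset hm)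
  have hn2 : i₂ ∉ E' := fun hm => h21 (h1'.subset hm)
  rw [← Finset.sum_subset (Finset.subset_univ {E₁, E₂}), Finset.sum_pair hne]
  · obtain ⟨c₁, -, hc₁⟩ := cellForm_mul_ι h1'.subset h1'.rk_eq h11
      (h1'.isCell.notMem_labelSpan h1'.isCell' h1'.subset h11 hn1)
    obtain ⟨c₂, -, hc₂⟩ := cellForm_mul_ι h1.subset h1.rk_eq (h2.subset h22)
      (h1.isCell.notMem_labelSpan h1.isCell' h1.subset (h2.subset h22) h21)
    obtain ⟨c₃, -, hc₃⟩ := cellForm_mul_ι h2'.subset h2'.rk_eq h22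
      (h2'.isCell.notMem_labelSpan h2'.isCell' h2'.subset h22 hn2)
    obtain ⟨c₄, -, hc₄⟩ := cellForm_mul_ι h2.subset h2.rk_eq (h1.subset h11)
      (h2.isCell.notMem_labelSpan h2.isCell' h2.subset (h1.subset h11) h12)
    rw [h1.inc_eq (h2.subset h22) h21 hc₂, h1'.inc_eq h11 hn1 hc₁,
      h2.inc_eq (h1.subset h11) h12 hc₄, h2'.inc_eq h22 hn2 hc₃]
    -- Both products append `a i₁` and `a i₂` to the form of `E'`, in opposite orders, along the two
    -- paths of the diamond.
    have hswap : (c₁ * c₂ + c₃ * c₄) • cellForm a E = 0 := by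
      have hs := ExteriorAlgebra.ι_add_mul_swap (R := ℝ) (a i₁) (a i₂)
      have := congrArg (fun t => cellForm a E' * t) hs
      simp only [mul_add, mul_zero, ← mul_assoc] at this
      rw [hc₁, hc₃, smul_mul_assoc, smul_mul_assoc, hc₂, hc₄, smul_smul, smul_smul,
        ← add_smul] at this
      exact this
    have h0 : c₁ * c₂ + c₃ * c₄ = 0 :=
      (smul_eq_zero.1 hswap).resolve_right (cellForm_ne_zero E)
    have h3 : c₂ * c₁ = -(c₄ * c₃) := by linarith
    rw [← SignType.coe_mul, ← SignType.coe_mul, ← sign_mul, ← sign_mul, h3, Left.sign_neg,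
      SignType.coe_neg, neg_add_cancel]
  · intro G _ hG
    by_cases hc : IsCover a b E G
    · by_cases hc' : IsCover a b G E'
      · exact absurd (by simpa using huniq G hc hc') hG
      · rw [inc_of_not hc', mul_zero]
    · rw [inc_of_not hc, zero_mul]

end Diamond

/-! ### Exactness of the complex of visible cells -/

section Acyclic

variable {V ι : Type*} [AddCommGroup V] [Module ℝ V]

/-- A functional vanishing wherever those labelled by `E` do lies in their
span. -/
theorem mem_labelSpan_of_forall {a : ι → (V →ₗ[ℝ] ℝ)} {E : Finset ι} {z : V →ₗ[ℝ] ℝ}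
    (h : ∀ u, (∀ i ∈ E, a i u = 0) → z u = 0) : z ∈ labelSpan a E := by
  have : labelSpan a E = Submodule.span ℝ (Set.range fun l : E => a l) := by
    rw [labelSpan, Set.image_eq_range]; rfl
  rw [this]
  refine mem_span_of_iInf_ker_le_ker fun v hv => h v ?_
  simpa only [Submodule.mem_iInf, LinearMap.mem_ker, Subtype.forall] using hv

variable (a : ι → (V →ₗ[ℝ] ℝ)) (b : ι → ℝ)

/-- A point lying on the hyperplanes labelled by `E`, beyond those labelled by `F`, and in the
open strips of all the others. -/
structure IsBeyond (E F : Finset ι) (q : V) : Prop where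
  eq : ∀ i ∈ E, a i q = b i
  lt : ∀ i ∈ F, b i < a i q
  strip : ∀ i ∉ E, i ∉ F → b i - 1 < a i q ∧ a i q < b i

/-- Non-empty cells with label between `E` and `E ∪ F`. -/
def cellInterval [DecidableEq ι] (E F : Finset ι) : Set (Finset ι) :=
  {G | IsCell a b G ∧ E ⊆ G ∧ G ⊆ E ∪ F}

/-- The cellular differential, on functions on the set of all labels. -/
def cellDiff (k : Type*) [CommRing k] [Fintype ι] (z : Finset ι → k) (G : Finset ι) : k :=
  ∑ E : Finset ι, (inc a b E G : k) * z E

variable {a b}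

/-- The direction from the point beyond to a point of any cell of the interval keeps `E` tight and
decreases the functionals in `F`, so it opens that cell up to `E`. -/
theorem IsBeyond.isCell_of_mem [Finite ι] [DecidableEq ι] {E F G : Finset ι} {q : V}
    (hq : IsBeyond a b E F q) (hG : G ∈ cellInterval a b E F) : IsCell a b E := by
  obtain ⟨⟨x, hx⟩, hEG, hGF⟩ := hG
  refine IsCell.of_direction ⟨x, hx⟩ (u := x - q) (fun i hi => ?_) (fun i hi hi' => ?_) hEG
  · rw [map_sub, hx.1 i (hEG hi), hq.eq i hi, sub_self]
  · have hiF : i ∈ F := (Finset.mem_union.1 (hGF hi)).resolve_left hi'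
    rw [map_sub, hx.1 i hi]
    linarith [hq.lt i hiF]

variable (a b) in
/-- The ratio in which the hyperplane labelled by `i` divides the segment from `p` to `q`. -/
def crossing (p q : V) (i : ι) : ℝ := (b i - a i p) / (a i q - b i)

/-- On the segment from `p` to `q`, parametrised by the ratio `m`, the wall of `i ∈ F` is met
exactly when `m` equals `crossing a b p q i`. The intermediate point is thus on the walls met at
that moment, beyond those met earlier, and in the remaining strips. -/
theorem InCell.isBeyond_combination [DecidableEq ι] {E F : Finset ι} {p q : V}
    (hp : InCell a b E p) (hq : IsBeyond a b E F q) {m : ℝ} (hm : 0 < m) :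
    IsBeyond a b (E ∪ F.filter fun i => crossing a b p q i = m)
      (F.filter fun i => crossing a b p q i < m) ((1 + m)⁻¹ • (p + m • q)) := by
  have hm1 : 0 < (1 + m)⁻¹ := by positivity
  have hval : ∀ i, a i ((1 + m)⁻¹ • (p + m • q)) - b i
      = (1 + m)⁻¹ * ((a i p - b i) + m * (a i q - b i)) := fun i => by
    rw [map_smul, map_add, map_smul, smul_eq_mul, smul_eq_mul]
    field_simp
    ring
  have hF : ∀ i ∈ F, (a i p - b i) + m * (a i q - b i)
      = (m - crossing a b p q i) * (a i q - b i) := fun i hi => by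
    have : a i q - b i ≠ 0 := by linarith [hq.lt i hi]
    have h2 : crossing a b p q i * (a i q - b i) = b i - a i p := div_mul_cancel₀ _ this
    rw [sub_mul, h2]
    ring
  constructor
  · intro i hi
    rw [← sub_eq_zero, hval]
    rcases Finset.mem_union.1 hi with hi | hi
    · rw [hp.1 i hi, hq.eq i hi]; ring
    · rw [Finset.mem_filter] at hi
      rw [hF i hi.1, hi.2]; ring
  · intro i hi
    rw [Finset.mem_filter] at hi
    rw [← sub_pos, hval, hF i hi.1]
    exact mul_pos hm1 (mul_pos (by linarith [hi.2]) (by linarith [hq.lt i hi.1]))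
  · intro i hi hi'
    have hiE : i ∉ E := fun h => hi (Finset.mem_union_left _ h)
    obtain ⟨h1, h2⟩ := hp.2 i hiE
    have hlow : ∀ c, -1 < c → -1 < (1 + m)⁻¹ * ((a i p - b i) + m * c) := fun c hc => by
      have : -1 = (1 + m)⁻¹ * (-1 + m * -1) := by field_simp; ring
      rw [this]
      refine mul_lt_mul_of_pos_left ?_ hm1
      have := mul_lt_mul_of_pos_left hc hm
      linarith
    by_cases hiF : i ∈ F
    · have hgt : m < crossing a b p q i := by
        by_contra hcon
        rcases (not_lt.1 hcon).lt_or_eq with h | h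
        · exact hi' (Finset.mem_filter.2 ⟨hiF, h⟩)
        · exact hi (Finset.mem_union_right _ (Finset.mem_filter.2 ⟨hiF, h⟩))
      have h3 := hq.lt i hiF
      constructor
      · have := hlow (a i q - b i) (by linarith)
        rw [← hval] at this
        linarith
      · have : a i ((1 + m)⁻¹ • (p + m • q)) - b i < 0 := by
          rw [hval, hF i hiF]
          exact mul_neg_of_pos_of_neg hm1
            (mul_neg_of_neg_of_pos (by linarith) (by linarith))
        linarith
    · obtain ⟨h3, h4⟩ := hq.strip i hiE hiF
      constructor
      · have := hlow (a i q - b i) (by linarith)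
        rw [← hval] at this
        linarith
      · have : a i ((1 + m)⁻¹ • (p + m • q)) - b i < 0 := by
          rw [hval]
          refine mul_neg_of_pos_of_neg hm1 ?_
          have := mul_neg_of_pos_of_neg hm (show a i q - b i < 0 by linarith)
          linarith
        linarith

/-- A point of the open cell can be chosen so that the hyperplanes crossed last on the way to a
point beyond are parallel within the cell. -/
theorem IsBeyond.exists_parallel [Finite ι] [DecidableEq ι] {E F : Finset ι} {q : V}
    (hq : IsBeyond a b E F q) (hE : IsCell a b E) (hF : F.Nonempty) :
    ∃ p, InCell a b E p ∧ ∃ m, 0 < m ∧ (∃ i ∈ F, crossing a b p q i = m) ∧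
      (∀ i ∈ F, crossing a b p q i ≤ m) ∧
      ∀ i ∈ F, ∀ j ∈ F, crossing a b p q i = m → crossing a b p q j = m →
        ∀ u, (∀ l ∈ E, a l u = 0) → (a j q - b j) * a i u = (a i q - b i) * a j u := by
  classical
  -- The walls crossed last. The point `p` is chosen to make their number minimal; two of them not
  -- parallel within the cell could be separated by a small move of `p`.
  let top : V → Finset ι := fun p =>
    F.filter fun i => ∀ j ∈ F, crossing a b p q j ≤ crossing a b p q i
  have hex : ∃ n, ∃ p, InCell a b E p ∧ (top p).card = n := by
    obtain ⟨p, hp⟩ := hE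
    exact ⟨_, p, hp, rfl⟩
  obtain ⟨p, hp, hpn⟩ := Nat.find_spec hex
  have hmin : ∀ p', InCell a b E p' → (top p).card ≤ (top p').card := fun p' hp' => by
    rw [hpn]
    exact Nat.find_min' hex ⟨p', hp', rfl⟩
  obtain ⟨i₀, hi₀, hmax⟩ := F.exists_max_image (crossing a b p q) hF
  have hFE : ∀ i ∈ F, i ∉ E := fun i hi hiE => by
    have := hq.lt i hi
    rw [hq.eq i hiE] at this
    exact lt_irrefl _ this
  have hden : ∀ i ∈ F, 0 < a i q - b i := fun i hi => by linarith [hq.lt i hi]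
  refine ⟨p, hp, crossing a b p q i₀, ?_, ⟨i₀, hi₀, rfl⟩, hmax, ?_⟩
  · exact div_pos (by linarith [(hp.2 i₀ (hFE i₀ hi₀)).2]) (hden i₀ hi₀)
  intro i hi j hj hci hcj u hu
  by_contra hne
  -- One `ε` serves three purposes: to keep both strip inequalities, and to keep walls outside `top
  -- p` strictly earlier than wall `i`. The remaining index values are fillers with a trivial strict
  -- inequality.
  obtain ⟨ε, hε, hlt⟩ := exists_pos_forall_lt (ι := ι ⊕ ι ⊕ ι)
    (p := Sum.elim (fun l => if l ∈ E then b l - 1 else a l p) (Sum.elim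
      (fun l => if l ∈ E then -b l else - a l p)
      (fun l => if l ∈ F ∧ l ∉ top p then crossing a b p q l else crossing a b p q i₀ - 1)))
    (r := Sum.elim (fun l => b l) (Sum.elim (fun l => 1 - b l) (fun _ => crossing a b p q i₀)))
    (Sum.elim (fun l => a l u) (Sum.elim (fun l => - a l u)
      (fun l => a i u / (a i q - b i) - a l u / (a l q - b l)))) (by
      rintro (l | l | l)
      · by_cases hl : l ∈ E
        · simp [hl]
        · simpa [hl] using (hp.2 l hl).2
      · by_cases hl : l ∈ E
        · simp [hl]
        · simp only [Sum.elim_inr, Sum.elim_inl, hl, if_false]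
          linarith [(hp.2 l hl).1]
      · by_cases hl : l ∈ F ∧ l ∉ top p
        · simp only [Sum.elim_inr, hl, not_false_eq_true, and_self, if_true]
          refine lt_of_le_of_ne (hmax l hl.1) fun heq => hl.2 ?_
          exact Finset.mem_filter.2 ⟨hl.1, fun j hj => heq ▸ hmax j hj⟩
        · simp [hl])
  have hp' : InCell a b E (p + ε • u) := by
    refine ⟨fun l hl => by rw [map_add, map_smul, hu l hl, hp.1 l hl]; simp, fun l hl => ?_⟩
    have h1 := hlt (Sum.inl l)
    have h2 := hlt (Sum.inr (Sum.inl l))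
    simp only [Sum.elim_inr, Sum.elim_inl, hl, if_false] at h1 h2
    rw [map_add, map_smul, smul_eq_mul]
    constructor <;> linarith
  have hcross : ∀ l ∈ F, crossing a b (p + ε • u) q l
      = crossing a b p q l - ε * (a l u / (a l q - b l)) := fun l hl => by
    simp only [crossing, map_add, map_smul, smul_eq_mul]
    have := (hden l hl).ne'
    field_simp
    ring
  have hsub : top (p + ε • u) ⊆ top p := fun l hl => by
    by_contra hl'
    obtain ⟨hlF, hlmax⟩ := Finset.mem_filter.1 hl
    have h1 := hlt (Sum.inr (Sum.inr l))
    simp only [Sum.elim_inr, hlF, hl', not_false_eq_true, and_self, if_true] at h1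
    have h2 := hlmax i hi
    rw [hcross i hi, hcross l hlF, hci] at h2
    linarith
  have hne' : crossing a b (p + ε • u) q i ≠ crossing a b (p + ε • u) q j := fun heq => by
    rw [hcross i hi, hcross j hj, hci, hcj] at heq
    have h1 : a i u / (a i q - b i) = a j u / (a j q - b j) := by
      have : ε * (a i u / (a i q - b i)) = ε * (a j u / (a j q - b j)) := by linarith
      exact mul_left_cancel₀ hε.ne' this
    rw [div_eq_div_iff (hden i hi).ne' (hden j hj).ne'] at h1
    exact hne (by linarith)
  have hltcard : (top (p + ε • u)).card < (top p).card := by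
    refine Finset.card_lt_card ((Finset.ssubset_iff_of_subset hsub).2 ?_)
    have hmem : ∀ l ∈ F, crossing a b p q l = crossing a b p q i₀ → l ∈ top p := fun l hl hc =>
      Finset.mem_filter.2 ⟨hl, fun j hj => hc ▸ hmax j hj⟩
    rcases lt_or_gt_of_ne hne' with h | h
    · exact ⟨i, hmem i hi hci, fun hcon => absurd ((Finset.mem_filter.1 hcon).2 j hj) (not_le.2 h)⟩
    · exact ⟨j, hmem j hj hcj, fun hcon => absurd ((Finset.mem_filter.1 hcon).2 i hi) (not_le.2 h)⟩
  exact absurd (hmin _ hp') (not_le.2 hltcard)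

variable (a b) in
/-- The cellular complex of a family of cells is exact. -/
def IsAcyclicOn (k : Type*) [CommRing k] [Fintype ι] (T : Set (Finset ι)) : Prop :=
  ∀ z : Finset ι → k, (∀ E ∉ T, z E = 0) → (∀ E ∈ T, cellDiff a b k z E = 0) →
    ∃ y : Finset ι → k, (∀ E ∉ T, y E = 0) ∧ ∀ E ∈ T, cellDiff a b k y E = z E

theorem cellDiff_cellDiff {k : Type*} [CommRing k] [Fintype ι] [DecidableEq ι]
    (z : Finset ι → k) (G : Finset ι) : cellDiff a b k (cellDiff a b k z) G = 0 := by
  simp only [cellDiff, Finset.mul_sum]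
  rw [Finset.sum_comm]
  refine Finset.sum_eq_zero fun E _ => ?_
  have := congrArg (fun n : ℤ => (n : k) * z E) (sum_inc_mul_inc (a := a) (b := b) E G)
  simp only [Int.cast_sum, Int.cast_mul, Int.cast_zero, zero_mul, Finset.sum_mul] at this
  rw [← this]
  exact Finset.sum_congr rfl fun G' _ => by ring

theorem cellDiff_add {k : Type*} [CommRing k] [Fintype ι] (z z' : Finset ι → k)
    (G : Finset ι) :
    cellDiff a b k (z + z') G = cellDiff a b k z G + cellDiff a b k z' G := by
  simp [cellDiff, mul_add, Finset.sum_add_distrib]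

theorem cellDiff_sub {k : Type*} [CommRing k] [Fintype ι] (z z' : Finset ι → k)
    (G : Finset ι) :
    cellDiff a b k (z - z') G = cellDiff a b k z G - cellDiff a b k z' G := by
  simp [cellDiff, mul_sub, Finset.sum_sub_distrib]

/-- Exactness of an extension of exact families of cells. -/
theorem IsAcyclicOn.union {k : Type*} [CommRing k] [Fintype ι] [DecidableEq ι]
    {T T₁ T₂ : Set (Finset ι)} (h₁ : IsAcyclicOn a b k T₁) (h₂ : IsAcyclicOn a b k T₂)
    (hT : T = T₁ ∪ T₂) (hdisj : Disjoint T₁ T₂)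
    (hsub : ∀ E ∈ T₁, ∀ G ∈ T₂, ¬ G ⊆ E)
    (hconv : ∀ E ∈ T, ∀ E' ∈ T, ∀ G, IsCell a b G → E ⊆ G → G ⊆ E' → G ∈ T) :
    IsAcyclicOn a b k T := by
  classical
  have hT₁ : T₁ ⊆ T := hT ▸ Set.subset_union_left
  have hT₂ : T₂ ⊆ T := hT ▸ Set.subset_union_right
  -- a function supported on `T₁` has zero differential on `T₂`
  have hzero : ∀ z : Finset ι → k, (∀ E ∉ T₁, z E = 0) → ∀ G ∈ T₂, cellDiff a b k z G = 0 := by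
    intro z hz G hG
    refine Finset.sum_eq_zero fun E _ => ?_
    by_cases hE : E ∈ T₁
    · rw [inc_of_not fun hc => hsub E hE G hG hc.subset]; simp
    · rw [hz E hE, mul_zero]
  intro z hz hdz
  -- No cell of `T₁` has a boundary component in `T₂`, so the part of `z` on `T₂` is a cycle there
  -- and can be solved for first.
  obtain ⟨y₂, hy₂, hdy₂⟩ := h₂ (T₂.indicator z) (fun E hE => Set.indicator_of_notMem hE _) (by
    intro G hG
    have h1 : z = T₁.indicator z + T₂.indicator z := by
      refine Eq.trans ?_ (Set.indicator_union_of_disjoint hdisj z)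
      rw [← hT]
      funext E
      by_cases hE : E ∈ T
      · rw [Set.indicator_of_mem hE]
      · rw [Set.indicator_of_notMem hE, hz E hE]
    have h2 := hdz G (hT₂ hG)
    rw [h1, cellDiff_add, hzero _ (fun E hE => Set.indicator_of_notMem hE _) G hG, zero_add] at h2
    exact h2)
  have hy₂T : ∀ E ∉ T, y₂ E = 0 := fun E hE => hy₂ E fun h => hE (hT₂ h)
  -- what remains to be solved on `T₁`
  set w : Finset ι → k := z - T.indicator (cellDiff a b k y₂) with hw
  have hw2 : ∀ E ∉ T₁, w E = 0 := fun E hE => by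
    by_cases hE2 : E ∈ T₂
    · rw [hw, Pi.sub_apply, Set.indicator_of_mem (hT₂ hE2), hdy₂ E hE2,
        Set.indicator_of_mem hE2, sub_self]
    · have hET : E ∉ T := by
        rw [hT]
        rintro (h | h)
        · exact hE h
        · exact hE2 h
      rw [hw, Pi.sub_apply, Set.indicator_of_notMem hET, hz E hET, sub_zero]
  obtain ⟨y₁, hy₁, hdy₁⟩ := h₁ w hw2 (by
    intro G hG
    rw [hw, cellDiff_sub, hdz G (hT₁ hG), zero_sub, neg_eq_zero,
      ← cellDiff_cellDiff (a := a) (b := b) y₂ G]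
    refine Finset.sum_congr rfl fun E _ => ?_
    by_cases hE : E ∈ T
    · rw [Set.indicator_of_mem hE]
    · rw [Set.indicator_of_notMem hE, mul_zero]
      by_cases hc : IsCover a b E G
      · have : cellDiff a b k y₂ E = 0 := Finset.sum_eq_zero fun E' _ => by
          by_cases hE' : E' ∈ T
          · by_cases hc' : IsCover a b E' E
            · exact absurd (hconv G (hT₁ hG) E' hE' E hc.isCell hc.subset hc'.subset) hE
            · rw [inc_of_not hc']; simp
          · rw [hy₂T E' hE', mul_zero]
        rw [this, mul_zero]
      · rw [inc_of_not hc]; simp)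
  refine ⟨y₁ + y₂, fun E hE => ?_, fun E hE => ?_⟩
  · rw [Pi.add_apply, hy₁ E fun h => hE (hT₁ h), hy₂T E hE, add_zero]
  · rw [cellDiff_add]
    have hwE : w E = z E - cellDiff a b k y₂ E := by
      rw [hw, Pi.sub_apply, Set.indicator_of_mem hE]
    by_cases hE1 : E ∈ T₁
    · rw [hdy₁ E hE1, hwE]; ring
    · have hE2 : E ∈ T₂ := by
        rw [hT] at hE
        exact hE.resolve_left hE1
      rw [hzero y₁ hy₁ E hE2, zero_add, ← sub_eq_zero, ← neg_sub, ← hwE, hw2 E hE1, neg_zero]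

/-- The only differential is multiplication by an incidence number, which is its own inverse. -/
theorem isAcyclicOn_pair {k : Type*} [CommRing k] [Fintype ι] [DecidableEq ι]
    {E E' : Finset ι} (h : IsCover a b E E') : IsAcyclicOn a b k {E, E'} := by
  have hne : E ≠ E' := fun heq => by
    have := h.rk_eq
    rw [heq] at this
    omega
  have hself : ∀ G, ¬ IsCover a b G G := fun G hG => by
    have := hG.rk_eq
    omega
  have hback : ¬ IsCover a b E' E := fun hc => by
    have h1 := hc.rk_eq
    have h2 := h.rk_eq
    omega
  have hdiff : ∀ z : Finset ι → k, (∀ G ∉ ({E, E'} : Set (Finset ι)), z G = 0) → ∀ G,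
      cellDiff a b k z G = inc a b E G * z E + inc a b E' G * z E' := fun z hz G => by
    rw [cellDiff, ← Finset.sum_subset (Finset.subset_univ {E, E'}), Finset.sum_pair hne]
    intro G' _ hG'
    rw [hz G' (by simpa using hG'), mul_zero]
  intro z hz hdz
  have hsq : (inc a b E E' : k) * inc a b E E' = 1 := by
    rcases Int.isUnit_iff.1 h.inc_isUnit with h1 | h1 <;> simp [h1]
  have hz0 : z E = 0 := by
    have := hdz E' (by simp)
    rw [hdiff z hz, inc_of_not (hself E'), Int.cast_zero, zero_mul, add_zero] at this
    have h2 := congrArg (fun t => (inc a b E E' : k) * t) this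
    simpa only [← mul_assoc, hsq, one_mul, mul_zero] using h2
  refine ⟨Pi.single E (inc a b E E' * z E'), fun G hG => ?_, ?_⟩
  · exact Pi.single_eq_of_ne (fun h0 => hG (by simp [h0])) _
  · intro G hG
    rw [hdiff _ fun G hG => Pi.single_eq_of_ne (fun h0 => hG (by simp [h0])) _]
    rw [Pi.single_eq_same, Pi.single_eq_of_ne hne.symm, mul_zero, add_zero]
    rcases hG with rfl | hG
    · rw [inc_of_not (hself G), hz0]; simp
    · rw [Set.mem_singleton_iff] at hG
      subst hG
      rw [← mul_assoc, hsq, one_mul]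

/-- The cells that are visible from a point form an exact complex. -/
theorem IsBeyond.isAcyclicOn (k : Type*) [CommRing k] [Fintype ι] [DecidableEq ι]
    {E F : Finset ι} {q : V} (hq : IsBeyond a b E F q) (hF : F.Nonempty) :
    IsAcyclicOn a b k (cellInterval a b E F) := by
  induction hn : F.card using Nat.strong_induction_on generalizing E F q with
  | _ n ih =>
  by_cases hE : IsCell a b E
  swap
  · intro z hz _
    exact ⟨0, fun _ _ => rfl, fun G hG => absurd (hq.isCell_of_mem hG) hE⟩
  obtain ⟨p, hp, m, hm, ⟨i₀, hi₀, hci₀⟩, hmax, hpar⟩ := hq.exists_parallel hE hF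
  set G := F.filter fun i => crossing a b p q i = m with hG
  set F' := F.filter fun i => crossing a b p q i < m with hF'
  have hi₀G : i₀ ∈ G := Finset.mem_filter.2 ⟨hi₀, hci₀⟩
  have hFG : ∀ i ∈ F, i ∈ G ∨ i ∈ F' := fun i hi => by
    rcases (hmax i hi).lt_or_eq with h | h
    · exact Or.inr (Finset.mem_filter.2 ⟨hi, h⟩)
    · exact Or.inl (Finset.mem_filter.2 ⟨hi, h⟩)
  have hF'G : ∀ i ∈ F', i ∉ G := fun i hi hi' =>
    (Finset.mem_filter.1 hi).2.ne (Finset.mem_filter.1 hi').2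
  have hFE : ∀ i ∈ F, i ∉ E := fun i hi hiE => by
    have := hq.lt i hi
    rw [hq.eq i hiE] at this
    exact lt_irrefl _ this
  have hden : ∀ i ∈ F, 0 < a i q - b i := fun i hi => by linarith [hq.lt i hi]
  have hcard : F'.card < n := by
    rw [← hn]
    refine Finset.card_lt_card ((Finset.ssubset_iff_of_subset (Finset.filter_subset _ _)).2
      ⟨i₀, hi₀, fun h => hF'G i₀ h hi₀G⟩)
  have hq' : IsBeyond a b (E ∪ G) F' _ := hp.isBeyond_combination hq hm
  -- a cell on one of the last hyperplanes is on all of them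
  have hall : ∀ T ∈ cellInterval a b E F, ∀ i ∈ T, i ∈ G → G ⊆ T := by
    rintro T ⟨⟨x, hx⟩, hET, -⟩ i hiT hiG j hjG
    by_contra hjT
    obtain ⟨hiF, hci⟩ := Finset.mem_filter.1 hiG
    obtain ⟨hjF, hcj⟩ := Finset.mem_filter.1 hjG
    have h1 := hpar i hiF j hjF hci hcj (x - p) (fun l hl => by
      rw [map_sub, hx.1 l (hET hl), hp.1 l hl, sub_self])
    have h2 : m * (a i q - b i) = b i - a i p := by
      rw [← hci]; exact div_mul_cancel₀ _ (hden i hiF).ne'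
    have h3 : m * (a j q - b j) = b j - a j p := by
      rw [← hcj]; exact div_mul_cancel₀ _ (hden j hjF).ne'
    rw [map_sub, map_sub, hx.1 i hiT, ← h2] at h1
    have h4 : (a i q - b i) * (m * (a j q - b j) - (a j x - a j p)) = 0 := by linarith
    rw [h3] at h4
    rcases mul_eq_zero.1 h4 with h5 | h5
    · exact (hden i hiF).ne' h5
    · linarith [(hx.2 j hjT).2]
  have hTdecomp : cellInterval a b E F = cellInterval a b E F' ∪ cellInterval a b (E ∪ G) F' := by
    ext T
    constructor
    · intro hT
      by_cases hex : ∃ i ∈ T, i ∈ G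
      · obtain ⟨i, hi, hiG⟩ := hex
        refine Or.inr ⟨hT.1, Finset.union_subset hT.2.1 (hall T hT i hi hiG), fun j hj => ?_⟩
        rcases Finset.mem_union.1 (hT.2.2 hj) with h | h
        · exact Finset.mem_union_left _ (Finset.mem_union_left _ h)
        · rcases hFG j h with h | h
          · exact Finset.mem_union_left _ (Finset.mem_union_right _ h)
          · exact Finset.mem_union_right _ h
      · push Not at hex
        refine Or.inl ⟨hT.1, hT.2.1, fun j hj => ?_⟩
        rcases Finset.mem_union.1 (hT.2.2 hj) with h | h
        · exact Finset.mem_union_left _ h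
        · exact Finset.mem_union_right _ ((hFG j h).resolve_left (hex j hj))
    · rintro (hT | hT)
      · exact ⟨hT.1, hT.2.1, hT.2.2.trans
          (Finset.union_subset_union_right (Finset.filter_subset _ _))⟩
      · refine ⟨hT.1, Finset.subset_union_left.trans hT.2.1, hT.2.2.trans ?_⟩
        exact Finset.union_subset
          (Finset.union_subset_union_right (Finset.filter_subset _ _))
          ((Finset.filter_subset _ _).trans Finset.subset_union_right)
  by_cases hF'0 : F'.Nonempty
  · -- both pieces are exact by induction
    obtain ⟨j₀, hj₀, hj₀max⟩ := F'.exists_max_image (crossing a b p q) hF'0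
    have hj₀m := (Finset.mem_filter.1 hj₀).2
    have hj₀F := (Finset.mem_filter.1 hj₀).1
    have hj₀pos : 0 < crossing a b p q j₀ :=
      div_pos (by linarith [(hp.2 j₀ (hFE j₀ hj₀F)).2]) (hden j₀ hj₀F)
    -- Halfway between the last crossing of `F'` and the final crossing at `m`, exactly the walls of
    -- `F'` have been passed and no wall of `F` is touched.
    have hq'' := hp.isBeyond_combination hq
      (show 0 < (crossing a b p q j₀ + m) / 2 by linarith)
    have e1 : (F.filter fun i => crossing a b p q i = (crossing a b p q j₀ + m) / 2) = ∅ := by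
      refine Finset.filter_eq_empty_iff.2 fun i hi heq => ?_
      rcases hFG i hi with h | h
      · have := (Finset.mem_filter.1 h).2
        linarith
      · have := hj₀max i h
        linarith
    have e2 : (F.filter fun i => crossing a b p q i < (crossing a b p q j₀ + m) / 2) = F' := by
      ext i
      rw [Finset.mem_filter]
      constructor
      · rintro ⟨hi, h⟩
        exact Finset.mem_filter.2 ⟨hi, by linarith⟩
      · intro hi
        have := hj₀max i hi
        exact ⟨(Finset.mem_filter.1 hi).1, by linarith⟩
    rw [e1, e2, Finset.union_empty] at hq''
    refine IsAcyclicOn.union (ih _ hcard hq'' hF'0 rfl) (ih _ hcard hq' hF'0 rfl) hTdecomp ?_ ?_ ?_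
    · rw [Set.disjoint_left]
      intro T hT hT'
      have := hT.2.2 (hT'.2.1 (Finset.mem_union_right _ hi₀G))
      rcases Finset.mem_union.1 this with h | h
      · exact hFE i₀ hi₀ h
      · exact hF'G i₀ h hi₀G
    · intro T hT T' hT' hsub
      have := hT.2.2 (hsub (hT'.2.1 (Finset.mem_union_right _ hi₀G)))
      rcases Finset.mem_union.1 this with h | h
      · exact hFE i₀ hi₀ h
      · exact hF'G i₀ h hi₀G
    · intro T hT T' hT' T'' hcell h h'
      exact ⟨hcell, hT.2.1.trans h, h'.trans hT'.2.2⟩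
  · -- two cells remain
    rw [Finset.not_nonempty_iff_eq_empty] at hF'0
    rw [hF'0] at hq' hTdecomp
    have hEG : IsCell a b (E ∪ G) :=
      ⟨_, hq'.eq, fun i hi => hq'.strip i hi (Finset.notMem_empty i)⟩
    have hrk : rk a (E ∪ G) ≤ rk a E + 1 := by
      have hle : labelSpan a (E ∪ G) ≤ ℝ ∙ a i₀ ⊔ labelSpan a E := by
        rw [labelSpan, Submodule.span_le]
        rintro _ ⟨i, hi, rfl⟩
        rcases Finset.mem_union.1 hi with hi | hi
        · exact Submodule.mem_sup_right (mem_labelSpan hi)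
        · obtain ⟨hiF, hci⟩ := Finset.mem_filter.1 hi
          have hmem : a i - ((a i q - b i) / (a i₀ q - b i₀)) • a i₀ ∈ labelSpan a E := by
            refine mem_labelSpan_of_forall fun u hu => ?_
            have h1 := hpar i hiF i₀ hi₀ hci hci₀ u hu
            have h2 := (hden i₀ hi₀).ne'
            rw [LinearMap.sub_apply, LinearMap.smul_apply, smul_eq_mul, div_mul_eq_mul_div,
              ← h1, mul_div_cancel_left₀ _ h2, sub_self]
          have : a i = ((a i q - b i) / (a i₀ q - b i₀)) • a i₀
              + (a i - ((a i q - b i) / (a i₀ q - b i₀)) • a i₀) := by abel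
          rw [SetLike.mem_coe, this]
          exact Submodule.add_mem_sup
            (Submodule.smul_mem _ _ (Submodule.mem_span_singleton_self _)) hmem
      have h1 : rk a (E ∪ G) ≤
          Module.finrank ℝ (ℝ ∙ a i₀ ⊔ labelSpan a E : Submodule ℝ (V →ₗ[ℝ] ℝ)) :=
        Submodule.finrank_mono hle
      have h2 := Submodule.finrank_add_le_finrank_add_finrank (ℝ ∙ a i₀) (labelSpan a E)
      have h3 : Module.finrank ℝ (ℝ ∙ a i₀) ≤ 1 := by
        simpa using finrank_span_le_card (R := ℝ) ({a i₀} : Set (V →ₗ[ℝ] ℝ))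
      change _ ≤ _ + rk a E at h2
      omega
    have hcov : IsCover a b (E ∪ G) E :=
      ⟨hEG, hE, Finset.subset_union_left, by
        have := hEG.rk_lt hE Finset.subset_union_left (Finset.mem_union_right _ hi₀G) (hFE i₀ hi₀)
        omega⟩
    have : cellInterval a b E F = {E ∪ G, E} := by
      rw [hTdecomp]
      ext T
      simp only [cellInterval, Finset.union_empty, Set.mem_union, Set.mem_ofPred_eq,
        Set.mem_insert_iff, Set.mem_singleton_iff]
      constructor
      · rintro (⟨-, h1, h2⟩ | ⟨-, h1, h2⟩)
        · exact Or.inr (h2.antisymm h1)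
        · exact Or.inl (h2.antisymm h1)
      · rintro (rfl | rfl)
        · exact Or.inr ⟨hEG, subset_rfl, subset_rfl⟩
        · exact Or.inl ⟨hE, subset_rfl, subset_rfl⟩
    rw [this]
    exact isAcyclicOn_pair hcov

end Acyclic

/-! ### Conic modules in terms of facet levels -/

section Levels

variable {M : Type*} [AddCommGroup M]

/-- The integer `⌈⟨x, n⟩⌉`. -/
def level (x : RealSpace M) (n : Module.Dual ℤ M) : ℤ := ⌈realFunctional n x⌉

theorem level_add_latticePoint (x : RealSpace M) (m : M) (n : Module.Dual ℤ M) :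
    level (x + latticePoint m) n = level x n + n m := by
  rw [level, map_add, realFunctional_latticePoint, Int.ceil_add_intCast, level]

/-- The standing hypotheses on a cone: rational polyhedral and full dimensional. -/
structure IsFullRational (C : PointedCone ℝ (RealSpace M)) : Prop where
  rational : IsRationalPolyhedral C
  full : IsFullDimensional C

/-- A large multiple of an interior lattice point dominates any finite list of facet values. -/
theorem IsFullRational.exists_ge {C : PointedCone ℝ (RealSpace M)}
    (hC : IsFullRational C) (f : Module.Dual ℤ M → ℤ) :
    ∃ u : M, ∀ n ∈ primitiveNormals C, f n ≤ n u := by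
  obtain ⟨u, hu⟩ := exists_interior_point hC.rational hC.full
  have hfin := primitiveNormals_finite hC.rational hC.full
  refine ⟨(∑ n ∈ hfin.toFinset, |f n|) • u, fun n hn => ?_⟩
  rw [map_smul, smul_eq_mul]
  have h1 : |f n| ≤ ∑ n ∈ hfin.toFinset, |f n| :=
    Finset.single_le_sum (f := fun n => |f n|) (fun _ _ => abs_nonneg _) (hfin.mem_toFinset.2 hn)
  have h2 := hu n hn
  have h3 := le_abs_self (f n)
  have h4 := abs_nonneg (f n)
  nlinarith

variable [Module.Free ℤ M] [Module.Finite ℤ M] {C : PointedCone ℝ (RealSpace M)}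

/-- Normals take integer values on the lattice, so the facet inequalities may be rounded up to
ceilings; a conic module depends on `x` only through its levels. -/
theorem IsFullRational.mem_translatePoints_iff (hC : IsFullRational C) {x : RealSpace M} {m : M} :
    m ∈ translatePoints C x ↔ ∀ n ∈ primitiveNormals C, level x n ≤ n m := by
  change latticePoint m - x ∈ C ↔ _
  rw [mem_cone_iff hC.rational hC.full]
  refine forall₂_congr fun n _ => ?_
  rw [map_sub, realFunctional_latticePoint, sub_nonneg, level, Int.ceil_le]

theorem IsFullRational.translatePoints_nonempty (hC : IsFullRational C) (x : RealSpace M) :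
    (translatePoints C x).Nonempty := by
  obtain ⟨u, hu⟩ := hC.exists_ge (level x)
  exact ⟨u, hC.mem_translatePoints_iff.2 hu⟩

/-- A translate of the lattice points of one translated cone lies in another exactly if it does so
with respect to each facet. -/
theorem IsFullRational.forall_add_mem_iff (hC : IsFullRational C) {v y : RealSpace M} {m : M} :
    (∀ t ∈ translatePoints C v, m + t ∈ translatePoints C y) ↔
      ∀ n ∈ primitiveNormals C, level y n ≤ n m + level v n := by
  constructor
  · intro h n hn
    obtain ⟨m₁, hm₁⟩ := surjective_of_mem_primitiveNormals hn
    obtain ⟨u, hu0, hu⟩ := exists_facet_point hC.rational hC.full hn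
    have hfin := primitiveNormals_finite hC.rational hC.full
    set N : ℤ := ∑ n' ∈ hfin.toFinset, |level v n' - level v n * n' m₁| with hN
    -- A lattice point that attains the level for `n` exactly: `m₁` has `n`-value 1, and a large
    -- multiple of a facet point satisfies the other inequalities without changing that value.
    have hmem : level v n • m₁ + N • u ∈ translatePoints C v := by
      rw [hC.mem_translatePoints_iff]
      intro n' hn'
      simp only [map_add, map_smul, smul_eq_mul]
      by_cases hne : n' = n
      · rw [hne, hm₁, hu0]; simp
      · have h1 : |level v n' - level v n * n' m₁| ≤ N :=
          Finset.single_le_sum (f := fun n' => |level v n' - level v n * n' m₁|)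
            (fun _ _ => abs_nonneg _) (hfin.mem_toFinset.2 hn')
        have h2 := hu n' hn' hne
        have h3 := le_abs_self (level v n' - level v n * n' m₁)
        have h4 := abs_nonneg (level v n' - level v n * n' m₁)
        nlinarith
    have := (hC.mem_translatePoints_iff.1 (h _ hmem)) n hn
    simpa only [map_add, map_smul, smul_eq_mul, hm₁, hu0, mul_one, mul_zero, add_zero] using this
  · intro h t ht
    rw [hC.mem_translatePoints_iff] at ht ⊢
    intro n hn
    rw [map_add]
    linarith [h n hn, ht n hn]

theorem IsFullRational.translatePoints_subset_iff (hC : IsFullRational C) {v y : RealSpace M} :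
    translatePoints C v ⊆ translatePoints C y ↔
      ∀ n ∈ primitiveNormals C, level y n ≤ level v n := by
  have := hC.forall_add_mem_iff (v := v) (y := y) (m := 0)
  simp only [zero_add, map_zero] at this
  exact this

end Levels

/-! ### Homomorphisms of conic modules as Laurent polynomials -/

section Symbols

variable {k : Type*} [Field k] {M : Type*} [AddCommGroup M] {C : PointedCone ℝ (RealSpace M)}
  {v y : RealSpace M}

theorem toLaurent_mem (g : ConicModule k C v) {m : M} (hm : (toLaurent k g).coeff m ≠ 0) :
    m ∈ translatePoints C v := by
  by_contra hcon
  exact hm (AddMonoidAlgebra.mem_supported'.1 g.2 m hcon)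

theorem toLaurent_injective :
    Function.Injective (toLaurent k : ConicModule k C v → AddMonoidAlgebra k M) :=
  Subtype.val_injective

@[simp] theorem toLaurent_smul (r : toricAlgebra k C) (g : ConicModule k C v) :
    toLaurent k (r • g) = r.1 * toLaurent k g := rfl

@[simp] theorem toLaurent_add (g g' : ConicModule k C v) :
    toLaurent k (g + g') = toLaurent k g + toLaurent k g' := rfl

@[simp] theorem toLaurent_zero : toLaurent k (0 : ConicModule k C v) = 0 := rfl

theorem toLaurent_sum {ι : Type*} (s : Finset ι) (g : ι → ConicModule k C v) :
    toLaurent k (∑ i ∈ s, g i) = ∑ i ∈ s, toLaurent k (g i) := by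
  classical
  induction s using Finset.induction_on with
  | empty => rfl
  | insert i s hi ih => rw [Finset.sum_insert hi, Finset.sum_insert hi, toLaurent_add, ih]

/-- An element of the Laurent ring supported on the lattice points of the translated cone. -/
def ofLaurent (f : AddMonoidAlgebra k M) (hf : ∀ m, f.coeff m ≠ 0 → m ∈ translatePoints C v) :
    ConicModule k C v :=
  ⟨f, AddMonoidAlgebra.mem_supported'.2 fun m hm => by
    by_contra hcon
    exact hm (hf m hcon)⟩

variable (k) in
/-- The monomial with exponent `m`. -/
def mono {m : M} (hm : m ∈ translatePoints C v) : ConicModule k C v :=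
  ofLaurent (AddMonoidAlgebra.single m 1) fun m' hm' => by
    classical
    rw [AddMonoidAlgebra.coeff_single, Finsupp.single_apply] at hm'
    split_ifs at hm' with h
    · exact h ▸ hm
    · exact absurd rfl hm'

@[simp] theorem toLaurent_mono {m : M} (hm : m ∈ translatePoints C v) :
    toLaurent k (mono k hm) = AddMonoidAlgebra.single m 1 := rfl

theorem single_mul_cancel {m : M} {f g : AddMonoidAlgebra k M}
    (h : f * AddMonoidAlgebra.single m 1 = g * AddMonoidAlgebra.single m 1) : f = g := by
  have := congrArg (fun t => t * AddMonoidAlgebra.single (-m) (1 : k)) h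
  simpa [mul_assoc, AddMonoidAlgebra.single_mul_single, ← AddMonoidAlgebra.one_def] using this

theorem exists_mem_support_of_mul {f g : AddMonoidAlgebra k M} {m : M}
    (h : (f * g).coeff m ≠ 0) : ∃ m₁ m₂, f.coeff m₁ ≠ 0 ∧ g.coeff m₂ ≠ 0 ∧ m₁ + m₂ = m := by
  classical
  have := AddMonoidAlgebra.support_coeff_mul_subset f g (Finsupp.mem_support_iff.2 h)
  obtain ⟨m₁, h₁, m₂, h₂, rfl⟩ := Finset.mem_add.1 this
  exact ⟨m₁, m₂, Finsupp.mem_support_iff.1 h₁, Finsupp.mem_support_iff.1 h₂, rfl⟩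

/-- The Laurent polynomial `f` such that a homomorphism of conic modules is multiplication
by `f`. -/
def symbol (φ : ConicModule k C v →ₗ[toricAlgebra k C] ConicModule k C y) :
    AddMonoidAlgebra k M :=
  open Classical in
  if h : ∃ f, ∀ g, toLaurent k (φ g) = f * toLaurent k g then h.choose else 0

variable (C v y) in
/-- Multiplication by a Laurent polynomial. -/
def ofSymbol (f : AddMonoidAlgebra k M)
    (hf : ∀ m, f.coeff m ≠ 0 → ∀ t ∈ translatePoints C v, m + t ∈ translatePoints C y) :
    ConicModule k C v →ₗ[toricAlgebra k C] ConicModule k C y where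
  toFun g := ofLaurent (f * toLaurent k g) fun m hm => by
    obtain ⟨m₁, m₂, h₁, h₂, rfl⟩ := exists_mem_support_of_mul hm
    exact hf m₁ h₁ m₂ (toLaurent_mem g h₂)
  map_add' g g' := toLaurent_injective (mul_add _ _ _)
  map_smul' r g := toLaurent_injective (mul_left_comm _ _ _)

@[simp] theorem toLaurent_ofSymbol (f : AddMonoidAlgebra k M)
    (hf : ∀ m, f.coeff m ≠ 0 → ∀ t ∈ translatePoints C v, m + t ∈ translatePoints C y)
    (g : ConicModule k C v) : toLaurent k (ofSymbol C v y f hf g) = f * toLaurent k g := rfl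

variable (k) in
/-- The inclusion of a conic module in another. -/
def inclusion (h : translatePoints C v ⊆ translatePoints C y) :
    ConicModule k C v →ₗ[toricAlgebra k C] ConicModule k C y :=
  ofSymbol C v y 1 fun m hm t ht => by
    classical
    rw [AddMonoidAlgebra.one_def, AddMonoidAlgebra.coeff_single, Finsupp.single_apply] at hm
    split_ifs at hm with h0
    · rw [← h0, zero_add]; exact h ht
    · exact absurd rfl hm

variable [Module.Free ℤ M] [Module.Finite ℤ M]

/-- A conic module can be moved into the toric algebra by multiplication with a monomial. -/
theorem IsFullRational.exists_single_mul_mem (k : Type*) [Field k] (hC : IsFullRational C)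
    (v : RealSpace M) :
    ∃ u : M, ∀ g : ConicModule k C v,
      AddMonoidAlgebra.single u 1 * toLaurent k g ∈ toricAlgebra k C := by
  obtain ⟨u, hu⟩ := hC.exists_ge (fun n => - level v n)
  have hu0 : ∀ t ∈ translatePoints C v, u + t ∈ translatePoints C 0 := by
    rw [hC.forall_add_mem_iff]
    intro n hn
    have : level (0 : RealSpace M) n = 0 := by simp [level]
    rw [this]
    linarith [hu n hn]
  refine ⟨u, fun g => ?_⟩
  change _ ∈ AddMonoidAlgebra.supported k k (translatePoints C 0)
  rw [AddMonoidAlgebra.mem_supported']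
  intro m hm
  by_contra hcon
  obtain ⟨m₁, m₂, h₁, h₂, rfl⟩ := exists_mem_support_of_mul hcon
  classical
  rw [AddMonoidAlgebra.coeff_single, Finsupp.single_apply] at h₁
  split_ifs at h₁ with h0
  · exact hm (h0 ▸ hu0 m₂ (toLaurent_mem g h₂))
  · exact absurd rfl h₁

/-- Conic modules are torsion-free of rank one. A monomial `x^u` moves the whole module into the
ring, so `g` and `x^{m₀}` satisfy a relation with ring coefficients; applying `φ` and cancelling
monomials shows that `φ` is multiplication by `x^{-m₀} φ(x^{m₀})`. -/
theorem IsFullRational.toLaurent_apply (hC : IsFullRational C)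
    (φ : ConicModule k C v →ₗ[toricAlgebra k C] ConicModule k C y) (g : ConicModule k C v) :
    toLaurent k (φ g) = symbol φ * toLaurent k g := by
  have hex : ∃ f, ∀ g, toLaurent k (φ g) = f * toLaurent k g := by
    obtain ⟨m₀, hm₀⟩ := hC.translatePoints_nonempty v
    obtain ⟨u, hmem⟩ := hC.exists_single_mul_mem k v
    refine ⟨AddMonoidAlgebra.single (-m₀) 1 * toLaurent k (φ (mono k hm₀)), fun g => ?_⟩
    have h1 : (⟨_, hmem g⟩ : toricAlgebra k C) • mono k hm₀
        = (⟨_, hmem (mono k hm₀)⟩ : toricAlgebra k C) • g := by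
      apply toLaurent_injective
      simp only [toLaurent_smul]
      ring
    have h2 := congrArg (fun g => toLaurent k (φ g)) h1
    simp only [map_smul, toLaurent_smul, toLaurent_mono] at h2
    apply single_mul_cancel (m := u)
    apply single_mul_cancel (m := m₀)
    have h3 : AddMonoidAlgebra.single (-m₀) (1 : k) * AddMonoidAlgebra.single m₀ 1 = 1 := by
      rw [AddMonoidAlgebra.single_mul_single, neg_add_cancel, one_mul,
        ← AddMonoidAlgebra.one_def]
    calc toLaurent k (φ g) * AddMonoidAlgebra.single u 1 * AddMonoidAlgebra.single m₀ 1
        = AddMonoidAlgebra.single u 1 * AddMonoidAlgebra.single m₀ 1 * toLaurent k (φ g) := by ring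
      _ = AddMonoidAlgebra.single u 1 * toLaurent k g * toLaurent k (φ (mono k hm₀)) := h2.symm
      _ = (AddMonoidAlgebra.single (-m₀) (1 : k) * AddMonoidAlgebra.single m₀ 1) *
            (AddMonoidAlgebra.single u 1 * toLaurent k g * toLaurent k (φ (mono k hm₀))) := by
          rw [h3, one_mul]
      _ = _ := by ring
  rw [symbol, dif_pos hex]
  exact hex.choose_spec g

theorem IsFullRational.symbol_eq (hC : IsFullRational C)
    {φ : ConicModule k C v →ₗ[toricAlgebra k C] ConicModule k C y} {f : AddMonoidAlgebra k M}
    (h : ∀ g, toLaurent k (φ g) = f * toLaurent k g) : symbol φ = f := by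
  obtain ⟨m₀, hm₀⟩ := hC.translatePoints_nonempty v
  apply single_mul_cancel (m := m₀)
  have h1 := hC.toLaurent_apply φ (mono k hm₀)
  rw [h, toLaurent_mono] at h1
  exact h1.symm

theorem IsFullRational.symbol_ofSymbol (hC : IsFullRational C) (f : AddMonoidAlgebra k M)
    (hf : ∀ m, f.coeff m ≠ 0 → ∀ t ∈ translatePoints C v, m + t ∈ translatePoints C y) :
    symbol (ofSymbol C v y f hf) = f :=
  hC.symbol_eq fun _ => rfl

theorem IsFullRational.symbol_inclusion (hC : IsFullRational C)
    (h : translatePoints C v ⊆ translatePoints C y) : symbol (inclusion k h) = 1 :=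
  hC.symbol_ofSymbol _ _

theorem IsFullRational.symbol_id (hC : IsFullRational C) :
    symbol (LinearMap.id : ConicModule k C v →ₗ[toricAlgebra k C] ConicModule k C v) = 1 :=
  hC.symbol_eq fun _ => (one_mul _).symm

theorem IsFullRational.symbol_comp (hC : IsFullRational C) {w : RealSpace M}
    (ψ : ConicModule k C y →ₗ[toricAlgebra k C] ConicModule k C w)
    (φ : ConicModule k C v →ₗ[toricAlgebra k C] ConicModule k C y) :
    symbol (ψ.comp φ) = symbol ψ * symbol φ :=
  hC.symbol_eq fun g => by
    rw [LinearMap.comp_apply, hC.toLaurent_apply ψ, hC.toLaurent_apply φ, mul_assoc]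

theorem IsFullRational.symbol_add (hC : IsFullRational C)
    (φ ψ : ConicModule k C v →ₗ[toricAlgebra k C] ConicModule k C y) :
    symbol (φ + ψ) = symbol φ + symbol ψ :=
  hC.symbol_eq fun g => by
    rw [LinearMap.add_apply, toLaurent_add, hC.toLaurent_apply φ, hC.toLaurent_apply ψ, add_mul]

theorem IsFullRational.symbol_zero (hC : IsFullRational C) :
    symbol (0 : ConicModule k C v →ₗ[toricAlgebra k C] ConicModule k C y) = 0 :=
  hC.symbol_eq fun g => by rw [LinearMap.zero_apply, toLaurent_zero, zero_mul]

theorem IsFullRational.symbol_support (hC : IsFullRational C)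
    (φ : ConicModule k C v →ₗ[toricAlgebra k C] ConicModule k C y) {m : M}
    (hm : (symbol φ).coeff m ≠ 0) : ∀ t ∈ translatePoints C v, m + t ∈ translatePoints C y := by
  intro t ht
  apply toLaurent_mem (k := k) (φ (mono k ht))
  rw [hC.toLaurent_apply, toLaurent_mono, AddMonoidAlgebra.coeff_mul_single_apply]
  simpa using hm

/-- An isomorphism between conic modules forces one to be a translate of the other. -/
theorem IsFullRational.exists_translate_of_linearEquiv (hC : IsFullRational C)
    (e : ConicModule k C v ≃ₗ[toricAlgebra k C] ConicModule k C y) :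
    ∃ m : M, ∀ n ∈ primitiveNormals C, level y n = n m + level v n := by
  have h1 : symbol e.symm.toLinearMap * symbol e.toLinearMap
      = (1 : AddMonoidAlgebra k M) := by
    rw [← hC.symbol_comp, ← hC.symbol_id (v := v)]
    congr 1
    ext g
    simp
  have h2 : ((symbol e.symm.toLinearMap *
      symbol e.toLinearMap).coeff 0 : k) ≠ 0 := by
    rw [h1, AddMonoidAlgebra.one_def, AddMonoidAlgebra.coeff_single, Finsupp.single_eq_same]
    exact one_ne_zero
  -- The constant term of the product comes from a pair of opposite exponents; their facet
  -- inequalities go in opposite directions and so are equalities.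
  obtain ⟨m₁, m₂, hm₁, hm₂, hsum⟩ := exists_mem_support_of_mul h2
  refine ⟨m₂, fun n hn => ?_⟩
  have h3 := hC.forall_add_mem_iff.1 (hC.symbol_support _ hm₁) n hn
  have h4 := hC.forall_add_mem_iff.1 (hC.symbol_support _ hm₂) n hn
  have h5 : n m₁ + n m₂ = 0 := by rw [← map_add, hsum, map_zero]
  linarith

end Symbols

/-! ### The projective modules and their graded radicals -/

section ProjectiveModules

variable {k : Type*} [Field k] {M : Type*} [AddCommGroup M] {C : PointedCone ℝ (RealSpace M)}
  {s : ℕ} {c : Fin s → RealSpace M} {d : Fin s → ℕ} {y y' : RealSpace M}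

/-- The restriction of a map out of the complete sum to one summand. -/
def restrict (g : ProjectiveOf k C c d y) (p : Σ i : Fin s, Fin (d i)) :
    ConicModule k C (c p.1) →ₗ[toricAlgebra k C] ConicModule k C y :=
  (toHom k C c d g).comp (LinearMap.single (toricAlgebra k C)
    (fun p : Σ i : Fin s, Fin (d i) => ConicModule k C (c p.1)) p)

theorem toHom_apply (g : ProjectiveOf k C c d y) (z : ConicSum k C c d) :
    toHom k C c d g z = ∑ p, restrict g p (z p) := by
  conv_lhs => rw [← LinearMap.sum_single_apply
    (φ := fun p : Σ i : Fin s, Fin (d i) => ConicModule k C (c p.1)) z]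
  rw [map_sum]
  rfl

/-- Composition with a homomorphism of conic modules, as a map of right modules. -/
def postcomp (ψ : ConicModule k C y →ₗ[toricAlgebra k C] ConicModule k C y') :
    ProjectiveOf k C c d y →ₗ[(EndRing k C c d)ᵐᵒᵖ] ProjectiveOf k C c d y' where
  toFun g := LinearMap.comp ψ (toHom k C c d g)
  map_add' _ _ := LinearMap.comp_add _ _ _
  map_smul' _ _ := rfl

variable (k C c d) in
/-- The projection of a complete sum to a summand. -/
def proj (q : Σ i : Fin s, Fin (d i)) :
    ConicSum k C c d →ₗ[toricAlgebra k C] ConicModule k C (c q.1) :=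
  LinearMap.proj (R := toricAlgebra k C)
    (φ := fun p : Σ i : Fin s, Fin (d i) => ConicModule k C (c p.1)) q

/-- Every conic module is a direct summand of a complete sum. -/
theorem IsCompleteSum.exists_linearEquiv (hc : IsCompleteSum k C c d) (y : RealSpace M) :
    ∃ p : Σ i : Fin s, Fin (d i),
      Nonempty (ConicModule k C y ≃ₗ[toricAlgebra k C] ConicModule k C (c p.1)) := by
  obtain ⟨i, hi, -⟩ := hc.2 y
  exact ⟨⟨i, ⟨0, hc.1 i⟩⟩, hi⟩

theorem IsCompleteSum.exists_retraction (hc : IsCompleteSum k C c d) (y : RealSpace M) :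
    ∃ (j : ConicModule k C y →ₗ[toricAlgebra k C] ConicSum k C c d)
      (π : ProjectiveOf k C c d y), (toHom k C c d π).comp j = LinearMap.id := by
  obtain ⟨p, ⟨e⟩⟩ := hc.exists_linearEquiv y
  refine ⟨(LinearMap.single (toricAlgebra k C)
    (fun p : Σ i : Fin s, Fin (d i) => ConicModule k C (c p.1)) p).comp e.toLinearMap,
    e.symm.toLinearMap.comp (proj k C c d p), ?_⟩
  refine LinearMap.ext fun g => ?_
  change e.symm ((Pi.single p (e g) : ConicSum k C c d) p) = g
  rw [Pi.single_eq_same, LinearEquiv.symm_apply_apply]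

/-- Since the conic module is a direct summand of the complete sum, its Hom module is a direct
summand of the regular module. -/
theorem IsCompleteSum.projective (hc : IsCompleteSum k C c d) (y : RealSpace M) :
    Module.Projective (EndRing k C c d)ᵐᵒᵖ (ProjectiveOf k C c d y) := by
  obtain ⟨j, π, hjπ⟩ := hc.exists_retraction y
  let i : ProjectiveOf k C c d y →ₗ[(EndRing k C c d)ᵐᵒᵖ] (EndRing k C c d)ᵐᵒᵖ :=
    { toFun := fun f => MulOpposite.op (j.comp (toHom k C c d f))
      map_add' := fun f g => congrArg MulOpposite.op (LinearMap.comp_add _ _ _)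
      map_smul' := fun _ _ => rfl }
  let r : (EndRing k C c d)ᵐᵒᵖ →ₗ[(EndRing k C c d)ᵐᵒᵖ] ProjectiveOf k C c d y :=
    LinearMap.toSpanSingleton _ _ π
  refine Module.Projective.of_split i r (LinearMap.ext fun f => ?_)
  change (toHom k C c d π).comp (j.comp (toHom k C c d f)) = toHom k C c d f
  rw [← LinearMap.comp_assoc, hjπ, LinearMap.id_comp]

/-- The maps between the projective modules are given by composition. -/
theorem exists_eq_postcomp (hc : IsCompleteSum k C c d) {y y' : RealSpace M}
    (ρ : ProjectiveOf k C c d y →ₗ[(EndRing k C c d)ᵐᵒᵖ] ProjectiveOf k C c d y') :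
    ∃ ψ, ρ = postcomp ψ := by
  obtain ⟨j, π, hjπ⟩ := hc.exists_retraction y
  refine ⟨(toHom k C c d (ρ π)).comp j, LinearMap.ext fun f => ?_⟩
  -- The retraction `π` generates the module, so a homomorphism is determined by its value at `π`.
  have h1 : f = MulOpposite.op (j.comp (toHom k C c d f)) • π := by
    change toHom k C c d f = (toHom k C c d π).comp (j.comp (toHom k C c d f))
    rw [← LinearMap.comp_assoc, hjπ, LinearMap.id_comp]
  conv_lhs => rw [h1, map_smul]
  rfl

/-- The map out of the complete sum with given restrictions to the summands. -/
def sumHom (φ : (p : Σ i : Fin s, Fin (d i)) →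
      ConicModule k C (c p.1) →ₗ[toricAlgebra k C] ConicModule k C y) :
    ConicSum k C c d →ₗ[toricAlgebra k C] ConicModule k C y where
  toFun z := ∑ p, φ p (z p)
  map_add' := by intro a b; simp [Finset.sum_add_distrib]
  map_smul' := by intro a b; simp [Finset.smul_sum]

theorem sumHom_single (φ : (p : Σ i : Fin s, Fin (d i)) →
      ConicModule k C (c p.1) →ₗ[toricAlgebra k C] ConicModule k C y)
    (p : Σ i : Fin s, Fin (d i)) (z : ConicModule k C (c p.1)) :
    sumHom φ (Pi.single p z) = φ p z := by
  change ∑ q, φ q ((Pi.single p z : ConicSum k C c d) q) = _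
  rw [Finset.sum_eq_single p]
  · rw [Pi.single_eq_same]
  · intro q _ hq
    rw [Pi.single_eq_of_ne hq, map_zero]
  · intro h
    exact absurd (Finset.mem_univ p) h

variable [Module.Free ℤ M] [Module.Finite ℤ M]

/-- The symbol of the restriction to a summand. -/
def sym (hC : IsFullRational C) (p : Σ i : Fin s, Fin (d i)) :
    ProjectiveOf k C c d y →+ AddMonoidAlgebra k M where
  toFun g := symbol (restrict g p)
  map_zero' := hC.symbol_zero
  map_add' g g' := hC.symbol_add (restrict g p) (restrict g' p)

theorem toLaurent_toHom (hC : IsFullRational C) (g : ProjectiveOf k C c d y)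
    (z : ConicSum k C c d) :
    toLaurent k (toHom k C c d g z) = ∑ p, sym hC p g * toLaurent k (z p) := by
  rw [toHom_apply, toLaurent_sum]
  exact Finset.sum_congr rfl fun p _ => hC.toLaurent_apply _ _

theorem sym_injective (hC : IsFullRational C) {g g' : ProjectiveOf k C c d y}
    (h : ∀ p, sym hC p g = sym hC p g') : g = g' := by
  refine LinearMap.ext (f := toHom k C c d g) (g := toHom k C c d g') fun z =>
    toLaurent_injective ?_
  rw [toLaurent_toHom hC, toLaurent_toHom hC]
  exact Finset.sum_congr rfl fun p _ => by rw [h]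

theorem sym_support (hC : IsFullRational C) {g : ProjectiveOf k C c d y}
    {p : Σ i : Fin s, Fin (d i)} {m : M} (h : (sym hC p g).coeff m ≠ 0) :
    ∀ n ∈ primitiveNormals C, level y n ≤ n m + level (c p.1) n :=
  hC.forall_add_mem_iff.1 (hC.symbol_support (restrict g p) h)

theorem sym_postcomp (hC : IsFullRational C)
    (ψ : ConicModule k C y →ₗ[toricAlgebra k C] ConicModule k C y')
    (g : ProjectiveOf k C c d y) (p : Σ i : Fin s, Fin (d i)) :
    sym hC p (postcomp ψ g) = symbol ψ * sym hC p g :=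
  hC.symbol_comp ψ (restrict g p)

theorem exists_sym_eq (hC : IsFullRational C)
    (f : (Σ i : Fin s, Fin (d i)) → AddMonoidAlgebra k M)
    (hf : ∀ p m, (f p).coeff m ≠ 0 →
      ∀ n ∈ primitiveNormals C, level y n ≤ n m + level (c p.1) n) :
    ∃ g : ProjectiveOf k C c d y, ∀ p, sym hC p g = f p :=
  ⟨sumHom fun p => ofSymbol C (c p.1) y (f p) fun m hm => hC.forall_add_mem_iff.2 (hf p m hm),
    fun p => hC.symbol_eq fun z => congrArg (toLaurent k) (sumHom_single _ p z)⟩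

/-- An endomorphism of the complete sum followed by the projection to a summand. -/
def endProj (α : EndRing k C c d) (q : Σ i : Fin s, Fin (d i)) : ProjectiveOf k C c d (c q.1) :=
  (proj k C c d q).comp α

theorem sym_smul (hC : IsFullRational C) (α : EndRing k C c d) (g : ProjectiveOf k C c d y)
    (p : Σ i : Fin s, Fin (d i)) :
    sym hC p (MulOpposite.op α • g) = ∑ q, sym hC q g * sym hC p (endProj α q) := by
  refine hC.symbol_eq fun z => ?_
  change toLaurent k (toHom k C c d g (α (Pi.single p z))) = _
  rw [toLaurent_toHom hC, Finset.sum_mul]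
  refine Finset.sum_congr rfl fun q _ => ?_
  rw [mul_assoc]
  congr 1
  exact hC.toLaurent_apply (restrict (endProj α q) p) z

section Radical

/-- The maps `𝔸 → A_x` none of whose homogeneous components is an isomorphism on a summand. -/
def noIsoSubmodule (k : Type*) [Field k] (c : Fin s → RealSpace M) (d : Fin s → ℕ)
    (hC : IsFullRational C) (x : RealSpace M) :
    Submodule (EndRing k C c d)ᵐᵒᵖ (ProjectiveOf k C c d x) where
  carrier := {g | ∀ p m, (∀ n ∈ primitiveNormals C, level x n = n m + level (c p.1) n) →
    (sym hC p g).coeff m = 0}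
  add_mem' {g g'} hg hg' p m h := by
    rw [map_add, AddMonoidAlgebra.coeff_add, Finsupp.add_apply, hg p m h, hg' p m h, add_zero]
  zero_mem' p m _ := by rw [map_zero]; rfl
  smul_mem' α g hg p m h := by
    obtain ⟨α, rfl⟩ := MulOpposite.op_surjective α
    by_contra hcon
    rw [sym_smul, AddMonoidAlgebra.coeff_sum, Finsupp.finsetSum_apply] at hcon
    obtain ⟨q, -, hq⟩ := Finset.exists_ne_zero_of_sum_ne_zero hcon
    obtain ⟨m₁, m₂, h₁, h₂, rfl⟩ := exists_mem_support_of_mul hq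
    -- The facet inequalities for the two factors add up to an equality, so each is an equality; the
    -- first factor then already has an isomorphic component.
    refine h₁ (hg q m₁ fun n hn => ?_)
    have e1 := sym_support hC h₁ n hn
    have e2 := sym_support hC h₂ n hn
    have e3 := h n hn
    rw [map_add] at e3
    linarith

theorem mem_noIsoSubmodule {hC : IsFullRational C} {x : RealSpace M}
    {g : ProjectiveOf k C c d x} :
    g ∈ noIsoSubmodule k c d hC x ↔
      ∀ p m, (∀ n ∈ primitiveNormals C, level x n = n m + level (c p.1) n) →
        (sym hC p g).coeff m = 0 := Iff.rfl

theorem isHomogeneousHom_of_sym (hC : IsFullRational C) {x : RealSpace M} {m : M}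
    {g : ProjectiveOf k C c d x} (h : ∀ p m', m' ≠ m → (sym hC p g).coeff m' = 0) :
    IsHomogeneousHom k C c d m g := by
  intro a z hz
  rw [toLaurent_toHom hC]
  refine Submodule.sum_mem _ fun p _ => ?_
  rw [add_comm, AddMonoidAlgebra.mem_grade_iff]
  intro m' hm'
  obtain ⟨m₁, m₂, h₁, h₂, rfl⟩ := exists_mem_support_of_mul (Finsupp.mem_support_iff.1 hm')
  have e1 : m₁ = m := by
    by_contra hne
    exact h₁ (h p m₁ hne)
  have e2 : m₂ = a := by
    have := (AddMonoidAlgebra.mem_grade_iff k _ _).1 (hz p) (Finsupp.mem_support_iff.2 h₂)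
    simpa using this
  rw [e1, e2, Finset.mem_singleton]

theorem IsHomogeneousHom.sym_eq_zero (hC : IsFullRational C) {x : RealSpace M} {m : M}
    {g : ProjectiveOf k C c d x} (h : IsHomogeneousHom k C c d m g)
    (p : Σ i : Fin s, Fin (d i)) {m' : M} (hm : m' ≠ m) : (sym hC p g).coeff m' = 0 := by
  obtain ⟨m₀, hm₀⟩ := hC.translatePoints_nonempty (c p.1)
  have h1 := h m₀ (Pi.single p (mono k hm₀)) (fun q => by
    by_cases hq : q = p
    · subst hq
      rw [Pi.single_eq_same, toLaurent_mono]
      exact AddMonoidAlgebra.single_mem_grade _ _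
    · rw [Pi.single_eq_of_ne hq, toLaurent_zero]
      exact Submodule.zero_mem _)
  rw [toLaurent_toHom hC, Finset.sum_eq_single p, Pi.single_eq_same, toLaurent_mono,
    AddMonoidAlgebra.mem_grade_iff] at h1
  · by_contra hne
    have h2 : m' + m₀ ∈ (sym hC p g * AddMonoidAlgebra.single m₀ 1).coeff.support := by
      rw [Finsupp.mem_support_iff, AddMonoidAlgebra.coeff_mul_single_apply]
      simpa using hne
    have h3 := Finset.mem_singleton.1 (h1 h2)
    apply hm
    rw [add_comm m₀ m] at h3
    exact add_right_cancel h3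
  · intro q _ hq
    rw [Pi.single_eq_of_ne hq, toLaurent_zero, mul_zero]
  · intro hp
    exact absurd (Finset.mem_univ p) hp

theorem isGradedSubmodule_noIsoSubmodule (hC : IsFullRational C) (x : RealSpace M) :
    IsGradedSubmodule k C c d (noIsoSubmodule k c d hC x) := by
  classical
  intro g hg
  have hex : ∀ m : M, ∃ g' : ProjectiveOf k C c d x,
      ∀ p, sym hC p g' = AddMonoidAlgebra.single m ((sym hC p g).coeff m) := fun m =>
    exists_sym_eq hC _ fun p m' hm' n hn => by
      rw [AddMonoidAlgebra.coeff_single, Finsupp.single_apply] at hm'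
      split_ifs at hm' with h0
      · rw [h0] at hm'
        exact sym_support hC hm' n hn
      · exact absurd rfl hm'
  choose G hG using hex
  set S : Finset M := Finset.univ.biUnion fun p => (sym hC p g).coeff.support with hS
  have hsum : g = ∑ m ∈ S, G m := by
    refine sym_injective hC fun p => ?_
    rw [map_sum, Finset.sum_congr rfl fun m _ => hG m p]
    ext m'
    rw [AddMonoidAlgebra.coeff_sum, Finsupp.finsetSum_apply]
    simp only [AddMonoidAlgebra.coeff_single, Finsupp.single_apply]
    rw [Finset.sum_ite_eq']
    split_ifs with hm'
    · rfl
    · by_contra hne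
      exact hm' (Finset.mem_biUnion.2 ⟨p, Finset.mem_univ _, Finsupp.mem_support_iff.2 hne⟩)
  rw [hsum]
  refine AddSubmonoid.sum_mem _ fun m _ => AddSubmonoid.subset_closure ⟨?_, m, ?_⟩
  · intro p m' h
    rw [hG, AddMonoidAlgebra.coeff_single, Finsupp.single_apply]
    split_ifs with h0
    · rw [h0]; exact hg p m' h
    · rfl
  · refine isHomogeneousHom_of_sym hC fun p m' hm' => ?_
    rw [hG, AddMonoidAlgebra.coeff_single, Finsupp.single_apply, if_neg (Ne.symm hm')]

theorem IsCompleteSum.exists_sym_eq_single (hC : IsFullRational C) (hc : IsCompleteSum k C c d)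
    (y : RealSpace M) : ∃ (p : Σ i : Fin s, Fin (d i)) (m : M) (g : ProjectiveOf k C c d y),
      (∀ n ∈ primitiveNormals C, level y n = n m + level (c p.1) n) ∧
        sym hC p g = AddMonoidAlgebra.single m 1 := by
  classical
  obtain ⟨p, ⟨e⟩⟩ := hc.exists_linearEquiv y
  obtain ⟨m, hm⟩ := hC.exists_translate_of_linearEquiv e.symm
  obtain ⟨g, hg⟩ := exists_sym_eq (k := k) (c := c) (d := d) (y := y) hC
    (Pi.single p (AddMonoidAlgebra.single m 1)) (fun q m' hm' n hn => by
      by_cases hq : q = p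
      · subst hq
        rw [Pi.single_eq_same, AddMonoidAlgebra.coeff_single, Finsupp.single_apply] at hm'
        split_ifs at hm' with h0
        · rw [← h0]; exact (hm n hn).le
        · exact absurd rfl hm'
      · rw [Pi.single_eq_of_ne hq] at hm'
        exact absurd rfl hm')
  exact ⟨p, m, g, hm, by rw [hg, Pi.single_eq_same]⟩

theorem noIsoSubmodule_ne_top (hC : IsFullRational C) (hc : IsCompleteSum k C c d)
    (x : RealSpace M) : noIsoSubmodule k c d hC x ≠ ⊤ := by
  intro htop
  obtain ⟨p, m, g, hm, hg⟩ := hc.exists_sym_eq_single hC x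
  have h1 : g ∈ noIsoSubmodule k c d hC x := htop ▸ Submodule.mem_top
  have h2 := h1 p m hm
  rw [hg, AddMonoidAlgebra.coeff_single, Finsupp.single_eq_same] at h2
  exact one_ne_zero h2

/-- A homogeneous element with a forbidden non-zero coefficient restricts, on some summand, to an
invertible monomial. Every map from the complete sum factors through it, so it generates everything.
Gradedness reduces the claim to homogeneous elements. -/
theorem le_noIsoSubmodule (hC : IsFullRational C) {x : RealSpace M}
    {Q : Submodule (EndRing k C c d)ᵐᵒᵖ (ProjectiveOf k C c d x)}
    (hQ : IsGradedSubmodule k C c d Q) (hQt : Q ≠ ⊤) : Q ≤ noIsoSubmodule k c d hC x := by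
  have key : ∀ h ∈ Q, (∃ m, IsHomogeneousHom k C c d m h) → h ∈ noIsoSubmodule k c d hC x := by
    rintro h hh ⟨m₀, hm₀⟩ p m hpm
    by_contra hne
    apply hQt
    have hm : m = m₀ := by
      by_contra hmne
      exact hne (hm₀.sym_eq_zero hC p hmne)
    subst hm
    have hsingle : sym hC p h = AddMonoidAlgebra.single m ((sym hC p h).coeff m) := by
      classical
      ext m'
      rw [AddMonoidAlgebra.coeff_single, Finsupp.single_apply]
      split_ifs with h0
      · rw [h0]
      · exact hm₀.sym_eq_zero hC p (Ne.symm h0)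
    -- the inverse of the restriction of `h` to the summand
    let r : AddMonoidAlgebra k M := AddMonoidAlgebra.single (-m) ((sym hC p h).coeff m)⁻¹
    have hr : ∀ m', r.coeff m' ≠ 0 → ∀ t ∈ translatePoints C x,
        m' + t ∈ translatePoints C (c p.1) := fun m' hm' => by
      classical
      rw [hC.forall_add_mem_iff]
      intro n hn
      rw [AddMonoidAlgebra.coeff_single, Finsupp.single_apply] at hm'
      split_ifs at hm' with h0
      · rw [← h0, map_neg]
        linarith [hpm n hn]
      · exact absurd rfl hm'
    rw [eq_top_iff]
    rintro f -
    -- Follow `f` by the inverse monomial into the summand `p`; composing `h` with the result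
    -- returns `f`.
    let α : EndRing k C c d := (LinearMap.single (toricAlgebra k C)
      (fun p : Σ i : Fin s, Fin (d i) => ConicModule k C (c p.1)) p).comp
      ((ofSymbol C x (c p.1) r hr).comp (toHom k C c d f))
    have hf : f = MulOpposite.op α • h := by
      refine LinearMap.ext (f := toHom k C c d f)
        (g := toHom k C c d (MulOpposite.op α • h)) fun z => toLaurent_injective ?_
      change _ = toLaurent k (restrict h p (ofSymbol C x (c p.1) r hr (toHom k C c d f z)))
      rw [hC.toLaurent_apply, toLaurent_ofSymbol, ← mul_assoc]
      change _ = sym hC p h * r * _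
      have hone : sym hC p h * r = 1 := by
        rw [hsingle, AddMonoidAlgebra.single_mul_single, add_neg_cancel, mul_inv_cancel₀ hne,
          AddMonoidAlgebra.one_def]
      rw [hone, one_mul]
    rw [hf]
    exact Q.smul_mem _ hh
  intro g hg
  have hle : AddSubmonoid.closure {g | g ∈ Q ∧ ∃ m : M, IsHomogeneousHom k C c d m g} ≤
      (noIsoSubmodule k c d hC x).toAddSubmonoid :=
    AddSubmonoid.closure_le.2 fun h hh => key h hh.1 hh.2
  exact hle (hQ g hg)

theorem gradedRadical_eq (hC : IsFullRational C) (hc : IsCompleteSum k C c d)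
    (x : RealSpace M) : gradedRadical k C c d x = noIsoSubmodule k c d hC x := by
  refine le_antisymm (sSup_le fun Q hQ => le_noIsoSubmodule hC hQ.1 hQ.2) (le_sSup ⟨?_, ?_⟩)
  · exact isGradedSubmodule_noIsoSubmodule hC x
  · exact noIsoSubmodule_ne_top hC hc x

end Radical

end ProjectiveModules

/-! ### Projective dimension from a finite resolution -/

section Resolutions

universe w

open CategoryTheory

variable {Λ : Type w} [Ring Λ]

theorem shortExact_ofHom {X Y Z : Type w} [AddCommGroup X] [AddCommGroup Y] [AddCommGroup Z]
    [Module Λ X] [Module Λ Y] [Module Λ Z] (i : X →ₗ[Λ] Y) (p : Y →ₗ[Λ] Z)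
    (hi : Function.Injective i) (hp : Function.Surjective p) (hip : Function.Exact i p) :
    (ShortComplex.mk (ModuleCat.ofHom i) (ModuleCat.ofHom p) (by
      rw [← ModuleCat.ofHom_comp, hip.linearMap_comp_eq_zero]; rfl)).ShortExact where
  exact := (ShortComplex.ShortExact.moduleCat_exact_iff_function_exact _).2 hip
  mono_f := (ModuleCat.mono_iff_injective _).2 hi
  epi_g := (ModuleCat.epi_iff_surjective _).2 hp

theorem hasProjectiveDimensionLT_one_of_projective (X : Type w) [AddCommGroup X] [Module Λ X]
    (h : Module.Projective Λ X) (n : ℕ) :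
    HasProjectiveDimensionLT (ModuleCat.of Λ X) (n + 1) := by
  have : Projective (ModuleCat.of Λ X) := (IsProjective.iff_projective X).1 h
  exact hasProjectiveDimensionLT_of_ge _ 1 _ (by omega)

/-- The first syzygy sequence of a projective resolution. -/
theorem exact_subtype_range {X Y Z : Type w} [AddCommGroup X] [AddCommGroup Y] [AddCommGroup Z]
    [Module Λ X] [Module Λ Y] [Module Λ Z] {f : X →ₗ[Λ] Y} {ε : Y →ₗ[Λ] Z}
    (h : LinearMap.range f = LinearMap.ker ε) :
    Function.Exact (LinearMap.range f).subtype ε := by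
  rw [LinearMap.exact_iff, Submodule.range_subtype, h]

/-- Dimension shifting: the image of the first differential has a resolution one step shorter. -/
theorem hasProjectiveDimensionLT_of_resolution (e : ℕ) (S : Type w) [AddCommGroup S] [Module Λ S]
    (K : ℕ → Type w) [∀ n, AddCommGroup (K n)] [∀ n, Module Λ (K n)]
    (δ : ∀ n, K (n + 1) →ₗ[Λ] K n) (ε : K 0 →ₗ[Λ] S) (hK : ∀ n, Module.Projective Λ (K n))
    (hε : Function.Surjective ε) (h0 : LinearMap.range (δ 0) = LinearMap.ker ε)
    (hδ : ∀ n, LinearMap.range (δ (n + 1)) = LinearMap.ker (δ n))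
    (hzero : Subsingleton (K (e + 1))) :
    HasProjectiveDimensionLT (ModuleCat.of Λ S) (e + 1) := by
  induction e generalizing S K with
  | zero =>
    have hker : LinearMap.ker ε = ⊥ := by
      rw [← h0, LinearMap.range_eq_bot]
      exact LinearMap.ext fun x => by rw [Subsingleton.elim x 0, map_zero, map_zero]
    exact hasProjectiveDimensionLT_one_of_projective S (Module.Projective.of_equiv
      (LinearEquiv.ofBijective ε ⟨LinearMap.ker_eq_bot.1 hker, hε⟩)) 0
  | succ e ih =>
    have h1 := ih (LinearMap.range (δ 0)) (fun n => K (n + 1)) (fun n => δ (n + 1))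
      (δ 0).rangeRestrict (fun n => hK (n + 1)) (δ 0).surjective_rangeRestrict
      (by rw [LinearMap.ker_rangeRestrict]; exact hδ 0) (fun n => hδ (n + 1)) hzero
    exact (shortExact_ofHom _ ε (Submodule.injective_subtype _) hε
      (exact_subtype_range h0)).hasProjectiveDimensionLT_X₃ (e + 1) h1
      (hasProjectiveDimensionLT_one_of_projective _ (hK 0) _)

/-- If the projective dimension is less than the length of a projective resolution, then the last
map of the resolution has a retraction. -/
theorem exists_retraction_of_hasProjectiveDimensionLT (e : ℕ) (S : Type w) [AddCommGroup S]
    [Module Λ S] (K : ℕ → Type w) [∀ n, AddCommGroup (K n)] [∀ n, Module Λ (K n)]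
    (δ : ∀ n, K (n + 1) →ₗ[Λ] K n) (ε : K 0 →ₗ[Λ] S) (hK : ∀ n, Module.Projective Λ (K n))
    (hε : Function.Surjective ε) (h0 : LinearMap.range (δ 0) = LinearMap.ker ε)
    (hδ : ∀ n, LinearMap.range (δ (n + 1)) = LinearMap.ker (δ n))
    (hzero : Subsingleton (K (e + 2)))
    (hS : HasProjectiveDimensionLT (ModuleCat.of Λ S) (e + 1)) :
    ∃ r : K e →ₗ[Λ] K (e + 1), r.comp (δ e) = LinearMap.id := by
  induction e generalizing S K with
  | zero =>
    have hproj : Projective (ModuleCat.of Λ S) := projective_iff_hasProjectiveDimensionLT_one.2 hS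
    have hproj' : Module.Projective Λ S := (IsProjective.iff_projective S).2 hproj
    have hinj : Function.Injective (δ 0) := by
      rw [← LinearMap.ker_eq_bot, ← hδ 0, LinearMap.range_eq_bot]
      exact LinearMap.ext fun x => by rw [Subsingleton.elim x 0, map_zero, map_zero]
    obtain ⟨σ, hσ⟩ := Module.projective_lifting_property ε LinearMap.id hε
    -- Projectivity of `S` splits the augmentation by `σ`, and `q` is the complementary projection
    -- onto its kernel, which the injective map `δ 0` identifies with `K 1`.
    let q : K 0 →ₗ[Λ] K 0 := LinearMap.id - σ.comp ε
    have hq : ∀ x, q x ∈ LinearMap.range (δ 0) := fun x => by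
      rw [h0, LinearMap.mem_ker]
      have := LinearMap.congr_fun hσ (ε x)
      simp only [LinearMap.comp_apply, LinearMap.id_apply] at this
      simp [q, this]
    let E := LinearEquiv.ofInjective (δ 0) hinj
    refine ⟨E.symm.toLinearMap.comp (q.codRestrict _ hq), LinearMap.ext fun x => ?_⟩
    have h1 : q.codRestrict _ hq (δ 0 x) = E x := by
      apply Subtype.ext
      have h2 : ε (δ 0 x) = 0 := by
        rw [← LinearMap.mem_ker, ← h0]
        exact ⟨x, rfl⟩
      change δ 0 x - σ (ε (δ 0 x)) = δ 0 x
      rw [h2, map_zero, sub_zero]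
    simp only [LinearMap.comp_apply, h1, LinearMap.id_apply]
    exact E.symm_apply_apply x
  | succ e ih =>
    have h1 : HasProjectiveDimensionLT (ModuleCat.of Λ (LinearMap.range (δ 0))) (e + 1) :=
      (shortExact_ofHom _ ε (Submodule.injective_subtype _) hε
        (exact_subtype_range h0)).hasProjectiveDimensionLT_X₁ (e + 1)
        (hasProjectiveDimensionLT_one_of_projective _ (hK 0) _) hS
    exact ih (LinearMap.range (δ 0)) (fun n => K (n + 1)) (fun n => δ (n + 1))
      (δ 0).rangeRestrict (fun n => hK (n + 1)) (δ 0).surjective_rangeRestrict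
      (by rw [LinearMap.ker_rangeRestrict]; exact hδ 0) (fun n => hδ (n + 1)) hzero h1

end Resolutions

/-! ### The chambers just beyond the cells -/

section CellPoints

variable {M : Type*} [AddCommGroup M] (C : PointedCone ℝ (RealSpace M)) (x : RealSpace M)

/-- The real functionals given by the primitive normals. -/
def normalMap (n : primitiveNormals C) : RealSpace M →ₗ[ℝ] ℝ := realFunctional n.1

/-- The upper bounds of the primitive normals on the chamber of `x`. -/
def wall (n : primitiveNormals C) : ℝ := level x n.1

/-- The labels of the cells of codimension `i` of the chamber of `x`. -/
abbrev CellIndex (i : ℕ) : Type _ :=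
  {E : Finset (primitiveNormals C) //
    IsCell (normalMap C) (wall C x) E ∧ rk (normalMap C) E = i}

open Classical in
/-- A point whose conic module is the one attached to the cell labelled by `E`. -/
def cellPoint (E : Finset (primitiveNormals C)) : RealSpace M :=
  if h : ∃ y : RealSpace M, ∀ n : primitiveNormals C,
    level y n.1 = level x n.1 + if n ∈ E then 1 else 0 then h.choose else 0

variable {C x}

-- A point of the cell is moved slightly towards the interior of `C`. Tight normals pass the integer
-- `d_n`, so their ceiling rises by one; the others stay within their strips.
open Classical in
theorem IsFullRational.level_cellPoint (hC : IsFullRational C) {E : Finset (primitiveNormals C)}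
    (hE : IsCell (normalMap C) (wall C x) E) (n : primitiveNormals C) :
    level (cellPoint C x E) n.1 = level x n.1 + if n ∈ E then 1 else 0 := by
  have := (primitiveNormals_finite hC.rational hC.full).to_subtype
  obtain ⟨u, hu⟩ := exists_interior_point hC.rational hC.full
  obtain ⟨z, hz⟩ := hE
  obtain ⟨ε, hε, hlt⟩ := exists_pos_forall_lt
    (p := fun n => if n ∈ E then (0 : ℝ) else normalMap C n z)
    (r := fun n => if n ∈ E then (1 : ℝ) else wall C x n)
    (fun n => (n.1 u : ℝ)) (by
      intro n
      by_cases hn : n ∈ E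
      · simp [hn]
      · simpa [hn] using (hz.2 n hn).2)
  have hex : ∃ y : RealSpace M, ∀ n : primitiveNormals C,
      level y n.1 = level x n.1 + if n ∈ E then 1 else 0 := by
    refine ⟨z + ε • latticePoint u, fun n => ?_⟩
    have hpos : (0 : ℝ) < ε * n.1 u := mul_pos hε (by exact_mod_cast hu n.1 n.2)
    rw [level, map_add, map_smul, realFunctional_latticePoint, smul_eq_mul, Int.ceil_eq_iff]
    have h1 := hlt n
    by_cases hn : n ∈ E
    · simp only [hn, if_true] at h1 ⊢
      have h2 : realFunctional n.1 z = level x n.1 := hz.1 n hn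
      rw [h2]
      push_cast
      constructor <;> linarith
    · simp only [hn, if_false] at h1 ⊢
      have h2 : (level x n.1 : ℝ) - 1 < realFunctional n.1 z := (hz.2 n hn).1
      have h3 : realFunctional n.1 z + ε * n.1 u < level x n.1 := h1
      push_cast
      constructor <;> linarith
  rw [cellPoint, dif_pos hex]
  exact hex.choose_spec n

theorem IsFullRational.level_cellPoint_le_iff (hC : IsFullRational C)
    {E : Finset (primitiveNormals C)} (hE : IsCell (normalMap C) (wall C x) E)
    (f : Module.Dual ℤ M → ℤ) :
    (∀ n ∈ primitiveNormals C, level (cellPoint C x E) n ≤ f n) ↔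
      ∀ n : primitiveNormals C, level x n.1 ≤ f n.1 ∧ (n ∈ E → level x n.1 < f n.1) := by
  constructor
  · intro h n
    have h1 := h n.1 n.2
    rw [hC.level_cellPoint hE] at h1
    by_cases hn : n ∈ E
    · simp only [hn, if_true, forall_true_left] at h1 ⊢
      omega
    · simpa [hn] using h1
  · intro h n hn
    have h1 := h ⟨n, hn⟩
    have h2 := hC.level_cellPoint hE ⟨n, hn⟩
    by_cases hnE : (⟨n, hn⟩ : primitiveNormals C) ∈ E
    · simp only [hnE, if_true, forall_true_left] at h1 h2
      omega
    · simp only [hnE, if_false, false_imp_iff, and_true] at h1 h2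
      omega

/-- The chamber is a product of half-open conditions containing its upper walls; moving `x`
backwards along an interior vector leaves those walls without reaching the lower ones. -/
theorem IsFullRational.isCell_empty (hC : IsFullRational C) :
    IsCell (normalMap C) (wall C x) ∅ := by
  have := (primitiveNormals_finite hC.rational hC.full).to_subtype
  obtain ⟨u, hu⟩ := exists_interior_point hC.rational hC.full
  obtain ⟨ε, hε, hlt⟩ := exists_pos_forall_lt
    (p := fun n : primitiveNormals C => -normalMap C n x)
    (r := fun n => 1 - wall C x n)
    (fun n => (n.1 u : ℝ)) (by
      intro n
      have : (level x n.1 : ℝ) < realFunctional n.1 x + 1 := Int.ceil_lt_add_one _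
      change -realFunctional n.1 x < 1 - (level x n.1 : ℝ)
      linarith)
  refine ⟨x - ε • latticePoint u, by simp, fun n _ => ?_⟩
  have hpos : (0 : ℝ) < ε * n.1 u := mul_pos hε (by exact_mod_cast hu n.1 n.2)
  have h1 := hlt n
  have h2 : realFunctional n.1 x ≤ level x n.1 := Int.le_ceil _
  have h3 : normalMap C n (x - ε • latticePoint u) = realFunctional n.1 x - ε * n.1 u := by
    change realFunctional n.1 _ = _
    rw [map_sub, map_smul, realFunctional_latticePoint, smul_eq_mul]
  rw [h3]
  change -realFunctional n.1 x + ε * n.1 u < 1 - (level x n.1 : ℝ) at h1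
  change (level x n.1 : ℝ) - 1 < _ ∧ _ < (level x n.1 : ℝ)
  constructor <;> linarith

/-- A point of a smaller or equal chamber can be moved beyond the walls it does not satisfy. -/
theorem IsFullRational.exists_isBeyond [Fintype (primitiveNormals C)] (hC : IsFullRational C)
    {w : RealSpace M} (hw : ∀ n : primitiveNormals C, level x n.1 ≤ level w n.1) :
    ∃ q, IsBeyond (normalMap C) (wall C x) ∅
      (Finset.univ.filter fun n : primitiveNormals C => level x n.1 < level w n.1) q := by
  obtain ⟨u, hu⟩ := exists_interior_point hC.rational hC.full
  obtain ⟨ε, hε, hlt⟩ := exists_pos_forall_lt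
    (p := fun n : primitiveNormals C => -realFunctional n.1 w)
    (r := fun n => 1 - (level w n.1 : ℝ))
    (fun n => (n.1 u : ℝ)) (by
      intro n
      have : (level w n.1 : ℝ) < realFunctional n.1 w + 1 := Int.ceil_lt_add_one _
      linarith)
  have h3 : ∀ n, normalMap C n (w - ε • latticePoint u) = realFunctional n.1 w - ε * n.1 u := by
    intro n
    change realFunctional n.1 _ = _
    rw [map_sub, map_smul, realFunctional_latticePoint, smul_eq_mul]
  refine ⟨w - ε • latticePoint u, by simp, fun n hn => ?_, fun n _ hn => ?_⟩
  · have h1 := hlt n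
    have h2 : level x n.1 + 1 ≤ level w n.1 := (Finset.mem_filter.1 hn).2
    have h4 : (level x n.1 : ℝ) + 1 ≤ level w n.1 := by exact_mod_cast h2
    rw [h3]
    change (level x n.1 : ℝ) < _
    linarith
  · have h1 := hlt n
    have h2 : level w n.1 = level x n.1 := by
      have h5 := hw n
      have h6 : ¬ level x n.1 < level w n.1 := fun h =>
        hn (Finset.mem_filter.2 ⟨Finset.mem_univ _, h⟩)
      omega
    have hpos : (0 : ℝ) < ε * n.1 u := mul_pos hε (by exact_mod_cast hu n.1 n.2)
    have h5 : realFunctional n.1 w ≤ level w n.1 := Int.le_ceil _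
    rw [h2] at h1 h5
    rw [h3]
    change (level x n.1 : ℝ) - 1 < _ ∧ _ < (level x n.1 : ℝ)
    constructor <;> linarith

/-- Exactness of the cellular complex at the point `w`. -/
theorem IsFullRational.exists_cellDiff_eq (k : Type*) [Field k] [Fintype (primitiveNormals C)]
    (hC : IsFullRational C) {f : Module.Dual ℤ M → ℤ}
    (hf : ∃ w : RealSpace M, ∀ n ∈ primitiveNormals C, level w n = f n)
    {z : Finset (primitiveNormals C) → k}
    (hz : ∀ E, z E ≠ 0 → IsCell (normalMap C) (wall C x) E ∧
      ∀ n ∈ primitiveNormals C, level (cellPoint C x E) n ≤ f n)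
    (hdz : ∀ E, IsCell (normalMap C) (wall C x) E →
      cellDiff (normalMap C) (wall C x) k z E = 0)
    (hne : (∀ n ∈ primitiveNormals C, level x n = f n) → z = 0) :
    ∃ y : Finset (primitiveNormals C) → k,
      (∀ E, y E ≠ 0 → IsCell (normalMap C) (wall C x) E ∧
        ∀ n ∈ primitiveNormals C, level (cellPoint C x E) n ≤ f n) ∧
      (∀ E, cellDiff (normalMap C) (wall C x) k y E = z E) ∧ (z = 0 → y = 0) := by
  classical
  by_cases hz0 : z = 0
  · exact ⟨0, fun E hE => absurd rfl hE, fun E => by simp [cellDiff, hz0], fun _ => rfl⟩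
  obtain ⟨w, hw⟩ := hf
  obtain ⟨E₀, hE₀⟩ : ∃ E, z E ≠ 0 := by
    by_contra hcon
    push Not at hcon
    exact hz0 (funext hcon)
  have hle : ∀ n : primitiveNormals C, level x n.1 ≤ f n.1 := fun n =>
    ((hC.level_cellPoint_le_iff (hz E₀ hE₀).1 f).1 (hz E₀ hE₀).2 n).1
  obtain ⟨q, hq⟩ := hC.exists_isBeyond (x := x) (w := w) (fun n => by rw [hw n.1 n.2]; exact hle n)
  set F := Finset.univ.filter fun n : primitiveNormals C => level x n.1 < level w n.1 with hF
  have hmemF : ∀ n : primitiveNormals C, n ∈ F ↔ level x n.1 < f n.1 := fun n => by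
    rw [hF, Finset.mem_filter, hw n.1 n.2]; simp
  -- An empty `F` means that `f` gives the levels of `x` itself, a strand excluded by `hne` unless
  -- `z` is zero.
  have hFne : F.Nonempty := by
    rw [Finset.nonempty_iff_ne_empty]
    intro hemp
    refine hz0 (hne fun n hn => ?_)
    have h1 : level x n ≤ f n := hle ⟨n, hn⟩
    have h2 : ¬ level x n < f n := fun h => by
      have := (hmemF ⟨n, hn⟩).2 h
      rw [hemp] at this
      exact absurd this (Finset.notMem_empty _)
    omega
  have hint : ∀ E, E ∈ cellInterval (normalMap C) (wall C x) ∅ F ↔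
      IsCell (normalMap C) (wall C x) E ∧
        ∀ n ∈ primitiveNormals C, level (cellPoint C x E) n ≤ f n := fun E => by
    constructor
    · rintro ⟨h1, -, h2⟩
      rw [Finset.empty_union] at h2
      exact ⟨h1, (hC.level_cellPoint_le_iff h1 f).2 fun n => ⟨hle n, fun hn => (hmemF n).1 (h2 hn)⟩⟩
    · rintro ⟨h1, h2⟩
      refine ⟨h1, Finset.empty_subset _, fun n hn => ?_⟩
      rw [Finset.empty_union, hmemF]
      exact ((hC.level_cellPoint_le_iff h1 f).1 h2 n).2 hn
  have hz' : ∀ E ∉ cellInterval (normalMap C) (wall C x) ∅ F, z E = 0 := fun E hE => by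
    by_contra hcon
    exact hE ((hint E).2 (hz E hcon))
  obtain ⟨y, hy, hdy⟩ := hq.isAcyclicOn k hFne z hz' fun E hE => hdz E hE.1
  refine ⟨y, fun E hE => ?_, fun E => ?_, fun h => absurd h hz0⟩
  · rw [← hint]
    by_contra hcon
    exact hE (hy E hcon)
  · by_cases hE : E ∈ cellInterval (normalMap C) (wall C x) ∅ F
    · exact hdy E hE
    -- The visible family is closed under passing to cells with smaller labels, so its chains have
    -- no boundary outside it.
    · rw [hz' E hE]
      refine Finset.sum_eq_zero fun E' _ => ?_
      by_cases hE' : E' ∈ cellInterval (normalMap C) (wall C x) ∅ F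
      · rw [inc_of_not fun hcov => hE ⟨hcov.isCell', Finset.empty_subset _,
          hcov.subset.trans hE'.2.2⟩]
        simp
      · rw [hy E' hE', mul_zero]

end CellPoints

/-! ### The cellular resolution and its minimality -/

section Resolution

variable (k : Type*) [Field k] {M : Type*} [AddCommGroup M] (C : PointedCone ℝ (RealSpace M))
  {s : ℕ} (c : Fin s → RealSpace M) (d : Fin s → ℕ) (x : RealSpace M)

open Classical in
/-- The inclusion of a conic module in another if there is one. -/
def inclOrZero (y y' : RealSpace M) :
    ConicModule k C y →ₗ[toricAlgebra k C] ConicModule k C y' :=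
  if h : translatePoints C y ⊆ translatePoints C y' then inclusion k h else 0

/-- The terms of the resolution of the graded simple module of the chamber of `x`. -/
abbrev ResolutionTerm (n : ℕ) : Type _ :=
  (E : CellIndex C x n) → ProjectiveOf k C c d (cellPoint C x E.1)

variable {C x} in
theorem IsFullRational.level_cellPoint_mono (hC : IsFullRational C)
    {E E' : Finset (primitiveNormals C)} (h : IsCover (normalMap C) (wall C x) E E') :
    ∀ n ∈ primitiveNormals C, level (cellPoint C x E') n ≤ level (cellPoint C x E) n := by
  classical
  intro n hn
  have h1 := hC.level_cellPoint h.isCell ⟨n, hn⟩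
  have h2 := hC.level_cellPoint h.isCell' ⟨n, hn⟩
  have h3 := @h.subset ⟨n, hn⟩
  simp only at h1 h2
  rw [h1, h2]
  split_ifs with h4 h5
  · exact le_rfl
  · exact absurd (h3 h4) h5
  · omega
  · exact le_rfl

variable {C x} in
theorem rk_eq_zero_iff {E : Finset (primitiveNormals C)} (hC : IsFullRational C)
    (hE : IsCell (normalMap C) (wall C x) E) : rk (normalMap C) E = 0 ↔ E = ∅ := by
  refine ⟨fun h => (hE.eq_of_rk_eq hC.isCell_empty (Finset.empty_subset _)
    (h.trans (rk_empty _).symm)).symm, ?_⟩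
  · rintro rfl
    exact rk_empty _

variable {C x} in
/-- The label of the open cell of full dimension. -/
def emptyIndex (hC : IsFullRational C) : CellIndex C x 0 := ⟨∅, hC.isCell_empty, rk_empty _⟩

variable {C x} in
/-- The augmentation of the resolution. -/
def augmentation (hC : IsFullRational C) :
    ResolutionTerm k C c d x 0 →ₗ[(EndRing k C c d)ᵐᵒᵖ] GradedSimple k C c d x where
  toFun g := Submodule.Quotient.mk
    (postcomp (inclOrZero k C (cellPoint C x (emptyIndex hC).1) x) (g (emptyIndex hC)))
  map_add' _ _ := congrArg Submodule.Quotient.mk (LinearMap.map_add _ _ _)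
  map_smul' α _ := congrArg Submodule.Quotient.mk (LinearMap.map_smul _ α _)

section Coefficients

variable {k C c d x} [Module.Free ℤ M] [Module.Finite ℤ M]

theorem IsFullRational.symbol_inclOrZero (hC : IsFullRational C) {y y' : RealSpace M}
    (h : ∀ n ∈ primitiveNormals C, level y' n ≤ level y n) :
    symbol (inclOrZero k C y y') = 1 := by
  rw [inclOrZero, dif_pos (hC.translatePoints_subset_iff.2 h), hC.symbol_inclusion]

open Classical in
/-- The coefficients of an element of the resolution in a given degree. -/
def cellCoeff (hC : IsFullRational C) {n : ℕ} (g : ResolutionTerm k C c d x n)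
    (p : Σ i : Fin s, Fin (d i)) (m : M) (E : Finset (primitiveNormals C)) : k :=
  if h : IsCell (normalMap C) (wall C x) E ∧ rk (normalMap C) E = n then
    (sym hC p (g ⟨E, h⟩)).coeff m else 0

theorem cellCoeff_apply (hC : IsFullRational C) {n : ℕ} (g : ResolutionTerm k C c d x n)
    (p : Σ i : Fin s, Fin (d i)) (m : M) (E : CellIndex C x n) :
    cellCoeff hC g p m E.1 = (sym hC p (g E)).coeff m := by
  rw [cellCoeff, dif_pos E.2]

theorem of_cellCoeff_ne_zero {hC : IsFullRational C} {n : ℕ} {g : ResolutionTerm k C c d x n}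
    {p : Σ i : Fin s, Fin (d i)} {m : M} {E : Finset (primitiveNormals C)}
    (h : cellCoeff hC g p m E ≠ 0) :
    IsCell (normalMap C) (wall C x) E ∧ rk (normalMap C) E = n ∧
      ∀ n ∈ primitiveNormals C, level (cellPoint C x E) n ≤ n m + level (c p.1) n := by
  by_cases hE : IsCell (normalMap C) (wall C x) E ∧ rk (normalMap C) E = n
  · refine ⟨hE.1, hE.2, ?_⟩
    rw [cellCoeff_apply hC g p m ⟨E, hE⟩] at h
    exact sym_support hC h
  · rw [cellCoeff, dif_neg hE] at h
    exact absurd rfl h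

theorem cellCoeff_injective (hC : IsFullRational C) {n : ℕ} {g g' : ResolutionTerm k C c d x n}
    (h : ∀ p m, ∀ E : CellIndex C x n, cellCoeff hC g p m E.1 = cellCoeff hC g' p m E.1) :
    g = g' := by
  funext E
  refine sym_injective hC fun p => ?_
  ext m
  rw [← cellCoeff_apply, ← cellCoeff_apply]
  exact h p m E

/-- A cell of positive codimension has a non-empty label, which demands a level strictly above that
of `x`. -/
theorem cellCoeff_succ_eq_zero (hC : IsFullRational C) {n : ℕ}
    (g : ResolutionTerm k C c d x (n + 1)) {p : Σ i : Fin s, Fin (d i)} {m : M}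
    (h : ∀ n ∈ primitiveNormals C, level x n = n m + level (c p.1) n) :
    cellCoeff hC g p m = 0 := by
  funext E
  by_contra hE
  obtain ⟨h1, h2, h3⟩ := of_cellCoeff_ne_zero hE
  have hne : E.Nonempty := by
    rw [Finset.nonempty_iff_ne_empty, Ne, ← rk_eq_zero_iff hC h1]
    omega
  obtain ⟨i, hi⟩ := hne
  have h4 := ((hC.level_cellPoint_le_iff h1 _).1 h3 i).2 hi
  have h5 := h i.1 i.2
  omega

theorem mem_ker_augmentation (hC : IsFullRational C) (hc : IsCompleteSum k C c d)
    (g : ResolutionTerm k C c d x 0) :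
    g ∈ LinearMap.ker (augmentation k c d hC) ↔
      ∀ p m, (∀ n ∈ primitiveNormals C, level x n = n m + level (c p.1) n) →
        cellCoeff hC g p m ∅ = 0 := by
  have hlev : ∀ n ∈ primitiveNormals C,
      level x n ≤ level (cellPoint C x (emptyIndex (x := x) hC).1) n := fun n hn => by
    have := hC.level_cellPoint (emptyIndex (x := x) hC).2.1 ⟨n, hn⟩
    simp only [emptyIndex, Finset.notMem_empty, if_false, add_zero] at this
    exact this.ge
  rw [LinearMap.mem_ker]
  change Submodule.Quotient.mk _ = 0 ↔ _
  rw [Submodule.Quotient.mk_eq_zero, gradedRadical_eq hC hc,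
    mem_noIsoSubmodule]
  refine forall₃_congr fun p m _ => ?_
  rw [show cellCoeff hC g p m ∅ = _ from cellCoeff_apply hC g p m (emptyIndex hC)]
  change (sym hC p (postcomp _ _)).coeff m = 0 ↔ _
  rw [sym_postcomp, hC.symbol_inclOrZero hlev, one_mul]

/-- The point attached to the open cell has the levels of `x`, so the inclusions in both directions
exist and have symbol 1. -/
theorem augmentation_surjective (hC : IsFullRational C) :
    Function.Surjective (augmentation k c d (x := x) hC) := by
  classical
  intro q
  obtain ⟨f, rfl⟩ := Submodule.Quotient.mk_surjective _ q
  have hlev : ∀ n ∈ primitiveNormals C,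
      level (cellPoint C x (emptyIndex (x := x) hC).1) n = level x n := fun n hn => by
    have := hC.level_cellPoint (emptyIndex (x := x) hC).2.1 ⟨n, hn⟩
    simp only [emptyIndex, Finset.notMem_empty, if_false, add_zero] at this
    exact this
  refine ⟨Pi.single (emptyIndex hC : CellIndex C x 0)
    (postcomp (inclOrZero k C x (cellPoint C x (emptyIndex hC).1)) f), ?_⟩
  refine congrArg Submodule.Quotient.mk ?_
  rw [Pi.single_eq_same]
  refine sym_injective hC fun p => ?_
  rw [sym_postcomp, sym_postcomp, hC.symbol_inclOrZero fun n hn => (hlev n hn).ge,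
    hC.symbol_inclOrZero fun n hn => (hlev n hn).le, one_mul, one_mul]

end Coefficients

variable [Fintype (primitiveNormals C)]

instance (n : ℕ) : Fintype (CellIndex C x n) := Fintype.ofFinite _

/-- The component of the differential of the resolution for a pair of cells. -/
def boundaryTerm (E E' : Finset (primitiveNormals C)) :
    ProjectiveOf k C c d (cellPoint C x E) →ₗ[(EndRing k C c d)ᵐᵒᵖ]
      ProjectiveOf k C c d (cellPoint C x E') :=
  inc (normalMap C) (wall C x) E E' •
    postcomp (inclOrZero k C (cellPoint C x E) (cellPoint C x E'))

/-- The differential of the resolution. -/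
def resolutionMap (n : ℕ) :
    ResolutionTerm k C c d x (n + 1) →ₗ[(EndRing k C c d)ᵐᵒᵖ] ResolutionTerm k C c d x n where
  toFun g E' := ∑ E : CellIndex C x (n + 1), boundaryTerm k C c d x E.1 E'.1 (g E)
  map_add' g g' := by
    funext E'
    rw [Pi.add_apply, ← Finset.sum_add_distrib]
    exact Finset.sum_congr rfl fun E _ => (boundaryTerm k C c d x E.1 E'.1).map_add (g E) (g' E)
  map_smul' α g := by
    funext E'
    rw [Pi.smul_apply, RingHom.id_apply, Finset.smul_sum]
    exact Finset.sum_congr rfl fun E _ => (boundaryTerm k C c d x E.1 E'.1).map_smul α (g E)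

variable {k C c d x}

theorem projective_resolutionTerm (hc : IsCompleteSum k C c d) (n : ℕ) :
    Module.Projective (EndRing k C c d)ᵐᵒᵖ (ResolutionTerm k C c d x n) := by
  classical
  have := fun E : CellIndex C x n => hc.projective (cellPoint C x E.1)
  exact Module.Projective.of_equiv (DirectSum.linearEquivFunOnFintype (EndRing k C c d)ᵐᵒᵖ
    (CellIndex C x n) fun E => ProjectiveOf k C c d (cellPoint C x E.1))

theorem resolutionMap_single [DecidableEq (CellIndex C x (n + 1))] (E : CellIndex C x (n + 1))
    (f : ProjectiveOf k C c d (cellPoint C x E.1)) (E' : CellIndex C x n) :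
    resolutionMap k C c d x n (Pi.single E f) E' = boundaryTerm k C c d x E.1 E'.1 f := by
  change ∑ G : CellIndex C x (n + 1), boundaryTerm k C c d x G.1 E'.1
    ((Pi.single E f : ResolutionTerm k C c d x (n + 1)) G) = _
  rw [Finset.sum_eq_single E, Pi.single_eq_same]
  · intro G _ hG
    rw [Pi.single_eq_of_ne hG, map_zero]
  · intro h
    exact absurd (Finset.mem_univ _) h

variable [Module.Free ℤ M] [Module.Finite ℤ M]

theorem cellCoeff_resolutionMap (hC : IsFullRational C) {n : ℕ}
    (g : ResolutionTerm k C c d x (n + 1)) (p : Σ i : Fin s, Fin (d i)) (m : M)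
    (E' : CellIndex C x n) :
    cellCoeff hC (resolutionMap k C c d x n g) p m E'.1 =
      cellDiff (normalMap C) (wall C x) k (cellCoeff hC g p m) E'.1 := by
  rw [cellCoeff_apply]
  change (sym hC p (∑ E : CellIndex C x (n + 1), boundaryTerm k C c d x E.1 E'.1 (g E))).coeff m = _
  rw [map_sum, AddMonoidAlgebra.coeff_sum, Finsupp.finsetSum_apply, cellDiff]
  refine Fintype.sum_of_injective (fun E : CellIndex C x (n + 1) => E.1) Subtype.val_injective
    _ _ (fun E hE => ?_) (fun E => ?_)
  · by_cases h0 : cellCoeff hC g p m E = 0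
    · rw [h0, mul_zero]
    · have h1 := of_cellCoeff_ne_zero h0
      exact absurd ⟨⟨E, h1.1, h1.2.1⟩, rfl⟩ hE
  · rw [boundaryTerm, LinearMap.smul_apply, map_zsmul, sym_postcomp, cellCoeff_apply]
    by_cases hcov : IsCover (normalMap C) (wall C x) E.1 E'.1
    · rw [hC.symbol_inclOrZero (hC.level_cellPoint_mono hcov), one_mul, ← zsmul_eq_mul]
      rfl
    · rw [inc_of_not hcov]
      simp

theorem cellDiff_cellCoeff_eq_zero (hC : IsFullRational C) {n : ℕ}
    (g : ResolutionTerm k C c d x (n + 1)) (p : Σ i : Fin s, Fin (d i)) (m : M)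
    {E : Finset (primitiveNormals C)} (hE : rk (normalMap C) E ≠ n) :
    cellDiff (normalMap C) (wall C x) k (cellCoeff hC g p m) E = 0 := by
  refine Finset.sum_eq_zero fun G _ => ?_
  by_cases h0 : cellCoeff hC g p m G = 0
  · rw [h0, mul_zero]
  · rw [inc_of_not, Int.cast_zero, zero_mul]
    intro hcov
    have h1 := (of_cellCoeff_ne_zero h0).2.1
    have h2 := hcov.rk_eq
    omega

/-- All inclusions have symbol 1, so for a fixed summand and exponent the differential is the
cellular one. This decomposes the resolution into strands. -/
theorem cellCoeff_resolutionMap_eq (hC : IsFullRational C) {n : ℕ}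
    (g : ResolutionTerm k C c d x (n + 1)) (p : Σ i : Fin s, Fin (d i)) (m : M) :
    cellCoeff hC (resolutionMap k C c d x n g) p m =
      cellDiff (normalMap C) (wall C x) k (cellCoeff hC g p m) := by
  funext E
  by_cases hE : IsCell (normalMap C) (wall C x) E ∧ rk (normalMap C) E = n
  · exact cellCoeff_resolutionMap hC g p m ⟨E, hE⟩
  · rw [cellCoeff, dif_neg hE]
    symm
    by_cases hrk : rk (normalMap C) E = n
    · refine Finset.sum_eq_zero fun G _ => ?_
      rw [inc_of_not fun hcov => hE ⟨hcov.isCell', hrk⟩, Int.cast_zero, zero_mul]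
    · exact cellDiff_cellCoeff_eq_zero hC g p m hrk

theorem exists_resolutionMap_eq (hC : IsFullRational C) {n : ℕ} (g : ResolutionTerm k C c d x n)
    (hg : ∀ p m E, cellDiff (normalMap C) (wall C x) k (cellCoeff hC g p m) E = 0)
    (hne : ∀ p m, (∀ n ∈ primitiveNormals C, level x n = n m + level (c p.1) n) →
      cellCoeff hC g p m = 0) :
    ∃ h, resolutionMap k C c d x n h = g := by
  classical
  have hex : ∀ p m, ∃ y : Finset (primitiveNormals C) → k,
      (∀ E, y E ≠ 0 → IsCell (normalMap C) (wall C x) E ∧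
        ∀ n ∈ primitiveNormals C, level (cellPoint C x E) n ≤ n m + level (c p.1) n) ∧
      (∀ E, cellDiff (normalMap C) (wall C x) k y E = cellCoeff hC g p m E) ∧
      (cellCoeff hC g p m = 0 → y = 0) := fun p m => by
    -- The relevant point is `c p.1` translated by `m`; its levels bound the cells that may occur in
    -- this strand.
    refine hC.exists_cellDiff_eq k (f := fun n => n m + level (c p.1) n)
      ⟨c p.1 + latticePoint m, fun n _ => ?_⟩ (fun E hE => ?_) (fun E _ => hg p m E) (hne p m)
    · rw [level_add_latticePoint, add_comm]
    · have h1 := of_cellCoeff_ne_zero hE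
      exact ⟨h1.1, h1.2.2⟩
  choose y hy hdy hy0 using hex
  -- The strandwise solutions form Laurent polynomials because they were chosen to be zero wherever
  -- the given coefficients are, which leaves finitely many exponents.
  let S : (Σ i : Fin s, Fin (d i)) → Finset M := fun p =>
    Finset.univ.biUnion fun E : CellIndex C x n => (sym hC p (g E)).coeff.support
  have hS : ∀ p m E, y p m E ≠ 0 → m ∈ S p := fun p m E hE => by
    by_contra hm
    refine hE (congrFun (hy0 p m ?_) E)
    funext G
    by_contra hG
    have h1 := of_cellCoeff_ne_zero hG
    refine hm (Finset.mem_biUnion.2 ⟨⟨G, h1.1, h1.2.1⟩, Finset.mem_univ _,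
      Finsupp.mem_support_iff.2 ?_⟩)
    rw [← cellCoeff_apply]
    exact hG
  let F : Finset (primitiveNormals C) → (Σ i : Fin s, Fin (d i)) → AddMonoidAlgebra k M :=
    fun E p => AddMonoidAlgebra.ofCoeff
      (Finsupp.onFinset (S p) (fun m => y p m E) fun m hm => hS p m E hm)
  have hF : ∀ E p m, (F E p).coeff m = y p m E := fun E p m => rfl
  have hh : ∀ E : CellIndex C x (n + 1), ∃ h : ProjectiveOf k C c d (cellPoint C x E.1),
      ∀ p, sym hC p h = F E.1 p := fun E =>
    exists_sym_eq hC (F E.1) fun p m hm => (hy p m E.1 hm).2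
  clear_value F
  choose h hh using hh
  refine ⟨h, cellCoeff_injective hC fun p m E => ?_⟩
  rw [cellCoeff_resolutionMap, ← hdy p m E.1]
  refine Finset.sum_congr rfl fun G _ => ?_
  by_cases hcov : IsCover (normalMap C) (wall C x) G E.1
  · have hG : IsCell (normalMap C) (wall C x) G ∧ rk (normalMap C) G = n + 1 :=
      ⟨hcov.isCell, by rw [hcov.rk_eq, E.2.2]⟩
    rw [cellCoeff_apply hC h p m ⟨G, hG⟩, hh, hF]
  · rw [inc_of_not hcov, Int.cast_zero, zero_mul, zero_mul]

theorem range_resolutionMap_succ (hC : IsFullRational C) (n : ℕ) :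
    LinearMap.range (resolutionMap k C c d x (n + 1)) =
      LinearMap.ker (resolutionMap k C c d x n) := by
  classical
  refine le_antisymm ?_ fun g hg => ?_
  · rintro _ ⟨h, rfl⟩
    rw [LinearMap.mem_ker]
    refine cellCoeff_injective hC fun p m E => ?_
    rw [cellCoeff_resolutionMap, cellCoeff_resolutionMap_eq, cellDiff_cellDiff, cellCoeff_apply]
    change _ = (sym hC p 0).coeff m
    rw [map_zero]
    rfl
  · refine exists_resolutionMap_eq hC g (fun p m E => ?_) fun p m h =>
      cellCoeff_succ_eq_zero hC g h
    rw [← cellCoeff_resolutionMap_eq, LinearMap.mem_ker.1 hg, cellCoeff]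
    split_ifs with h
    · change (sym hC p 0).coeff m = _
      rw [map_zero]
      rfl
    · rfl

theorem range_resolutionMap_zero (hC : IsFullRational C) (hc : IsCompleteSum k C c d) :
    LinearMap.range (resolutionMap k C c d x 0) =
      LinearMap.ker (augmentation k c d hC) := by
  refine le_antisymm ?_ fun g hg => ?_
  · rintro _ ⟨h, rfl⟩
    rw [mem_ker_augmentation hC hc]
    intro p m hm
    rw [cellCoeff_resolutionMap_eq, cellCoeff_succ_eq_zero hC h hm]
    simp [cellDiff]
  · rw [mem_ker_augmentation hC hc] at hg
    refine exists_resolutionMap_eq hC g (fun p m E => Finset.sum_eq_zero fun G _ => ?_)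
      fun p m hm => ?_
    · by_cases h0 : cellCoeff hC g p m G = 0
      · rw [h0, mul_zero]
      · rw [inc_of_not, Int.cast_zero, zero_mul]
        intro hcov
        have h1 := (of_cellCoeff_ne_zero h0).2.1
        have h2 := hcov.rk_eq
        omega
    · funext E
      by_contra hE
      obtain ⟨h1, h2, -⟩ := of_cellCoeff_ne_zero hE
      rw [rk_eq_zero_iff hC h1] at h2
      subst h2
      exact hE (hg p m hm)

/-- The differentials of the resolution do not have a retraction. -/
theorem resolutionMap_comp_ne_id (hC : IsFullRational C) (hc : IsCompleteSum k C c d) {n : ℕ}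
    (E : CellIndex C x (n + 1))
    (r : ResolutionTerm k C c d x n →ₗ[(EndRing k C c d)ᵐᵒᵖ] ResolutionTerm k C c d x (n + 1)) :
    r.comp (resolutionMap k C c d x n) ≠ LinearMap.id := by
  classical
  intro hr
  have hρ : ∀ E' : CellIndex C x n, ∃ ψ : ConicModule k C (cellPoint C x E'.1)
      →ₗ[toricAlgebra k C] ConicModule k C (cellPoint C x E.1),
      ∀ g, r (Pi.single E' g) E = postcomp ψ g := fun E' => by
    obtain ⟨ψ, hψ⟩ := exists_eq_postcomp hc ((LinearMap.proj E).comp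
      (r.comp (LinearMap.single (EndRing k C c d)ᵐᵒᵖ
        (fun E : CellIndex C x n => ProjectiveOf k C c d (cellPoint C x E.1)) E')))
    exact ⟨ψ, fun g => LinearMap.congr_fun hψ g⟩
  choose ψ hψ using hρ
  have h1 : ∀ f, f = ∑ E' : CellIndex C x n,
      postcomp (ψ E') (boundaryTerm k C c d x E.1 E'.1 f) := fun f => by
    have h2 := congrFun (LinearMap.congr_fun hr (Pi.single E f)) E
    rw [LinearMap.id_apply, Pi.single_eq_same, LinearMap.comp_apply,
      ← Finset.univ_sum_single (resolutionMap k C c d x n (Pi.single E f)), map_sum,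
      Finset.sum_apply] at h2
    refine h2.symm.trans (Finset.sum_congr rfl fun E' _ => ?_)
    rw [hψ, resolutionMap_single]
  obtain ⟨p, m, f, -, hf⟩ := hc.exists_sym_eq_single hC (cellPoint C x E.1)
  have h2 : (sym hC p f).coeff m ≠ 0 := by
    rw [hf, AddMonoidAlgebra.coeff_single, Finsupp.single_eq_same]
    exact one_ne_zero
  rw [h1 f, map_sum, AddMonoidAlgebra.coeff_sum, Finsupp.finsetSum_apply] at h2
  obtain ⟨E', -, hE'⟩ := Finset.exists_ne_zero_of_sum_ne_zero h2
  rw [boundaryTerm, LinearMap.smul_apply, map_zsmul, map_zsmul] at hE'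
  by_cases hcov : IsCover (normalMap C) (wall C x) E.1 E'.1
  · rw [sym_postcomp, sym_postcomp, hC.symbol_inclOrZero (hC.level_cellPoint_mono hcov), one_mul,
      hf] at hE'
    -- Since `f` has a single monomial, its coefficient can only be reproduced by a non-zero
    -- constant term of `ψ E'`. Such a term would include the module of `E'` in that of `E`,
    -- although the latter has a higher level at some normal.
    have h3 : (symbol (ψ E')).coeff 0 ≠ 0 := fun h0 => by
      apply hE'
      rw [AddMonoidAlgebra.coeff_smul, Finsupp.smul_apply,
        AddMonoidAlgebra.coeff_mul_single_apply]
      simp [h0]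
    obtain ⟨i, hi, hi'⟩ := hcov.exists_mem
    have h4 := hC.forall_add_mem_iff.1 (hC.symbol_support _ h3) i.1 i.2
    rw [hC.level_cellPoint hcov.isCell, hC.level_cellPoint hcov.isCell', if_pos hi, if_neg hi',
      map_zero] at h4
    omega
  · rw [inc_of_not hcov, zero_smul] at hE'
    exact hE' rfl

end Resolution

/-! ### Projective dimension as maximal codimension -/

section ProjectiveDimension

variable {k : Type*} [Field k] {M : Type*} [AddCommGroup M] [Module.Free ℤ M] [Module.Finite ℤ M]
  {C : PointedCone ℝ (RealSpace M)} {s : ℕ} {c : Fin s → RealSpace M} {d : Fin s → ℕ}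
  {x : RealSpace M}

-- The resolution stops after degree `e`, giving the upper bound. For `e > 0` the last differential
-- would split if the dimension were smaller; for `e = 0` it suffices that the simple module is
-- non-zero.
open CategoryTheory in
theorem pdimSimple_eq (hC : IsFullRational C) (hc : IsCompleteSum k C c d) {e : ℕ}
    (he : Nonempty (CellIndex C x e)) (he' : IsEmpty (CellIndex C x (e + 1))) :
    pdimSimple k C c d x = e := by
  have := (primitiveNormals_finite hC.rational hC.full).fintype
  have hzero : Subsingleton (ResolutionTerm k C c d x (e + 1)) := inferInstance
  refine le_antisymm ((projectiveDimension_le_iff _ _).2 ?_)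
    ((projectiveDimension_ge_iff _ _).2 fun hlt => ?_)
  · exact hasProjectiveDimensionLT_of_resolution e _ (ResolutionTerm k C c d x)
      (resolutionMap k C c d x) (augmentation k c d hC) (projective_resolutionTerm hc)
      (augmentation_surjective hC) (range_resolutionMap_zero hC hc)
      (range_resolutionMap_succ hC) hzero
  · cases e with
    | zero =>
      rw [hasProjectiveDimensionLT_zero_iff_isZero, ModuleCat.isZero_of_iff_subsingleton,
        Submodule.Quotient.subsingleton_iff, gradedRadical_eq hC hc] at hlt
      exact noIsoSubmodule_ne_top hC hc x hlt
    | succ e =>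
      obtain ⟨r, hr⟩ := exists_retraction_of_hasProjectiveDimensionLT e _
        (ResolutionTerm k C c d x) (resolutionMap k C c d x) (augmentation k c d hC)
        (projective_resolutionTerm hc) (augmentation_surjective hC)
        (range_resolutionMap_zero hC hc) (range_resolutionMap_succ hC) hzero hlt
      exact resolutionMap_comp_ne_id hC hc he.some r hr

end ProjectiveDimension

/-! ### Codimension of a cell as the rank of its label -/

section Codimension

theorem rk_add_finrank_dualCoannihilator {V ι : Type*} [AddCommGroup V] [Module ℝ V]
    [FiniteDimensional ℝ V] (a : ι → V →ₗ[ℝ] ℝ) (E : Finset ι) :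
    rk a E + Module.finrank ℝ (labelSpan a E).dualCoannihilator = Module.finrank ℝ V :=
  Subspace.finrank_add_finrank_dualCoannihilator_eq (labelSpan a E)

theorem rk_eq_finrank {V ι : Type*} [AddCommGroup V] [Module ℝ V]
    [FiniteDimensional ℝ V] {a : ι → V →ₗ[ℝ] ℝ} {E : Finset ι}
    (h : ∀ u, (∀ i ∈ E, a i u = 0) → u = 0) : rk a E = Module.finrank ℝ V := by
  have h1 : (labelSpan a E).dualCoannihilator = ⊥ := eq_bot_iff.2 fun u hu =>
    h u fun i hi => (Submodule.mem_dualCoannihilator _).1 hu _ (mem_labelSpan hi)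
  rw [← rk_add_finrank_dualCoannihilator a E, h1, finrank_bot, add_zero]

/-- A non-empty cell is relatively open in the affine subspace cut out by its tight functionals, so
its direction is their common kernel. -/
theorem finrank_quotient_direction_affineSpan {V ι : Type*} [AddCommGroup V] [Module ℝ V]
    [FiniteDimensional ℝ V] [Finite ι] {a : ι → V →ₗ[ℝ] ℝ} {b : ι → ℝ} {E : Finset ι}
    (hE : IsCell a b E) :
    Module.finrank ℝ (V ⧸ (affineSpan ℝ {y | InCell a b E y}).direction) = rk a E := by
  have h : (affineSpan ℝ {y | InCell a b E y}).direction =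
      (labelSpan a E).dualCoannihilator := by
    rw [direction_affineSpan, vectorSpan_def]
    refine le_antisymm (Submodule.span_le.2 ?_) fun u hu => ?_
    · rintro _ ⟨y, hy, z, hz, rfl⟩
      refine (Submodule.mem_dualCoannihilator _).2 fun f hf =>
        apply_eq_zero_of_mem_labelSpan (fun i hi => ?_) hf
      change a i (y - z) = 0
      rw [map_sub, hy.1 i hi, hz.1 i hi, sub_self]
    · rw [Submodule.mem_dualCoannihilator] at hu
      obtain ⟨y, hy⟩ := hE
      obtain ⟨ε, hε, hlt⟩ := exists_pos_forall_lt (ι := {i // i ∉ E} ⊕ {i // i ∉ E})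
        (p := Sum.elim (fun i => a i y) (fun i => - a i y))
        (r := Sum.elim (fun i => b i) (fun i => 1 - b i))
        (Sum.elim (fun i => a i u) (fun i => - a i u)) (by
          rintro (i | i)
          · exact (hy.2 i i.2).2
          · have := (hy.2 i i.2).1
            simp only [Sum.elim_inr]
            linarith)
      have hmem : InCell a b E (y + ε • u) := by
        refine ⟨fun i hi => ?_, fun i hi => ?_⟩
        · rw [map_add, map_smul, hu _ (mem_labelSpan hi), smul_zero, add_zero, hy.1 i hi]
        · have h1 := hlt (Sum.inl ⟨i, hi⟩)
          have h2 := hlt (Sum.inr ⟨i, hi⟩)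
          simp only [Sum.elim_inl, Sum.elim_inr] at h1 h2
          rw [map_add, map_smul, smul_eq_mul]
          constructor <;> linarith
      have h1 : ε • u ∈ Submodule.span ℝ ({y | InCell a b E y} -ᵥ {y | InCell a b E y}) :=
        Submodule.subset_span ⟨y + ε • u, hmem, y, hy, by simp⟩
      exact (Submodule.smul_mem_iff _ hε.ne').1 h1
  have h2 := Submodule.finrank_quotient_add_finrank (labelSpan a E).dualCoannihilator
  rw [← rk_add_finrank_dualCoannihilator a E] at h2
  rw [h]
  exact Nat.add_right_cancel h2

variable {M : Type*} [AddCommGroup M] {C : PointedCone ℝ (RealSpace M)} {x : RealSpace M}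

theorem finrank_realSpace [Module.Free ℤ M] : Module.finrank ℝ (RealSpace M) = Module.finrank ℤ M :=
  Module.finrank_baseChange

theorem translatePoints_eq_of_mem_chamber (k : Type*) [Field k] {y : RealSpace M}
    (hy : y ∈ chamber k C x) : translatePoints C y = translatePoints C x := by
  have key : ∀ {v w : RealSpace M}, conicModule k C v = conicModule k C w →
      translatePoints C v ⊆ translatePoints C w := fun {v w} h m hm => by
    have h1 : toLaurent k (mono k hm) ∈ conicModule k C w := h ▸ (mono k hm).2
    refine toLaurent_mem (k := k) (⟨_, h1⟩ : conicModule k C w) ?_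
    change (AddMonoidAlgebra.single m (1 : k)).coeff m ≠ 0
    rw [AddMonoidAlgebra.coeff_single, Finsupp.single_eq_same]
    exact one_ne_zero
  exact (key hy).antisymm (key hy.symm)

theorem openCell_image (E : Finset (primitiveNormals C)) :
    openCell C x (Subtype.val '' {n : primitiveNormals C | n ∉ E}) =
      {y | InCell (normalMap C) (wall C x) E y} := by
  ext y
  refine ⟨fun h => ⟨fun n hn => h.2 n.1 ⟨n.2, ?_⟩, fun n hn => h.1 n.1 ⟨n, hn, rfl⟩⟩,
    fun h => ⟨?_, ?_⟩⟩
  · rintro ⟨n', hn', heq⟩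
    rw [Subtype.val_injective heq] at hn'
    exact hn' hn
  · rintro _ ⟨n, hn, rfl⟩
    exact h.2 n hn
  · rintro n ⟨hn, hn'⟩
    refine h.1 ⟨n, hn⟩ ?_
    by_contra hcon
    exact hn' ⟨⟨n, hn⟩, hcon, rfl⟩

variable [Module.Free ℤ M] [Module.Finite ℤ M]

/-- All points of a chamber have the same levels, so its cells may be computed from `x`; passing
from `Ω` to its complement matches them with labels. -/
theorem codim_image_cells (k : Type*) [Field k] (hC : IsFullRational C) :
    codim '' cells C (chamber k C x) = {e | Nonempty (CellIndex C x e)} := by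
  classical
  have := (primitiveNormals_finite hC.rational hC.full).fintype
  ext e
  constructor
  · rintro ⟨_, ⟨hne, y, hy, Ω, hΩ, rfl⟩, rfl⟩
    have hT := translatePoints_eq_of_mem_chamber k hy
    have hlev : ∀ n ∈ primitiveNormals C, level y n = level x n := fun n hn =>
      le_antisymm (hC.translatePoints_subset_iff.1 hT.ge n hn)
        (hC.translatePoints_subset_iff.1 hT.le n hn)
    have hwall : wall C y = wall C x := funext fun n => congrArg Int.cast (hlev n.1 n.2)
    let E : Finset (primitiveNormals C) := Finset.univ.filter fun n => n.1 ∉ Ω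
    have hE : Subtype.val '' {n : primitiveNormals C | n ∉ E} = Ω := by
      ext n
      constructor
      · rintro ⟨n, hn, rfl⟩
        by_contra hcon
        exact hn (Finset.mem_filter.2 ⟨Finset.mem_univ _, hcon⟩)
      · intro hn
        exact ⟨⟨n, hΩ hn⟩, fun hcon => (Finset.mem_filter.1 hcon).2 hn, rfl⟩
    rw [← hE, openCell_image, hwall] at hne ⊢
    exact ⟨E, hne, (finrank_quotient_direction_affineSpan hne).symm⟩
  · rintro ⟨E, hE, rfl⟩
    refine ⟨_, ⟨?_, x, rfl, _, ?_, (openCell_image E).symm⟩,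
      finrank_quotient_direction_affineSpan hE⟩
    · exact hE
    · rintro _ ⟨n, -, rfl⟩
      exact n.2

theorem rk_le_finrank (E : Finset (primitiveNormals C)) :
    rk (normalMap C) E ≤ Module.finrank ℤ M := by
  rw [← finrank_realSpace, ← Subspace.dual_finrank_eq]
  exact Submodule.finrank_le _

theorem rk_univ [Fintype (primitiveNormals C)] (hC : IsFullRational C)
    (hpointed : IsStronglyConvex C) :
    rk (normalMap C) Finset.univ = Module.finrank ℤ M := by
  rw [← finrank_realSpace]
  exact rk_eq_finrank fun u hu => eq_zero_of_primitiveNormals hC.rational hC.full hpointed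
    fun n hn => hu ⟨n, hn⟩ (Finset.mem_univ _)

end Codimension

/-! ### The vertex of a chamber with free conic module -/

section Free

variable {k : Type*} [Field k] {M : Type*} [AddCommGroup M] [Module.Free ℤ M] [Module.Finite ℤ M]
  {C : PointedCone ℝ (RealSpace M)} {x : RealSpace M}

variable (k C) in
/-- The conic module of the origin is the toric algebra. -/
def zeroEquiv : ConicModule k C 0 ≃ₗ[toricAlgebra k C] toricAlgebra k C where
  toFun g := ⟨g.1, g.2⟩
  invFun r := ⟨r.1, r.2⟩
  map_add' _ _ := rfl
  map_smul' _ _ := rfl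
  left_inv _ := rfl
  right_inv _ := rfl

/-- A free conic module has rank one. -/
theorem exists_linearEquiv_zero_of_free (hC : IsFullRational C)
    (hfree : Module.Free (toricAlgebra k C) (ConicModule k C x)) :
    Nonempty (ConicModule k C 0 ≃ₗ[toricAlgebra k C] ConicModule k C x) := by
  obtain ⟨I, b⟩ := Module.Free.exists_basis (toricAlgebra k C) (ConicModule k C x)
  obtain ⟨u, hu⟩ := hC.exists_single_mul_mem k x
  have hsub : Subsingleton I := by
    refine ⟨fun i j => ?_⟩
    by_contra hij
    -- After translation into the commutative toric algebra, two basis elements become coefficients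
    -- of a relation between each other; distinct indices would force one of them to be zero.
    have h1 : (⟨_, hu (b i)⟩ : toricAlgebra k C) • b j
        = (⟨_, hu (b j)⟩ : toricAlgebra k C) • b i := by
      apply toLaurent_injective
      simp only [toLaurent_smul]
      ring
    have h2 := congrArg (fun g => b.repr g j) h1
    simp only [map_smul, Module.Basis.repr_self, Finsupp.smul_apply, Finsupp.single_eq_same,
      Finsupp.single_eq_of_ne (Ne.symm hij), smul_eq_mul, mul_one, mul_zero] at h2
    have h3 : AddMonoidAlgebra.single u 1 * toLaurent k (b i) = 0 := congrArg Subtype.val h2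
    refine b.ne_zero i (toLaurent_injective (single_mul_cancel (m := u) ?_))
    rw [mul_comm, h3, toLaurent_zero, zero_mul]
  have hne : Nonempty I := by
    by_contra hcon
    rw [not_nonempty_iff] at hcon
    obtain ⟨m, hm⟩ := hC.translatePoints_nonempty x
    have h1 : mono k hm = 0 := b.repr.injective (Subsingleton.elim _ _)
    have h2 := congrArg (fun g => (toLaurent k g).coeff m) h1
    simp at h2
  exact ⟨(zeroEquiv k C).trans
    (b.repr.trans (Finsupp.uniqueLinearEquiv _ _ hne.some)).symm⟩

/-- Freeness makes the module a monomial translate of the toric algebra. The translating lattice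
point attains every level, and by pointedness the normals that label it have full rank. -/
theorem nonempty_cellIndex_of_free (hC : IsFullRational C) (hpointed : IsStronglyConvex C)
    (hfree : Module.Free (toricAlgebra k C) (ConicModule k C x)) :
    Nonempty (CellIndex C x (Module.finrank ℤ M)) := by
  have := (primitiveNormals_finite hC.rational hC.full).fintype
  obtain ⟨e⟩ := exists_linearEquiv_zero_of_free hC hfree
  obtain ⟨m, hm⟩ := hC.exists_translate_of_linearEquiv e
  refine ⟨Finset.univ, ⟨latticePoint m, fun n _ => ?_,
    fun n hn => absurd (Finset.mem_univ n) hn⟩, rk_univ hC hpointed⟩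
  change realFunctional n.1 (latticePoint m) = (level x n.1 : ℝ)
  rw [realFunctional_latticePoint, hm n.1 n.2]
  simp [level]

end Free

end ConicModules

end

theorem corollary6p7 {k : Type*} [Field k] {M : Type*} [AddCommGroup M]
    [Module.Free ℤ M] [Module.Finite ℤ M]
    (C : PointedCone ℝ (ConicModules.RealSpace M))
    (hrational : ConicModules.IsRationalPolyhedral C)
    (hfull : ConicModules.IsFullDimensional C)
    (hpointed : ConicModules.IsStronglyConvex C)
    {s : ℕ} (c : Fin s → ConicModules.RealSpace M) (d : Fin s → ℕ)
    (hcomplete : ConicModules.IsCompleteSum k C c d)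
    (x : ConicModules.RealSpace M) :
    (∃ e : ℕ,
      IsGreatest (ConicModules.codim '' ConicModules.cells C (ConicModules.chamber k C x)) e ∧
      ConicModules.pdimSimple k C c d x = (e : WithBot ℕ∞)) ∧
    ConicModules.pdimSimple k C c d x ≤ (Module.finrank ℤ M : WithBot ℕ∞) ∧
    (Module.Free (ConicModules.toricAlgebra k C) (ConicModules.ConicModule k C x) →
      ConicModules.pdimSimple k C c d x = (Module.finrank ℤ M : WithBot ℕ∞)) := by
  have hC : ConicModules.IsFullRational C := ⟨hrational, hfull⟩
  have hbdd : ∀ e ∈ {e | Nonempty (ConicModules.CellIndex C x e)}, e ≤ Module.finrank ℤ M := by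
    rintro _ ⟨E, -, rfl⟩
    exact ConicModules.rk_le_finrank E
  -- The maximum exists because the open cell supplies codimension zero and the rank bounds all
  -- codimensions.
  obtain ⟨e, he⟩ : ∃ e, IsGreatest {e | Nonempty (ConicModules.CellIndex C x e)} e :=
    ⟨_, Nat.sSup_mem ⟨0, ⟨ConicModules.emptyIndex hC⟩⟩ ⟨_, hbdd⟩,
      fun _ h => le_csSup ⟨_, hbdd⟩ h⟩
  have hpdim : ConicModules.pdimSimple k C c d x = e :=
    ConicModules.pdimSimple_eq hC hcomplete he.1
      (not_nonempty_iff.1 fun h => absurd (he.2 h) (by simp))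
  refine ⟨⟨e, ?_, hpdim⟩, ?_, fun hfree => ?_⟩
  · rw [ConicModules.codim_image_cells k hC]
    exact he
  · rw [hpdim]
    exact_mod_cast hbdd e he.1
  · rw [hpdim, le_antisymm (hbdd e he.1)
      (he.2 (ConicModules.nonempty_cellIndex_of_free hC hpointed hfree))]
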